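/- **Machine model.** Machines are multitape Turing machines over the binary alphabet (plus blank), given by finitely many quadruples (state, action on each tape, next state), where the action on a tape is to rewrite the scanned symbol, to shift the head, or to leave the tape alone. $R(\langle x,p\rangle)=\langle y,q\rangle$ means that $R$, started in its start state with $x$ on the first tape, $p$ on the second and all other tapes blank, reaches its halting state with $y$ on the first tape, $q$ on the second and all other tapes blank (heads on the first symbols both times). $R$ is *reversible* if every configuration has at most one successor and at most one predecessor, no quadruple leaves the halting state and no quadruple enters the start state. A reversible machine $UR$ is *universal* if for every reversible machine $R$ there is a constant $c_R$ such that, whenever $R(\langle x,p\rangle)=\langle y,q\rangle$ in at most $T$ steps, there are $p',q'$ with $|p'|+|q'|\le |p|+|q|+c_R$ and $UR(\langle x,p'\rangle)=\langle y,q'\rangle$ in at most $c_R N\lfloor\log_2 N\rfloor+c_R$ steps, where $N=T+|x|+|p|$ and $N\lfloor\log_2 N\rfloor$ is read as $0$ for $N=0$. **Irreversibility cost.** Fix a universal reversible Turing machine $UR$. For a time bound $t:\mathbb N\to\mathbb N$ and binary strings $x,y$, let $$E^t(x,y)=\min\{|p|+|q| : UR(\langle x,p\rangle)=\langle y,q\rangle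 \text{ in at most } t(|x|) \text{ steps}\},$$ with $E^t(x,y)=\infty$ if there are no such $p,q$. Let $\epsilon$ be the empty string; $E^t(x,\epsilon)$ is the cost of erasing $x$ in time $t$. **Theorem (Irreversibility-time trade-off hierarchy).** Let $t_k(n)=2^{kn}$. For every sufficiently large $n$ (depending on $UR$) there is a binary string $x$ of length $n$ such that, with $m=\lfloor\frac12\sqrt n\rfloor$, we have $t_1(n)<t_2(n)<\dots<t_m(n)$, the costs $E^{t_1}(x,\epsilon),\dots,E^{t_m}(x,\epsilon)$ are all finite, and $$E^{t_1}(x,\epsilon)>E^{t_2}(x,\epsilon)>\dots>E^{t_m}(x,\epsilon).$$ -/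

import Mathlib

/-- The part of a quadruple that concerns one tape: rewrite the scanned symbol `a` into `b`,
shift the head without reading, or leave the tape alone without reading.
Tape symbols are `some false`, `some true` (the bits 0, 1) and `none` (blank). -/
inductive TapeAction : Type where
  | write (a b : Option Bool)
  | shift (d : Turing.Dir)
  | stay

/-- `A.Rel S T`: the action `A` is applicable to the tape `S` and turns it into `T`. -/
def TapeAction.Rel : TapeAction → Turing.Tape (Option Bool) → Turing.Tape (Option Bool) → Prop
  | .write a b, S, T => S.head = a ∧ T = S.write b
  | .shift d, S, T => T = S.move d
  | .stay, S, T => T = S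

/-- A multitape Turing machine over the binary alphabet with blank, given by quadruples
`(state, actions on the tapes, next state)`. Tape `0` holds the input `x` (at the end the output
`y`), tape `1` holds the record `p` (at the end the garbage `q`), and there are `work` further
tapes. -/
structure QuadMachine : Type 1 where
  State : Type
  finite_state : Finite State
  work : ℕ
  start : State
  halt : State
  rules : Set (State × (Fin (work + 2) → TapeAction) × State)

namespace QuadMachine

/-- Instantaneous descriptions: the state and the tapes with their heads. -/
structure Config (M : QuadMachine) : Type where
  state : M.State
  tape : Fin (M.work + 2) → Turing.Tape (Option Bool)

/-- One step of computation. -/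
def Step (M : QuadMachine) (c d : M.Config) : Prop :=
  ∃ r ∈ M.rules, c.state = r.1 ∧ d.state = r.2.2 ∧ ∀ i, (r.2.1 i).Rel (c.tape i) (d.tape i)

/-- `M.Steps T c d`: exactly `T` steps lead from `c` to `d`. -/
inductive Steps (M : QuadMachine) : ℕ → M.Config → M.Config → Prop
  | refl (c : M.Config) : Steps M 0 c c
  | tail {T : ℕ} {c d e : M.Config} : Steps M T c d → M.Step d e → Steps M (T + 1) c e

/-- The configuration in state `s` with `u` on tape `0` and `v` on tape `1`, both heads on the
first symbol, and all other tapes blank. -/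
def pairConfig (M : QuadMachine) (s : M.State) (u v : List Bool) : M.Config where
  state := s
  tape := fun i =>
    if i = 0 then Turing.Tape.mk₁ (u.map some)
    else if i = 1 then Turing.Tape.mk₁ (v.map some)
    else Turing.Tape.mk₁ []

/-- `M(⟨x, p⟩) = ⟨y, q⟩` in at most `t` steps. -/
def ComputesIn (M : QuadMachine) (t : ℕ) (x p y q : List Bool) : Prop :=
  ∃ T ≤ t, M.Steps T (M.pairConfig M.start x p) (M.pairConfig M.halt y q)

/-- Reversible Turing machines: every configuration has at most one successor and at most one
predecessor; no quadruple leaves the halting state, and none enters the start state (so that the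
inverse machine halts exactly when it is back at its input). -/
structure IsReversible (M : QuadMachine) : Prop where
  deterministic : ∀ c d d' : M.Config, M.Step c d → M.Step c d' → d = d'
  codeterministic : ∀ c c' d : M.Config, M.Step c d → M.Step c' d → c = c'
  source_ne_halt : ∀ r ∈ M.rules, r.1 ≠ M.halt
  target_ne_start : ∀ r ∈ M.rules, r.2.2 ≠ M.start

/-- A universal reversible Turing machine: every reversible Turing machine `R` is
simulated at the price of a constant number of additional bits and with time overhead
`O(N log N)`, where `N` is the number of simulated steps plus the length of the input.
The constant depends on `R` only. -/
def IsUniversalReversible (U : QuadMachine) : Prop :=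
  U.IsReversible ∧
    ∀ R : QuadMachine, R.IsReversible → ∃ c : ℕ, ∀ (T : ℕ) (x p y q : List Bool),
      R.ComputesIn T x p y q →
        ∃ p' q' : List Bool, p'.length + q'.length ≤ p.length + q.length + c ∧
          U.ComputesIn
            (c * ((T + x.length + p.length) * Nat.log 2 (T + x.length + p.length)) + c)
            x p' y q'

/-- The `t`-time-bounded irreversibility cost `E^t(x, y)` with respect to `M`: the minimum of
`|p| + |q|` over all `p, q` with `M(⟨x, p⟩) = ⟨y, q⟩` in at most `t(|x|)` steps
(`⊤` if there are none). -/
noncomputable def irrevCost (M : QuadMachine) (t : ℕ → ℕ) (x y : List Bool) : ℕ∞ :=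
  ⨅ (p : List Bool) (q : List Bool) (_ : M.ComputesIn (t x.length) x p y q),
    ((p.length + q.length : ℕ) : ℕ∞)

end QuadMachine

/-- The time bounds `t_k(n) = 2^(kn)`. -/
def expTime (k n : ℕ) : ℕ := 2 ^ (k * n)

/-! Let `γ` be about √n/8, `g = 12γ` and `L = n - g`. Running the reversible machine `U` backwards
from empty output and garbage `q` is a deterministic computation, so `q` describes at most one
string. Call a string of length `L` hard if no `q` with `|q| + γ ≤ L` yields, within `2^(n(j+1))`
backward steps, a start state with the first `|q| + γ` bits of the string on the first tape; here `j
= ⌊(L - |q| - γ)/g⌋`, so shorter garbage is given more time. Such a `q` hits at most `2^(L-|q|-γ)`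
strings. Summing over all `q` gives at most `(L-γ+1) 2^(L-γ) < 2^L`, so hard strings exist
(`exists_hard`). The witness `x` is the least hard string, read as a binary number with its lowest
bit first, followed by `g` zeros.

Lower bound. If `U` erases `x` within `2^(jn)` steps leaving `q`, then `q` hits `x`
(`hits_of_computesIn`). Hardness forces `|q| + γ > n - jg`.

Upper bound. With `k = κ + 1`, keep the first `n - kg = e + γ` bits as garbage and recompute the
rest. The final `g` bits are zero. The `κg` bits in between form the least continuation of the kept
part that is hit by no program longer than `e` (`levelCount_of_hard`): programs of length at most
`e` inspect kept bits only, and those already pass. The programs to be tried are allowed at most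
`2^(nκ)` steps. Candidates, programs and steps multiply to at most `2^(κg) · 2^(e+g) · 2^(nκ) =
2^(kn-γ)`, up to polynomial factors, and `2^γ` absorbs these together with the overhead of
universality (`run_erase_of_hard`, `time_le`). The two parameters are supplied in unary and returned
unchanged, so the cost is at most `n - kg + 2(k+γ+1) + c`. Since `g = 12γ`, this is below the lower
bound for every earlier level (`exists_hierarchy`).

The eraser must itself be reversible. It is written in a small structured language whose tests and
loops carry assertions that determine their inverses (`Frag`). The search is computed, its result is
used to cancel part of `x`, and the search is undone (`run_conj`). Only after this are the zeroed
cells removed, so no history is left. -/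

namespace RevMachine

open Turing

/-! ### Tapes -/

theorem tape_ext {S T : Tape (Option Bool)} (h : ∀ i, S.nth i = T.nth i) : S = T := by
  obtain ⟨a, L, R⟩ := S
  obtain ⟨b, L', R'⟩ := T
  have h0 : a = b := h 0
  have hR : R = R' := ListBlank.ext fun i => h ((i + 1 : ℕ) : ℤ)
  have hL : L = L' := ListBlank.ext fun i => h (Int.negSucc i)
  rw [h0, hR, hL]

theorem move_right_left (T : Tape (Option Bool)) : (T.move Dir.left).move Dir.right = T :=
  tape_ext fun i => by rw [Tape.move_right_nth, Tape.move_left_nth]; congr 1; ring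

theorem move_left_right (T : Tape (Option Bool)) : (T.move Dir.right).move Dir.left = T :=
  tape_ext fun i => by rw [Tape.move_left_nth, Tape.move_right_nth]; congr 1; ring

theorem write_write (T : Tape (Option Bool)) (a b : Option Bool) :
    (T.write a).write b = T.write b := rfl

theorem write_head (T : Tape (Option Bool)) (a : Option Bool) : (T.write a).head = a := rfl

theorem write_eq_self {T : Tape (Option Bool)} {a : Option Bool} (h : T.head = a) :
    T.write a = T := by subst h; exact T.write_self

theorem move_right_iterate_nth (T : Tape (Option Bool)) (n : ℕ) (i : ℤ) :
    ((Tape.move Dir.right)^[n] T).nth i = T.nth (i + n) := by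
  induction n generalizing i with
  | zero => simp
  | succ n ih =>
    rw [Function.iterate_succ_apply', Tape.move_right_nth, ih]; congr 1; push_cast; ring

theorem mk₁_nth_nat (l : List (Option Bool)) (n : ℕ) : (Tape.mk₁ l).nth n = l.getI n := by
  rw [Tape.mk₁, Tape.mk₂, Tape.mk'_nth_nat, ListBlank.nth_mk]

theorem mk₁_nth_negSucc (l : List (Option Bool)) (n : ℕ) :
    (Tape.mk₁ l).nth (Int.negSucc n) = none := by
  change (ListBlank.mk ([] : List (Option Bool))).nth n = none
  rw [ListBlank.nth_mk, List.getI_nil]; rfl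

theorem getI_map_some (l : List Bool) (n : ℕ) : (l.map some).getI n = l[n]? := by
  rcases lt_or_ge n l.length with h | h
  · rw [List.getI_eq_getElem _ (by simpa using h)]; simp [h]
  · rw [List.getI_eq_default _ (by simpa using h)]
    rw [List.getElem?_eq_none h]; rfl

/-- The tape with the bits of `l` on the cells `1, 2, …`, the head on cell `h`; cell `0` is the
blank left of the word. -/
def word (l : List Bool) (h : ℕ) : Tape (Option Bool) :=
  (Tape.move Dir.right)^[h] ((Tape.mk₁ (l.map some)).move Dir.left)

/-- The content of the cell `i` of `word l h`. -/
def cell (l : List Bool) : ℤ → Option Bool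
  | Int.ofNat 0 => none
  | Int.ofNat (n + 1) => l[n]?
  | Int.negSucc _ => none

theorem cell_succ (l : List Bool) (n : ℕ) : cell l ((n : ℤ) + 1) = l[n]? := rfl

theorem word_nth (l : List Bool) (h : ℕ) (i : ℤ) : (word l h).nth i = cell l (i + h) := by
  rw [word, move_right_iterate_nth, Tape.move_left_nth]
  generalize i + (h : ℤ) = z
  rcases z with (_ | n) | n
  · exact mk₁_nth_negSucc _ 0
  · have : (Int.ofNat (n + 1) - 1) = (n : ℤ) := by simp
    rw [this, mk₁_nth_nat, getI_map_some]; rfl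
  · have : (Int.negSucc n - 1) = Int.negSucc (n + 1) := by omega
    rw [this, mk₁_nth_negSucc]; rfl

theorem head_word (l : List Bool) (h : ℕ) : (word l h).head = cell l h := by
  rw [← Tape.nth_zero, word_nth]; simp

@[simp] theorem head_word_zero (l : List Bool) : (word l 0).head = none := head_word l 0

@[simp] theorem head_word_succ (l : List Bool) (h : ℕ) : (word l (h + 1)).head = l[h]? :=
  head_word l (h + 1)

@[simp] theorem word_move_right (l : List Bool) (h : ℕ) :
    (word l h).move Dir.right = word l (h + 1) := by
  rw [word, word, Function.iterate_succ_apply']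

@[simp] theorem word_move_left (l : List Bool) (h : ℕ) :
    (word l (h + 1)).move Dir.left = word l h := by
  rw [← word_move_right, move_left_right]

/-- This matches the two head conventions. Machines start and stop on cell 1, while program
fragments rest on the blank cell 0, so that a loop over a word can recognise its beginning as well
as its end. -/
theorem word_one (l : List Bool) : word l 1 = Tape.mk₁ (l.map some) := by
  rw [word, Function.iterate_one, move_right_left]

/-- A blank tape carries no trace of its head position; hence the two conventions agree on unused
tapes. -/
theorem word_nil (h h' : ℕ) : word [] h = word [] h' := by
  refine tape_ext fun i => ?_
  rw [word_nth, word_nth]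
  have : ∀ z, cell [] z = none := by
    intro z; rcases z with (_ | n) | n <;> simp [cell]
  rw [this, this]

theorem word_write {l l' : List Bool} {h : ℕ} {b : Option Bool}
    (h1 : l'[h]? = b) (h2 : ∀ i, i ≠ h → l'[i]? = l[i]?) :
    (word l (h + 1)).write b = word l' (h + 1) := by
  refine tape_ext fun i => ?_
  rw [Tape.write_nth, word_nth, word_nth]
  split_ifs with hi
  · subst hi
    rw [zero_add]; exact h1.symm
  · have hz : i + ((h + 1 : ℕ) : ℤ) ≠ ((h + 1 : ℕ) : ℤ) := by omega
    generalize i + ((h + 1 : ℕ) : ℤ) = z at hz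
    rcases z with (_ | n) | n
    · rfl
    · refine (h2 n ?_).symm
      rintro rfl; exact hz rfl
    · rfl

theorem word_write_append (l : List Bool) (b : Bool) :
    (word l (l.length + 1)).write (some b) = word (l ++ [b]) (l.length + 1) := by
  refine word_write (by simp) fun i hi => ?_
  rcases lt_or_gt_of_ne hi with h | h
  · rw [List.getElem?_append_left h]
  · rw [List.getElem?_eq_none (by simp; omega), List.getElem?_eq_none (by omega)]

theorem word_write_mid (l r : List Bool) (a b : Bool) :
    (word (l ++ a :: r) (l.length + 1)).write (some b) = word (l ++ b :: r) (l.length + 1) := by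
  refine word_write (by simp) fun i hi => ?_
  rcases lt_or_gt_of_ne hi with h | h
  · rw [List.getElem?_append_left h, List.getElem?_append_left h]
  · rw [List.getElem?_append_right h.le, List.getElem?_append_right h.le]
    obtain ⟨j, hj⟩ := Nat.exists_eq_add_of_lt h
    have : i - l.length = j + 1 := by omega
    rw [this]; simp

theorem word_nth_nat (l : List Bool) (t : ℕ) : (word l 1).nth t = l[t]? := by
  rw [word_nth]; exact cell_succ l t

/-! ### Reversible program fragments -/

/-- The action that undoes `a`. -/
def invAction : TapeAction → TapeAction
  | .write a b => .write b a
  | .shift .left => .shift .right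
  | .shift .right => .shift .left
  | .stay => .stay

/-- This is where the quadruple format pays off: a write records the symbol it replaces and a shift
reads nothing, so every action has a syntactic inverse. -/
theorem invAction_rel {a : TapeAction} {S T : Tape (Option Bool)} :
    (invAction a).Rel T S ↔ a.Rel S T := by
  rcases a with ⟨a, b⟩ | ⟨_ | _⟩ | _
  · constructor
    · rintro ⟨h, rfl⟩; exact ⟨rfl, (write_eq_self h).symm⟩
    · rintro ⟨h, rfl⟩; exact ⟨rfl, (write_eq_self h).symm⟩
  · constructor
    · rintro rfl; exact (move_left_right T).symm
    · rintro rfl; exact (move_right_left S).symm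
  · constructor
    · rintro rfl; exact (move_right_left T).symm
    · rintro rfl; exact (move_left_right S).symm
  · exact eq_comm

theorem rel_right_unique {a : TapeAction} {S T T' : Tape (Option Bool)}
    (h : a.Rel S T) (h' : a.Rel S T') : T = T' := by
  rcases a with ⟨a, b⟩ | d | _
  · exact h.2.trans h'.2.symm
  · exact Eq.trans h (Eq.symm h')
  · exact Eq.trans h (Eq.symm h')

/-- The symbols under the heads. -/
def heads {ι : Type} (α : ι → Tape (Option Bool)) : ι → Option Bool := fun i => (α i).head

/-- One step with the quadruples `rules`. -/
def RuleStep {ι S : Type} (rules : Set (S × (ι → TapeAction) × S)) (s : S)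
    (α : ι → Tape (Option Bool)) (s' : S) (β : ι → Tape (Option Bool)) : Prop :=
  ∃ acts, (s, acts, s') ∈ rules ∧ ∀ i, (acts i).Rel (α i) (β i)

/-- A reversible program fragment on tapes indexed by `ι`, with one entry and one exit. -/
structure Frag (ι : Type) : Type 1 where
  State : Type
  finite_state : Finite State
  entry : State
  exit : State
  rules : Set (State × (ι → TapeAction) × State)
  det : ∀ {s α s₁ β₁ s₂ β₂}, RuleStep rules s α s₁ β₁ → RuleStep rules s α s₂ β₂ →
    s₁ = s₂ ∧ β₁ = β₂
  codet : ∀ {s α s₁ β₁ s₂ β₂}, RuleStep rules s₁ β₁ s α → RuleStep rules s₂ β₂ s α →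
    s₁ = s₂ ∧ β₁ = β₂
  source_ne_exit : ∀ r ∈ rules, r.1 ≠ exit
  target_ne_entry : ∀ r ∈ rules, r.2.2 ≠ entry

namespace Frag

variable {ι : Type}

/-- One step of a fragment. -/
abbrev Step (F : Frag ι) := RuleStep F.rules

theorem not_step_exit (F : Frag ι) {α s β} : ¬ F.Step F.exit α s β :=
  fun ⟨_, h, _⟩ => F.source_ne_exit _ h rfl

theorem not_step_entry (F : Frag ι) {α s β} : ¬ F.Step s α F.entry β :=
  fun ⟨_, h, _⟩ => F.target_ne_entry _ h rfl

/-- `n` steps of a fragment. -/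
inductive Reach (F : Frag ι) : ℕ → F.State → (ι → Tape (Option Bool)) → F.State →
    (ι → Tape (Option Bool)) → Prop
  | refl (s α) : Reach F 0 s α s α
  | tail {n s α s₁ β₁ s₂ β₂} : Reach F n s α s₁ β₁ → F.Step s₁ β₁ s₂ β₂ →
      Reach F (n + 1) s α s₂ β₂

theorem Reach.single {F : Frag ι} {s α s' β} (h : F.Step s α s' β) : F.Reach 1 s α s' β :=
  (Reach.refl s α).tail h

theorem Reach.trans {F : Frag ι} {m n s α s₁ β₁ s₂ β₂} (h : F.Reach m s α s₁ β₁)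
    (h' : F.Reach n s₁ β₁ s₂ β₂) : F.Reach (m + n) s α s₂ β₂ := by
  induction h' with
  | refl => exact h
  | tail _ hs ih => exact (ih h).tail hs

/-- The fragment computes `β` from `α` in at most `T` steps. -/
def Run (F : Frag ι) (T : ℕ) (α β : ι → Tape (Option Bool)) : Prop :=
  ∃ t ≤ T, F.Reach t F.entry α F.exit β

theorem Run.mono {F : Frag ι} {T T' : ℕ} {α β} (h : F.Run T α β) (hT : T ≤ T') : F.Run T' α β :=
  let ⟨t, ht, h⟩ := h
  ⟨t, ht.trans hT, h⟩

/-! #### The inverse fragment -/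

theorem ruleStep_inv {S : Type} {rules : Set (S × (ι → TapeAction) × S)} {s α s' β} :
    RuleStep {r | (r.2.2, fun i => invAction (r.2.1 i), r.1) ∈ rules} s α s' β ↔
      RuleStep rules s' β s α := by
  constructor
  · rintro ⟨acts, h, hr⟩
    exact ⟨_, h, fun i => invAction_rel.2 (hr i)⟩
  · rintro ⟨acts, h, hr⟩
    refine ⟨fun i => invAction (acts i), ?_, fun i => invAction_rel.2 (hr i)⟩
    have : (fun i => invAction (invAction (acts i))) = acts := by
      funext i
      rcases acts i with ⟨a, b⟩ | ⟨_ | _⟩ | _ <;> rfl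
    simpa [this] using h

/-- The fragment that undoes `F`. -/
def inv (F : Frag ι) : Frag ι where
  State := F.State
  finite_state := F.finite_state
  entry := F.exit
  exit := F.entry
  rules := {r | (r.2.2, fun i => invAction (r.2.1 i), r.1) ∈ F.rules}
  det h h' := F.codet (ruleStep_inv.1 h) (ruleStep_inv.1 h')
  codet h h' := F.det (ruleStep_inv.1 h) (ruleStep_inv.1 h')
  source_ne_exit _ h := F.target_ne_entry _ h
  target_ne_entry _ h := F.source_ne_exit _ h

theorem Reach.inv {F : Frag ι} {n s α s' β} (h : F.Reach n s α s' β) :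
    F.inv.Reach n s' β s α := by
  induction h with
  | refl => exact .refl _ _
  | @tail n s α s₁ β₁ s₂ β₂ _ hs ih =>
    rw [add_comm]
    exact (Reach.single (F := F.inv) (ruleStep_inv.2 hs)).trans ih

theorem Run.inv {F : Frag ι} {T α β} (h : F.Run T α β) : F.inv.Run T β α :=
  let ⟨t, ht, h⟩ := h
  ⟨t, ht, h.inv⟩

/-! #### Atoms -/

/-- The fragment with a single quadruple. -/
def single (acts : ι → TapeAction) : Frag ι where
  State := Bool
  finite_state := inferInstance
  entry := false
  exit := true
  rules := {(false, acts, true)}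
  det := by
    rintro s α s₁ β₁ s₂ β₂ ⟨a, h, hr⟩ ⟨a', h', hr'⟩
    simp only [Set.mem_singleton_iff, Prod.mk.injEq] at h h'
    obtain ⟨-, rfl, rfl⟩ := h
    obtain ⟨-, rfl, rfl⟩ := h'
    exact ⟨rfl, funext fun i => rel_right_unique (hr i) (hr' i)⟩
  codet := by
    rintro s α s₁ β₁ s₂ β₂ ⟨a, h, hr⟩ ⟨a', h', hr'⟩
    simp only [Set.mem_singleton_iff, Prod.mk.injEq] at h h'
    obtain ⟨rfl, rfl, -⟩ := h
    obtain ⟨rfl, rfl, -⟩ := h'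
    exact ⟨rfl, funext fun i =>
      rel_right_unique (invAction_rel.2 (hr i)) (invAction_rel.2 (hr' i))⟩
  source_ne_exit := by rintro r rfl; simp
  target_ne_entry := by rintro r rfl; simp

theorem run_single {acts : ι → TapeAction} {α β} (h : ∀ i, (acts i).Rel (α i) (β i)) :
    (single acts).Run 1 α β :=
  ⟨1, le_rfl, .single ⟨acts, rfl, h⟩⟩

/-- Do nothing. -/
def skip : Frag ι := single fun _ => .stay

theorem run_skip (α : ι → Tape (Option Bool)) : skip.Run 1 α α := run_single fun _ => rfl

section
variable [DecidableEq ι]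

/-- Shift one head. -/
def mv (A : ι) (d : Dir) : Frag ι := single (Function.update (fun _ => .stay) A (.shift d))

theorem run_mv (A : ι) (d : Dir) (α : ι → Tape (Option Bool)) :
    (mv A d).Run 1 α (Function.update α A ((α A).move d)) := by
  refine run_single fun i => ?_
  rcases eq_or_ne i A with rfl | h
  · simp [TapeAction.Rel]
  · simp [h, TapeAction.Rel]

/-- There is one quadruple for each vector of scanned symbols, and exactly one of them applies to
given tapes. -/
theorem ruleStep_perm {A : ι} {σ : (ι → Option Bool) → Equiv.Perm (Option Bool)} {s α s' β} :
    RuleStep (Set.range fun v : ι → Option Bool =>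
      (false, (fun i => TapeAction.write (v i) (Function.update v A (σ v (v A)) i)), true))
      s α s' β ↔ s = false ∧ s' = true ∧
        β = Function.update α A ((α A).write (σ (heads α) (α A).head)) := by
  constructor
  · rintro ⟨acts, ⟨v, hv⟩, hr⟩
    simp only [Prod.mk.injEq] at hv
    obtain ⟨rfl, rfl, rfl⟩ := hv
    have hv : v = heads α := funext fun i => ((hr i).1).symm
    refine ⟨rfl, rfl, funext fun i => ?_⟩
    rw [(hr i).2]
    rcases eq_or_ne i A with rfl | h
    · simp [hv, heads]
    · simp [h, hv, heads, Tape.write_self]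
  · rintro ⟨rfl, rfl, rfl⟩
    refine ⟨_, ⟨heads α, rfl⟩, fun i => ⟨rfl, ?_⟩⟩
    rcases eq_or_ne i A with rfl | h
    · simp [heads]
    · simp [h, heads, Tape.write_self]

/-- Rewrite the symbol under the head of the tape `A` by a permutation that may depend on the
symbols under the other heads. -/
def perm (A : ι) (σ : (ι → Option Bool) → Equiv.Perm (Option Bool))
    (hσ : ∀ v b, σ (Function.update v A b) = σ v) : Frag ι where
  State := Bool
  finite_state := inferInstance
  entry := false
  exit := true
  rules := Set.range fun v : ι → Option Bool =>
    (false, (fun i => TapeAction.write (v i) (Function.update v A (σ v (v A)) i)), true)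
  det := by
    intro s α s₁ β₁ s₂ β₂ h h'
    obtain ⟨-, rfl, rfl⟩ := ruleStep_perm.1 h
    obtain ⟨-, rfl, rfl⟩ := ruleStep_perm.1 h'
    exact ⟨rfl, rfl⟩
  codet := by
    intro s α s₁ β₁ s₂ β₂ h h'
    obtain ⟨rfl, -, h1⟩ := ruleStep_perm.1 h
    obtain ⟨rfl, -, h2⟩ := ruleStep_perm.1 h'
    -- By `hσ` the permutation ignores the symbol on `A`, so it can be recomputed after the write
    -- and inverted.
    have key : ∀ β : ι → Tape (Option Bool),
        α = Function.update β A ((β A).write (σ (heads β) (β A).head)) →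
        β = Function.update α A ((α A).write ((σ (heads α)).symm (α A).head)) := by
      rintro β rfl
      have : heads (Function.update β A ((β A).write (σ (heads β) (β A).head))) =
          Function.update (heads β) A (σ (heads β) (β A).head) := by
        funext i
        rcases eq_or_ne i A with rfl | h
        · simp [heads, write_head]
        · simp [heads, h]
      rw [this, hσ]
      simp [write_head, write_write, Tape.write_self]
    exact ⟨rfl, (key _ h1).trans (key _ h2).symm⟩
  source_ne_exit := by rintro r ⟨v, rfl⟩; simp
  target_ne_entry := by rintro r ⟨v, rfl⟩; simp

theorem run_perm {A : ι} {σ : (ι → Option Bool) → Equiv.Perm (Option Bool)}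
    {hσ : ∀ v b, σ (Function.update v A b) = σ v} (α : ι → Tape (Option Bool)) :
    (perm A σ hσ).Run 1 α (Function.update α A ((α A).write (σ (heads α) (α A).head))) :=
  ⟨1, le_rfl, .single (ruleStep_perm.2 ⟨rfl, rfl, rfl⟩)⟩

end

/-! #### Control flow -/

/-- The states of a flowchart with two blocks. -/
inductive FlowState (S S' : Type) : Type
  | src
  | tgt
  | inl (s : S)
  | inr (s : S')

instance {S S' : Type} [Finite S] [Finite S'] : Finite (FlowState S S') :=
  Finite.of_surjective (fun x : Bool ⊕ (S ⊕ S') => match x with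
    | .inl false => FlowState.src
    | .inl true => .tgt
    | .inr (.inl s) => .inl s
    | .inr (.inr s) => .inr s) fun y => match y with
    | .src => ⟨.inl false, rfl⟩
    | .tgt => ⟨.inl true, rfl⟩
    | .inl s => ⟨.inr (.inl s), rfl⟩
    | .inr s => ⟨.inr (.inr s), rfl⟩

/-- The state in which an edge of the flowchart begins: `none` is the entry of the flowchart,
the two blocks are `some false` and `some true`. -/
def outNode (P Q : Frag ι) : Option Bool → FlowState P.State Q.State
  | none => .src
  | some false => .inl P.exit
  | some true => .inr Q.exit

/-- The state in which an edge of the flowchart ends. -/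
def inNode (P Q : Frag ι) : Option Bool → FlowState P.State Q.State
  | none => .tgt
  | some false => .inl P.entry
  | some true => .inr Q.entry

theorem outNode_injective (P Q : Frag ι) : Function.Injective (outNode P Q) := by
  rintro (_ | _ | _) (_ | _ | _) h <;> simp_all [outNode]

theorem inNode_injective (P Q : Frag ι) : Function.Injective (inNode P Q) := by
  rintro (_ | _ | _) (_ | _ | _) h <;> simp_all [inNode]

/-- The quadruples of a flowchart with the blocks `P` and `Q`; `E a b` is the set of head symbols
for which the edge from `a` to `b` is taken. -/
def flowRules (P Q : Frag ι) (E : Option Bool → Option Bool → Set (ι → Option Bool)) :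
    Set (FlowState P.State Q.State × (ι → TapeAction) × FlowState P.State Q.State) :=
  {r | (∃ p ∈ P.rules, r = (.inl p.1, p.2.1, .inl p.2.2)) ∨
    (∃ q ∈ Q.rules, r = (.inr q.1, q.2.1, .inr q.2.2)) ∨
    ∃ a b, ∃ v ∈ E a b, r = (outNode P Q a, fun i => .write (v i) (v i), inNode P Q b)}

theorem ruleStep_flow {P Q : Frag ι} {E : Option Bool → Option Bool → Set (ι → Option Bool)}
    {s α s' β} : RuleStep (flowRules P Q E) s α s' β ↔
      (∃ p p', s = .inl p ∧ s' = .inl p' ∧ P.Step p α p' β) ∨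
      (∃ q q', s = .inr q ∧ s' = .inr q' ∧ Q.Step q α q' β) ∨
      ∃ a b, heads α ∈ E a b ∧ s = outNode P Q a ∧ s' = inNode P Q b ∧ β = α := by
  constructor
  · rintro ⟨acts, ⟨⟨p, a, p'⟩, hp, h⟩ | ⟨⟨p, a, p'⟩, hp, h⟩ | ⟨a, b, v, hv, h⟩, hr⟩ <;>
      simp only [Prod.mk.injEq] at h <;> obtain ⟨rfl, rfl, rfl⟩ := h
    · exact .inl ⟨_, _, rfl, rfl, _, hp, hr⟩
    · exact .inr (.inl ⟨_, _, rfl, rfl, _, hp, hr⟩)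
    · have : v = heads α := funext fun i => ((hr i).1).symm
      subst this
      exact .inr (.inr ⟨_, _, hv, rfl, rfl, funext fun i => (hr i).2.trans (write_eq_self rfl)⟩)
  · rintro (⟨p, p', rfl, rfl, a, h, hr⟩ | ⟨p, p', rfl, rfl, a, h, hr⟩ | ⟨a, b, h, rfl, rfl, rfl⟩)
    · exact ⟨a, .inl ⟨_, h, rfl⟩, hr⟩
    · exact ⟨a, .inr (.inl ⟨_, h, rfl⟩), hr⟩
    · exact ⟨_, .inr (.inr ⟨a, b, _, h, rfl⟩), fun i => ⟨rfl, (write_eq_self rfl).symm⟩⟩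

/-- Edges leave a block only at its exit, where the block itself has no step; with the three
analogues that follow, edges never compete with inner steps in either direction of time. -/
theorem not_step_outNode_left {P Q : Frag ι} {a : Option Bool} {p α p' β}
    (h : outNode P Q a = .inl p) : ¬ P.Step p α p' β := by
  rcases a with _ | _ | _ <;> simp only [outNode, FlowState.inl.injEq, reduceCtorEq] at h
  subst h; exact P.not_step_exit

theorem not_step_outNode_right {P Q : Frag ι} {a : Option Bool} {q α q' β}
    (h : outNode P Q a = .inr q) : ¬ Q.Step q α q' β := by
  rcases a with _ | _ | _ <;> simp only [outNode, FlowState.inr.injEq, reduceCtorEq] at h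
  subst h; exact Q.not_step_exit

theorem not_step_inNode_left {P Q : Frag ι} {a : Option Bool} {p α p' β}
    (h : inNode P Q a = .inl p') : ¬ P.Step p α p' β := by
  rcases a with _ | _ | _ <;> simp only [inNode, FlowState.inl.injEq, reduceCtorEq] at h
  subst h; exact P.not_step_entry

theorem not_step_inNode_right {P Q : Frag ι} {a : Option Bool} {q α q' β}
    (h : inNode P Q a = .inr q') : ¬ Q.Step q α q' β := by
  rcases a with _ | _ | _ <;> simp only [inNode, FlowState.inr.injEq, reduceCtorEq] at h
  subst h; exact Q.not_step_entry

/-- The flowchart with the blocks `P`, `Q` and the edges `E`. -/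
def flow (P Q : Frag ι) (E : Option Bool → Option Bool → Set (ι → Option Bool))
    (hr : ∀ a b b' v, v ∈ E a b → v ∈ E a b' → b = b')
    (hc : ∀ a a' b v, v ∈ E a b → v ∈ E a' b → a = a') : Frag ι where
  State := FlowState P.State Q.State
  finite_state := have := P.finite_state; have := Q.finite_state; inferInstance
  entry := .src
  exit := .tgt
  rules := flowRules P Q E
  det := by
    intro s α s₁ β₁ s₂ β₂ h h'
    rcases ruleStep_flow.1 h with
      ⟨p, p', rfl, rfl, h1⟩ | ⟨p, p', rfl, rfl, h1⟩ | ⟨a, b, h1, rfl, rfl, rfl⟩ <;>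
    rcases ruleStep_flow.1 h' with
      ⟨q, q', hq, rfl, h2⟩ | ⟨q, q', hq, rfl, h2⟩ | ⟨a', b', h2, hq, rfl, rfl⟩
    · cases hq; obtain ⟨rfl, rfl⟩ := P.det h1 h2; exact ⟨rfl, rfl⟩
    · cases hq
    · exact absurd h1 (not_step_outNode_left hq.symm)
    · cases hq
    · cases hq; obtain ⟨rfl, rfl⟩ := Q.det h1 h2; exact ⟨rfl, rfl⟩
    · exact absurd h1 (not_step_outNode_right hq.symm)
    · exact absurd h2 (not_step_outNode_left hq)
    · exact absurd h2 (not_step_outNode_right hq)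
    · obtain rfl := outNode_injective P Q hq
      obtain rfl := hr _ _ _ _ h1 h2
      exact ⟨rfl, rfl⟩
  codet := by
    intro s α s₁ β₁ s₂ β₂ h h'
    rcases ruleStep_flow.1 h with
      ⟨p, p', rfl, rfl, h1⟩ | ⟨p, p', rfl, rfl, h1⟩ | ⟨a, b, h1, rfl, rfl, rfl⟩ <;>
    rcases ruleStep_flow.1 h' with
      ⟨q, q', rfl, hq, h2⟩ | ⟨q, q', rfl, hq, h2⟩ | ⟨a', b', h2, rfl, hq, rfl⟩
    · cases hq; obtain ⟨rfl, rfl⟩ := P.codet h1 h2; exact ⟨rfl, rfl⟩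
    · cases hq
    · exact absurd h1 (not_step_inNode_left hq.symm)
    · cases hq
    · cases hq; obtain ⟨rfl, rfl⟩ := Q.codet h1 h2; exact ⟨rfl, rfl⟩
    · exact absurd h1 (not_step_inNode_right hq.symm)
    · exact absurd h2 (not_step_inNode_left hq)
    · exact absurd h2 (not_step_inNode_right hq)
    · obtain rfl := inNode_injective P Q hq
      obtain rfl := hc _ _ _ _ h1 h2
      exact ⟨rfl, rfl⟩
  source_ne_exit := by
    rintro r (⟨p, -, rfl⟩ | ⟨p, -, rfl⟩ | ⟨_ | _ | _, b, v, -, rfl⟩) <;> simp [outNode]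
  target_ne_entry := by
    rintro r (⟨p, -, rfl⟩ | ⟨p, -, rfl⟩ | ⟨a, _ | _ | _, v, -, rfl⟩) <;> simp [inNode]

section flow
variable {P Q : Frag ι} {E : Option Bool → Option Bool → Set (ι → Option Bool)}
  {hr : ∀ a b b' v, v ∈ E a b → v ∈ E a b' → b = b'}
  {hc : ∀ a a' b v, v ∈ E a b → v ∈ E a' b → a = a'}

theorem reach_flow_left {n s α s' β} (h : P.Reach n s α s' β) :
    (flow P Q E hr hc).Reach n (.inl s) α (.inl s') β := by
  induction h with
  | refl => exact .refl _ _
  | tail _ hs ih => exact ih.tail (ruleStep_flow.2 (.inl ⟨_, _, rfl, rfl, hs⟩))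

theorem reach_flow_right {n s α s' β} (h : Q.Reach n s α s' β) :
    (flow P Q E hr hc).Reach n (.inr s) α (.inr s') β := by
  induction h with
  | refl => exact .refl _ _
  | tail _ hs ih => exact ih.tail (ruleStep_flow.2 (.inr (.inl ⟨_, _, rfl, rfl, hs⟩)))

theorem reach_flow_edge {a b : Option Bool} {α : ι → Tape (Option Bool)}
    (h : heads α ∈ E a b) :
    (flow P Q E hr hc).Reach 1 (outNode P Q a) α (inNode P Q b) α :=
  .single (ruleStep_flow.2 (.inr (.inr ⟨a, b, h, rfl, rfl, rfl⟩)))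

end flow

/-- `P`, then `Q`. -/
def seq (P Q : Frag ι) : Frag ι :=
  flow P Q (fun a b => match a, b with
    | none, some false => Set.univ
    | some false, some true => Set.univ
    | some true, none => Set.univ
    | _, _ => ∅)
    (by rintro (_ | _ | _) (_ | _ | _) (_ | _ | _) v <;> simp)
    (by rintro (_ | _ | _) (_ | _ | _) (_ | _ | _) v <;> simp)

theorem run_seq {P Q : Frag ι} {T T' α β γ} (h : P.Run T α β) (h' : Q.Run T' β γ) :
    (seq P Q).Run (T + T' + 3) α γ := by
  obtain ⟨t, ht, h⟩ := h
  obtain ⟨t', ht', h'⟩ := h'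
  refine ⟨1 + t + 1 + t' + 1, by omega, ?_⟩
  refine ((((reach_flow_edge (a := none) (b := some false) ?_).trans
    (reach_flow_left h)).trans (reach_flow_edge (a := some false) (b := some true) ?_)).trans
    (reach_flow_right h')).trans (reach_flow_edge (a := some true) (b := none) ?_) <;>
  exact Set.mem_univ _

/-- `if A then P else Q`, with the assertion that `B` holds after `P` and fails after `Q`. -/
def cond (A : Set (ι → Option Bool)) (P Q : Frag ι) (B : Set (ι → Option Bool)) : Frag ι :=
  flow P Q (fun a b => match a, b with
    | none, some false => A
    | none, some true => Aᶜ
    | some false, none => B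
    | some true, none => Bᶜ
    | _, _ => ∅)
    (by rintro (_ | _ | _) (_ | _ | _) (_ | _ | _) v <;> simp)
    (by rintro (_ | _ | _) (_ | _ | _) (_ | _ | _) v <;> simp)

/-- The exit test `hB` is what tells the inverse program which branch to undo. -/
theorem run_cond_pos {A B : Set (ι → Option Bool)} {P Q : Frag ι} {T α β}
    (hA : heads α ∈ A) (h : P.Run T α β) (hB : heads β ∈ B) :
    (cond A P Q B).Run (T + 2) α β := by
  obtain ⟨t, ht, h⟩ := h
  refine ⟨1 + t + 1, by omega, ?_⟩
  refine ((reach_flow_edge (a := none) (b := some false) ?_).trans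
    (reach_flow_left h)).trans (reach_flow_edge (a := some false) (b := none) ?_)
  · exact hA
  · exact hB

theorem run_cond_neg {A B : Set (ι → Option Bool)} {P Q : Frag ι} {T α β}
    (hA : heads α ∉ A) (h : Q.Run T α β) (hB : heads β ∉ B) :
    (cond A P Q B).Run (T + 2) α β := by
  obtain ⟨t, ht, h⟩ := h
  refine ⟨1 + t + 1, by omega, ?_⟩
  refine ((reach_flow_edge (a := none) (b := some true) ?_).trans
    (reach_flow_right h)).trans (reach_flow_edge (a := some true) (b := none) ?_)
  · exact hA
  · exact hB

/-- `from A do P until B loop Q`: repeat `P; Q` and leave after a `P` that makes `B` true, with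
the assertion that `A` holds at the entry and fails after each `Q`. -/
def loop (A : Set (ι → Option Bool)) (P : Frag ι) (B : Set (ι → Option Bool)) (Q : Frag ι) :
    Frag ι :=
  flow P Q (fun a b => match a, b with
    | none, some false => A
    | some true, some false => Aᶜ
    | some false, none => B
    | some false, some true => Bᶜ
    | _, _ => ∅)
    (by rintro (_ | _ | _) (_ | _ | _) (_ | _ | _) v <;> simp)
    (by rintro (_ | _ | _) (_ | _ | _) (_ | _ | _) v <;> simp)

/-- `α i` and `β i` are the tapes before and after the `i`-th execution of `P`, counted from 0; `P`
runs `N + 1` times and `Q` only `N` times. Backwards, `A` plays the role of the stopping test, hence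
`hA` and `hA'`. -/
theorem run_loop {A B : Set (ι → Option Bool)} {P Q : Frag ι} {T T' : ℕ} (N : ℕ)
    (α β : ℕ → ι → Tape (Option Bool)) (hA : heads (α 0) ∈ A)
    (hP : ∀ i ≤ N, P.Run T (α i) (β i)) (hB' : ∀ i < N, heads (β i) ∉ B)
    (hQ : ∀ i < N, Q.Run T' (β i) (α (i + 1))) (hA' : ∀ i < N, heads (α (i + 1)) ∉ A)
    (hB : heads (β N) ∈ B) :
    (loop A P B Q).Run ((N + 1) * (T + T' + 2)) (α 0) (β N) := by
  -- Induction on the number of arrivals at the entry of `P`; the leading 1 is the entry edge.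
  have key : ∀ i ≤ N, ∃ t ≤ 1 + i * (T + T' + 2),
      (loop A P B Q).Reach t FlowState.src (α 0) (.inl P.entry) (α i) := by
    intro i
    induction i with
    | zero =>
      exact fun _ => ⟨1, by omega, reach_flow_edge (a := none) (b := some false) hA⟩
    | succ i ih =>
      intro hi
      obtain ⟨t, ht, h⟩ := ih (by omega)
      obtain ⟨t₁, ht₁, h₁⟩ := hP i (by omega)
      obtain ⟨t₂, ht₂, h₂⟩ := hQ i (by omega)
      refine ⟨t + t₁ + 1 + t₂ + 1, by linarith, ?_⟩
      refine (((h.trans (reach_flow_left h₁)).trans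
        (reach_flow_edge (a := some false) (b := some true) ?_)).trans
        (reach_flow_right h₂)).trans (reach_flow_edge (a := some true) (b := some false) ?_)
      · exact hB' i hi
      · exact hA' i hi
  obtain ⟨t, ht, h⟩ := key N le_rfl
  obtain ⟨t₁, ht₁, h₁⟩ := hP N le_rfl
  refine ⟨t + t₁ + 1, by linarith, ?_⟩
  exact (h.trans (reach_flow_left h₁)).trans
    (reach_flow_edge (a := some false) (b := none) hB)

/-- `P`, then `Q`, then undo `P`. -/
def conj (P Q : Frag ι) : Frag ι := seq P (seq Q P.inv)

/-- Compute, use, uncompute. The undoing phase may lead to a `δ` different from `α`: it suffices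
that `P` started on `δ` would have produced `γ`. This holds whenever `Q` changes only data on which
the work of `P` does not depend. -/
theorem run_conj {P Q : Frag ι} {T T' T'' α β γ δ} (h : P.Run T α β) (h' : Q.Run T' β γ)
    (h'' : P.Run T'' δ γ) : (conj P Q).Run (T + (T' + T'' + 3) + 3) α δ :=
  run_seq h (run_seq h' h''.inv)

/-- `P`, repeated `r` times. -/
def rep (P : Frag ι) : ℕ → Frag ι
  | 0 => skip
  | r + 1 => seq (rep P r) P

theorem run_rep {P : Frag ι} {T : ℕ} (α : ℕ → ι → Tape (Option Bool)) (r : ℕ)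
    (h : ∀ i < r, P.Run T (α i) (α (i + 1))) : (rep P r).Run (1 + r * (T + 3)) (α 0) (α r) := by
  induction r with
  | zero => exact (run_skip _).mono (by omega)
  | succ r ih =>
    exact (run_seq (ih fun i hi => h i (by omega)) (h r (by omega))).mono (by linarith)

end Frag

namespace Frag

/-! ### Programs on words -/

section words
variable {ι : Type} [DecidableEq ι]

/-- Rewrite the symbol under the head of `A` by a fixed permutation. -/
def permC (A : ι) (e : Equiv.Perm (Option Bool)) : Frag ι := perm A (fun _ => e) fun _ _ => rfl

theorem run_permC (A : ι) (e : Equiv.Perm (Option Bool)) (α : ι → Tape (Option Bool)) :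
    (permC A e).Run 1 α (Function.update α A ((α A).write (e (α A).head))) :=
  run_perm α

theorem run_mv_update (A : ι) (d : Dir) (α : ι → Tape (Option Bool)) (S : Tape (Option Bool)) :
    (mv A d).Run 1 (Function.update α A S) (Function.update α A (S.move d)) := by
  simpa using run_mv A d (Function.update α A S)

theorem run_permC_update (A : ι) (e : Equiv.Perm (Option Bool)) (α : ι → Tape (Option Bool))
    (S : Tape (Option Bool)) :
    (permC A e).Run 1 (Function.update α A S)
      (Function.update α A (S.write (e S.head))) := by
  simpa using run_permC A e (Function.update α A S)

/-- The head of `A` scans the symbol `b`. -/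
def sees (A : ι) (b : Option Bool) : Set (ι → Option Bool) := {v | v A = b}

omit [DecidableEq ι] in
theorem heads_mem_sees {A : ι} {b : Option Bool} {α : ι → Tape (Option Bool)} :
    heads α ∈ sees A b ↔ (α A).head = b := Iff.rfl

theorem heads_update_mem_sees {A : ι} {b : Option Bool} {α : ι → Tape (Option Bool)}
    {S : Tape (Option Bool)} : heads (Function.update α A S) ∈ sees A b ↔ S.head = b := by
  rw [heads_mem_sees, Function.update_self]

/-- Move the head of `A` over its word, executing `body` on each cell. -/
def forCells (A : ι) (body : Frag ι) : Frag ι :=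
  loop (sees A none) (mv A .right) (sees A none) body

/-- The blank is both the entry assertion (cell 0) and the stopping test (the cell after the word),
and it is seen at no cell in between. The value of `α i` at `A` is irrelevant, being overwritten by
the update. -/
theorem run_forCells {A : ι} {body : Frag ι} {T : ℕ} {l : List Bool}
    (α : ℕ → ι → Tape (Option Bool))
    (h : ∀ i < l.length, body.Run T (Function.update (α i) A (word l (i + 1)))
      (Function.update (α (i + 1)) A (word l (i + 1)))) :
    (forCells A body).Run ((l.length + 1) * (T + 3)) (Function.update (α 0) A (word l 0))
      (Function.update (α l.length) A (word l (l.length + 1))) := by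
  refine (run_loop (T := 1) (T' := T) l.length (fun i => Function.update (α i) A (word l i))
    (fun i => Function.update (α i) A (word l (i + 1))) ?_ ?_ ?_ h ?_ ?_).mono (by
      rw [add_comm 1 T])
  · simp [heads_update_mem_sees]
  · intro i _; simpa using run_mv_update A .right (α i) (word l i)
  · intro i hi; simp [heads_update_mem_sees, hi]
  · intro i hi; simp [heads_update_mem_sees, hi]
  · simp [heads_update_mem_sees]

/-- Move the head of `A` from the right end of its word back to the left end. -/
def back (A : ι) : Frag ι := (forCells A skip).inv

theorem run_toEnd (A : ι) (l : List Bool) (α : ι → Tape (Option Bool)) :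
    (forCells A skip).Run ((l.length + 1) * 4) (Function.update α A (word l 0))
      (Function.update α A (word l (l.length + 1))) :=
  run_forCells (T := 1) (fun _ => α) fun _ _ => run_skip _

theorem run_back (A : ι) (l : List Bool) (α : ι → Tape (Option Bool)) :
    (back A).Run ((l.length + 1) * 4) (Function.update α A (word l (l.length + 1)))
      (Function.update α A (word l 0)) := (run_toEnd A l α).inv

/-- Execute `body` for each cell of the word on `A`. -/
def each (A : ι) (body : Frag ι) : Frag ι := seq (forCells A body) (back A)

theorem run_each {A : ι} {body : Frag ι} {T : ℕ} {l : List Bool}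
    (α : ℕ → ι → Tape (Option Bool)) (hA : ∀ i, α i A = word l 0)
    (h : ∀ i < l.length, body.Run T (Function.update (α i) A (word l (i + 1)))
      (Function.update (α (i + 1)) A (word l (i + 1)))) :
    (each A body).Run ((l.length + 1) * (T + 10)) (α 0) (α l.length) := by
  have := (run_seq (run_forCells α h) (run_back A l (α l.length))).mono
    (T' := (l.length + 1) * (T + 10)) (by nlinarith)
  rwa [← hA 0, Function.update_eq_self, hA 0, ← hA l.length, Function.update_eq_self] at this

/-- Append a zero to the word on `B`. -/
def push (B : ι) : Frag ι :=
  seq (forCells B skip) (seq (permC B (Equiv.swap none (some false)))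
    (seq (mv B .right) (back B)))

/-- The blank after the word becomes a zero, and the head then returns over the longer word. The
inverse of `push` deletes a final zero; this is how unary lengths are subtracted and cleared cells
are removed. -/
theorem run_push {B : ι} {l : List Bool} {α : ι → Tape (Option Bool)} (hB : α B = word l 0) :
    (push B).Run (8 * (l.length + 4)) α (Function.update α B (word (l ++ [false]) 0)) := by
  have h1 := run_toEnd B l α
  have h2 := run_permC_update B (Equiv.swap none (some false)) α (word l (l.length + 1))
  have h3 := run_mv_update B .right α (word (l ++ [false]) (l.length + 1))
  have h4 := run_back B (l ++ [false]) α
  simp only [head_word_succ, le_refl, List.getElem?_eq_none, Equiv.swap_apply_left,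
    word_write_append] at h2
  simp only [word_move_right] at h3
  rw [List.length_append, List.length_singleton] at h4
  have := (run_seq h1 (run_seq h2 (run_seq h3 h4))).mono (T' := 8 * (l.length + 4)) (by omega)
  rwa [← hB, Function.update_eq_self] at this

theorem run_each_push {A B : ι} (hAB : A ≠ B) {l u : List Bool} {α : ι → Tape (Option Bool)}
    (hA : α A = word l 0) (hB : α B = word u 0) :
    (each A (push B)).Run ((l.length + 1) * (8 * (l.length + u.length) + 42)) α
      (Function.update α B (word (u ++ List.replicate l.length false) 0)) := by
  have := run_each (A := A) (body := push B) (T := 8 * (l.length + u.length + 4)) (l := l)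
    (fun i => Function.update α B (word (u ++ List.replicate i false) 0))
    (fun i => by rw [Function.update_of_ne hAB, hA]) (fun i hi => by
      have h := (run_push (B := B) (l := u ++ List.replicate i false)
        (α := Function.update (Function.update α B (word (u ++ List.replicate i false) 0)) A
          (word l (i + 1))) (by rw [Function.update_of_ne hAB.symm, Function.update_self])).mono
          (T' := 8 * (l.length + u.length + 4)) (by simp; omega)
      rw [List.append_assoc, ← List.replicate_succ',
        Function.update_comm hAB.symm, Function.update_idem] at h
      rw [Function.update_comm hAB.symm, Function.update_comm hAB.symm]
      exact h)
  simp only [List.replicate_zero, List.append_nil] at this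
  rw [← hB, Function.update_eq_self] at this
  exact this.mono (by rw [show 8 * (l.length + u.length + 4) + 10 =
    8 * (l.length + u.length) + 42 by ring])

end words

end Frag

/-! #### Binary counters -/

/-- The `e` low-order bits of `i`, the lowest first. -/
def bits (e i : ℕ) : List Bool := (List.range e).map i.testBit

@[simp] theorem length_bits (e i : ℕ) : (bits e i).length = e := by simp [bits]

theorem bits_succ (e i : ℕ) : bits (e + 1) i = i.testBit 0 :: bits e (i / 2) := by
  simp [bits, List.range_succ_eq_map, Nat.testBit_succ, Function.comp_def]

theorem getElem?_bits (e i t : ℕ) : (bits e i)[t]? = if t < e then some (i.testBit t) else none := by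
  split_ifs with h
  · simp [bits, h]
  · simp [bits, h]

theorem bits_zero (e : ℕ) : bits e 0 = List.replicate e false := by
  simp [bits, List.eq_replicate_iff]

/-- Add one to a binary counter, the lowest bit first, with wraparound. -/
def incr : List Bool → List Bool
  | [] => []
  | false :: l => true :: l
  | true :: l => false :: incr l

@[simp] theorem length_incr (l : List Bool) : (incr l).length = l.length := by
  induction l with
  | nil => rfl
  | cons a l ih => cases a <;> simp [incr, ih]

theorem incr_bits (e i : ℕ) : incr (bits e i) = bits e (i + 1) := by
  induction e generalizing i with
  | zero => rfl
  | succ e ih =>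
    rw [bits_succ, bits_succ, Nat.testBit_zero, Nat.testBit_zero]
    rcases Nat.mod_two_eq_zero_or_one i with h | h
    · have h1 : (i + 1) % 2 = 1 := by omega
      have h2 : (i + 1) / 2 = i / 2 := by omega
      simp [h, h1, h2, incr]
    · have h1 : (i + 1) % 2 = 0 := by omega
      have h2 : (i + 1) / 2 = i / 2 + 1 := by omega
      simp [h, h1, h2, incr, ih]

theorem bits_two_pow (e : ℕ) : bits e (2 ^ e) = List.replicate e false := by
  rw [← bits_zero]
  refine List.map_congr_left fun t ht => ?_
  rw [List.mem_range] at ht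
  rw [Nat.testBit_two_pow_of_ne (by omega), Nat.zero_testBit]

theorem bits_injOn {e i j : ℕ} (hi : i < 2 ^ e) (hj : j < 2 ^ e) (h : bits e i = bits e j) :
    i = j := by
  refine Nat.eq_of_testBit_eq fun t => ?_
  rcases lt_or_ge t e with ht | ht
  · have := congrArg (·[t]?) h
    simpa only [getElem?_bits, ht, if_true, Option.some.injEq] using this
  · have hp : 2 ^ e ≤ 2 ^ t := Nat.pow_le_pow_right (by norm_num) ht
    rw [Nat.testBit_lt_two_pow (hi.trans_le hp), Nat.testBit_lt_two_pow (hj.trans_le hp)]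

theorem exists_bits (l : List Bool) : ∃ i < 2 ^ l.length, bits l.length i = l := by
  induction l with
  | nil => exact ⟨0, by simp, rfl⟩
  | cons a l ih =>
    obtain ⟨i, hi, h⟩ := ih
    refine ⟨2 * i + a.toNat, ?_, ?_⟩
    · rw [List.length_cons, pow_succ]
      have := Bool.toNat_le a
      omega
    · rw [List.length_cons, bits_succ, Nat.testBit_zero]
      cases a
      · have h2 : (2 * i) / 2 = i := by omega
        simp [h, h2]
      · have h1 : (2 * i + 1) % 2 = 1 := by omega
        have h2 : (2 * i + 1) / 2 = i := by omega
        simp [h, h1, h2]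

/-- The number of zeros in front of the first one. -/
def lead (l : List Bool) : ℕ := (l.takeWhile (!·)).length

theorem lead_le (l : List Bool) : lead l ≤ l.length := (List.takeWhile_prefix _).length_le

theorem getElem?_of_lt_lead {l : List Bool} {i : ℕ} (h : i < lead l) : l[i]? = some false := by
  induction l generalizing i with
  | nil => simp [lead] at h
  | cons a l ih =>
    cases a
    · cases i with
      | zero => rfl
      | succ i => simpa using ih (by simpa [lead] using h)
    · simp [lead] at h

theorem getElem?_lead_ne (l : List Bool) : l[lead l]? ≠ some false := by
  induction l with
  | nil => simp
  | cons a l ih =>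
    cases a
    · simpa [lead] using ih
    · simp [lead]

/-- This turns the zero test of a counter into a local one: after a scan the head sees a blank
exactly for the value zero. -/
theorem getElem?_lead_eq_none_iff {l : List Bool} :
    l[lead l]? = none ↔ l = List.replicate l.length false := by
  induction l with
  | nil => simp
  | cons a l ih =>
    cases a
    · simpa [lead, List.replicate_succ] using ih
    · simp [lead, List.replicate_succ]

/-- The carry either ends at the first zero or runs through a word of ones and overflows. -/
theorem incr_cases (l : List Bool) :
    (∃ j t, l = List.replicate j true ++ false :: t ∧
      incr l = List.replicate j false ++ true :: t) ∨
    (l = List.replicate l.length true ∧ incr l = List.replicate l.length false) := by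
  induction l with
  | nil => exact .inr ⟨rfl, rfl⟩
  | cons a l ih =>
    cases a
    · exact .inl ⟨0, l, rfl, rfl⟩
    · rcases ih with ⟨j, t, h, h'⟩ | ⟨h, h'⟩
      · refine .inl ⟨j + 1, t, ?_, ?_⟩
        · rw [List.replicate_succ, List.cons_append, ← h]
        · rw [List.replicate_succ, List.cons_append, ← h', incr]
      · refine .inr ⟨?_, ?_⟩
        · rw [List.length_cons, List.replicate_succ, ← h]
        · rw [List.length_cons, List.replicate_succ, ← h', incr]

theorem lead_replicate_append (j : ℕ) (t : List Bool) :
    lead (List.replicate j false ++ true :: t) = j := by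
  simp [lead]

theorem lead_replicate (j : ℕ) : lead (List.replicate j false) = j := by simp [lead]

/-! ### Reversible loops over binary counters -/

namespace Frag

section counter
variable {ι : Type} [DecidableEq ι]

/-- Move the head of `A` from the left end of its word to the first cell that is not `0`. -/
def scan (A : ι) : Frag ι := loop (sees A none) (mv A .right) (sees A (some false))ᶜ skip

theorem run_scan (A : ι) (l : List Bool) (α : ι → Tape (Option Bool)) :
    (scan A).Run (4 * (l.length + 1)) (Function.update α A (word l 0))
      (Function.update α A (word l (lead l + 1))) := by
  refine (run_loop (T := 1) (T' := 1) (lead l) (fun i => Function.update α A (word l i))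
    (fun i => Function.update α A (word l (i + 1))) ?_ ?_ ?_ ?_ ?_ ?_).mono
      (by have := lead_le l; omega)
  · simp [heads_update_mem_sees]
  · intro i _; simpa using run_mv_update A .right α (word l i)
  · intro i hi
    simp [heads_update_mem_sees, getElem?_of_lt_lead hi]
  · intro i _; exact run_skip _
  · intro i hi
    rw [heads_update_mem_sees, head_word_succ, getElem?_of_lt_lead hi]; simp
  · rw [Set.mem_compl_iff, heads_update_mem_sees, head_word_succ]
    exact getElem?_lead_ne l

/-- Flip the low-order ones of the counter on `A` and the zero after them. -/
def carry (A : ι) : Frag ι :=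
  loop (sees A none) (seq (mv A .right) (permC A (Equiv.swap (some false) (some true))))
    (sees A (some false))ᶜ skip

theorem run_flip (A : ι) (u r : List Bool) (a : Bool) (α : ι → Tape (Option Bool)) :
    (seq (mv A .right) (permC A (Equiv.swap (some false) (some true)))).Run 5
      (Function.update α A (word (u ++ a :: r) u.length))
      (Function.update α A (word (u ++ (!a) :: r) (u.length + 1))) := by
  have h := run_seq (run_mv_update A .right α (word (u ++ a :: r) u.length))
    (run_permC_update A (Equiv.swap (some false) (some true)) α _)
  have h2 : Equiv.swap (some false) (some true) (some a) = some (!a) := by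
    cases a <;> simp
  rw [word_move_right, head_word_succ, List.getElem?_append_right le_rfl, Nat.sub_self,
    List.getElem?_cons_zero, h2, word_write_mid] at h
  exact h

/-- Flipping stops at the first cell that does not show 0 after its flip. This is the first nonzero
cell of the new counter, exactly where `scan` would stop, so the inverse of `scan` brings the head
home. -/
theorem run_carry (A : ι) (l : List Bool) (α : ι → Tape (Option Bool)) :
    (carry A).Run (8 * (l.length + 1)) (Function.update α A (word l 0))
      (Function.update α A (word (incr l) (lead (incr l) + 1))) := by
  have step : ∀ (j i : ℕ) (r : List Bool), i < j →
      (seq (mv A .right) (permC A (Equiv.swap (some false) (some true)))).Run 5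
        (Function.update α A (word (List.replicate i false ++ List.replicate (j - i) true ++ r) i))
        (Function.update α A
          (word (List.replicate (i + 1) false ++ List.replicate (j - (i + 1)) true ++ r)
            (i + 1))) := by
    intro j i r hi
    have h := run_flip A (List.replicate i false) (List.replicate (j - (i + 1)) true ++ r) true α
    have hj : j - i = (j - (i + 1)) + 1 := by omega
    rw [List.length_replicate] at h
    rw [hj, List.replicate_succ, List.replicate_succ', List.append_assoc, List.append_assoc,
      List.append_assoc]
    exact h
  have seen : ∀ (j i : ℕ) (r : List Bool), i < j →
      (List.replicate (i + 1) false ++ List.replicate (j - (i + 1)) true ++ r)[i]? =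
        some false := by
    intro j i r hi
    rw [List.getElem?_append_left (by simp; omega), List.getElem?_append_left (by simp)]
    simp
  rcases incr_cases l with ⟨j, t, hl, hi⟩ | ⟨hl, hi⟩
  · have hlen : j ≤ l.length := by rw [hl]; simp
    rw [hi, lead_replicate_append, hl]
    have := run_loop (A := sees A none) (B := (sees A (some false))ᶜ)
      (P := seq (mv A .right) (permC A (Equiv.swap (some false) (some true)))) (Q := skip)
      (T := 5) (T' := 1) j
      (fun i => Function.update α A
        (word (List.replicate i false ++ List.replicate (j - i) true ++ false :: t) i))
      -- The last round differs from the others: it turns the zero after the block of ones into a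
      -- one.
      (fun i => Function.update α A (word (if i = j then List.replicate j false ++ true :: t else
        List.replicate (i + 1) false ++ List.replicate (j - (i + 1)) true ++ false :: t) (i + 1)))
      (by simp [heads_update_mem_sees]) ?_ ?_ ?_ ?_ ?_
    · simp only [List.replicate_zero, List.nil_append, Nat.sub_zero, if_true] at this
      exact this.mono (by rw [← hl]; omega)
    · intro i hij
      rcases hij.lt_or_eq with h | rfl
      · rw [if_neg h.ne]; exact step _ _ _ h
      · have := run_flip A (List.replicate i false) t false α
        simpa using this
    · intro i hij
      rw [if_neg hij.ne, Set.mem_compl_iff, heads_update_mem_sees, head_word_succ,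
        seen _ _ _ hij, not_not]
    · intro i hij
      rw [if_neg hij.ne]; exact run_skip _
    · intro i hij
      rw [heads_update_mem_sees, head_word_succ, seen _ _ _ hij]; simp
    · rw [if_pos rfl, Set.mem_compl_iff, heads_update_mem_sees, head_word_succ,
        List.getElem?_append_right (by simp)]
      simp
  · generalize hj : l.length = j at hl hi
    rw [hi, lead_replicate, hl]
    have := run_loop (A := sees A none) (B := (sees A (some false))ᶜ)
      (P := seq (mv A .right) (permC A (Equiv.swap (some false) (some true)))) (Q := skip)
      (T := 5) (T' := 1) j
      (fun i => Function.update α A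
        (word (List.replicate i false ++ List.replicate (j - i) true ++ []) i))
      (fun i => Function.update α A (word (if i = j then List.replicate j false else
        List.replicate (i + 1) false ++ List.replicate (j - (i + 1)) true ++ []) (i + 1)))
      (by simp [heads_update_mem_sees]) ?_ ?_ ?_ ?_ ?_
    · simp only [List.replicate_zero, List.nil_append, Nat.sub_zero, if_true,
        List.append_nil] at this
      exact this.mono (by omega)
    · intro i hij
      rcases hij.lt_or_eq with h | rfl
      · rw [if_neg h.ne]; exact step _ _ _ h
      -- On overflow the last round reaches the blank after the word, which the swap of 0 and 1
      -- fixes.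
      · have h := run_seq (run_mv_update A .right α (word (List.replicate i false) i))
          (run_permC_update A (Equiv.swap (some false) (some true)) α _)
        rw [word_move_right, head_word_succ, List.getElem?_eq_none (by simp),
          Equiv.swap_apply_of_ne_of_ne (by simp) (by simp), write_eq_self
            (by rw [head_word_succ, List.getElem?_eq_none (by simp)])] at h
        simpa using h
    · intro i hij
      rw [if_neg hij.ne, Set.mem_compl_iff, heads_update_mem_sees, head_word_succ,
        seen _ _ _ hij, not_not]
    · intro i hij
      rw [if_neg hij.ne]; exact run_skip _
    · intro i hij
      rw [heads_update_mem_sees, head_word_succ, seen _ _ _ hij]; simp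
    · rw [if_pos rfl, Set.mem_compl_iff, heads_update_mem_sees, head_word_succ,
        List.getElem?_eq_none (by simp)]
      simp

/-- Add one to the counter on `A`. -/
def inc (A : ι) : Frag ι := seq (carry A) (scan A).inv

theorem run_inc (A : ι) (l : List Bool) (α : ι → Tape (Option Bool)) :
    (inc A).Run (15 * (l.length + 1)) (Function.update α A (word l 0))
      (Function.update α A (word (incr l) 0)) :=
  (run_seq (run_carry A l α) (run_scan A (incr l) α).inv).mono (by rw [length_incr]; omega)

/-- Execute `body` for each value of the counter on `A`, which is zero at the beginning and at
the end. -/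
def forAll (A : ι) (body : Frag ι) : Frag ι :=
  seq (scan A) (seq (loop (sees A none)
    (seq (scan A).inv (seq body (seq (inc A) (scan A)))) (sees A none) skip) (scan A).inv)

/-- Since the increment wraps around, the value zero serves both as entry assertion and as stopping
test, and the counter is clean afterwards. No record of the number of rounds is needed. -/
theorem run_forAll {A : ι} {body : Frag ι} {T e : ℕ} (α : ℕ → ι → Tape (Option Bool))
    (hA : ∀ i, α i A = word (List.replicate e false) 0)
    (h : ∀ i < 2 ^ e, body.Run T (Function.update (α i) A (word (bits e i) 0))
      (Function.update (α (i + 1)) A (word (bits e i) 0))) :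
    (forAll A body).Run (2 ^ e * (T + 60 * (e + 1))) (α 0) (α (2 ^ e)) := by
  obtain ⟨N, hN⟩ : ∃ N, 2 ^ e = N + 1 := ⟨2 ^ e - 1, (Nat.sub_add_cancel Nat.one_le_two_pow).symm⟩
  -- No intermediate value passes the zero test, because values below `2 ^ e` have distinct bits.
  have seen : ∀ i, i < 2 ^ e → i ≠ 0 → (word (bits e i) (lead (bits e i) + 1)).head ≠ none := by
    intro i hi h0
    rw [head_word_succ]
    intro h
    rw [getElem?_lead_eq_none_iff, length_bits, ← bits_zero] at h
    exact h0 (bits_injOn hi (by positivity) h)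
  have seen0 : (word (List.replicate e false) (lead (List.replicate e false) + 1)).head = none := by
    rw [head_word_succ, getElem?_lead_eq_none_iff, List.length_replicate]
  have hloop := run_loop (A := sees A none) (B := sees A none)
    (P := seq (scan A).inv (seq body (seq (inc A) (scan A)))) (Q := skip)
    (T := T + 32 * (e + 1)) (T' := 1) N
    (fun i => Function.update (α i) A (word (bits e i) (lead (bits e i) + 1)))
    (fun i => Function.update (α (i + 1)) A
      (word (bits e (i + 1)) (lead (bits e (i + 1)) + 1)))
    (by rw [heads_update_mem_sees, bits_zero]; exact seen0)
    (fun i hi => by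
      have h1 := (run_scan A (bits e i) (α i)).inv
      have h2 := run_inc A (bits e i) (α (i + 1))
      have h3 := run_scan A (bits e (i + 1)) (α (i + 1))
      rw [incr_bits] at h2
      refine (run_seq h1 (run_seq (h i (by omega)) (run_seq h2 h3))).mono ?_
      simp only [length_bits]; omega)
    (fun i hi => by
      rw [heads_update_mem_sees]; exact seen _ (by omega) (by omega))
    (fun i hi => run_skip _)
    (fun i hi => by
      rw [heads_update_mem_sees]; exact seen _ (by omega) (by omega))
    (by rw [heads_update_mem_sees, ← hN, bits_two_pow]; exact seen0)
  simp only [← hN, bits_zero, bits_two_pow] at hloop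
  have := run_seq (run_scan A _ (α 0)) (run_seq hloop (run_scan A _ (α (2 ^ e))).inv)
  rw [← hA 0, Function.update_eq_self, hA 0, ← hA (2 ^ e), Function.update_eq_self] at this
  refine this.mono ?_
  rw [List.length_replicate]
  have : e + 1 ≤ 2 ^ e * (e + 1) := Nat.le_mul_of_pos_left _ (by positivity)
  have : 1 ≤ 2 ^ e := Nat.one_le_two_pow
  nlinarith

end counter

end Frag

/-! ### Running a reversible machine backwards -/

/-- The names of the tapes: those of the simulated machine, one tape for each of its states
(marked at the current state), and the tapes of the simulating machine. -/
inductive Ix (U : QuadMachine) : Type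
  | ur (i : Fin (U.work + 2))
  | st (s : U.State)
  | x
  | p
  | level
  | unit
  | block
  | ruler
  | cand
  | drop
  | kept
  | clock
  | mism
  | hits
  | iter
  | bad
  | stuck

noncomputable instance (U : QuadMachine) : DecidableEq (Ix U) := Classical.decEq _

/-- The contents of all tapes. -/
@[ext]
structure Tapes (U : QuadMachine) where
  ur : Fin (U.work + 2) → Tape (Option Bool)
  st : U.State → Tape (Option Bool)
  (x p level unit block ruler cand drop kept clock mism hits iter bad stuck : Tape (Option Bool))

namespace Tapes

variable {U : QuadMachine}

/-- The tape with a given name. -/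
def get (T : Tapes U) : Ix U → Tape (Option Bool)
  | .ur i => T.ur i
  | .st s => T.st s
  | .x => T.x
  | .p => T.p
  | .level => T.level
  | .unit => T.unit
  | .block => T.block
  | .ruler => T.ruler
  | .cand => T.cand
  | .drop => T.drop
  | .kept => T.kept
  | .clock => T.clock
  | .mism => T.mism
  | .hits => T.hits
  | .iter => T.iter
  | .bad => T.bad
  | .stuck => T.stuck

open scoped Classical in
@[simp] theorem update_ur (T : Tapes U) (i : Fin (U.work + 2)) (t : Tape (Option Bool)) :
    Function.update T.get (.ur i) t = { T with ur := Function.update T.ur i t }.get := by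
  funext j
  cases j with
  | ur j => by_cases h : j = i <;> simp [get, h]
  | _ => rw [Function.update_of_ne (by simp)]; rfl

open scoped Classical in
@[simp] theorem update_st (T : Tapes U) (s : U.State) (t : Tape (Option Bool)) :
    Function.update T.get (.st s) t = { T with st := Function.update T.st s t }.get := by
  funext j
  cases j with
  | st j => by_cases h : j = s <;> simp [get, h]
  | _ => rw [Function.update_of_ne (by simp)]; rfl

@[simp] theorem update_x (T : Tapes U) (t : Tape (Option Bool)) :
    Function.update T.get .x t = { T with x := t }.get := by
  funext j; cases j <;> simp [get]

@[simp] theorem update_p (T : Tapes U) (t : Tape (Option Bool)) :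
    Function.update T.get .p t = { T with p := t }.get := by
  funext j; cases j <;> simp [get]

@[simp] theorem update_level (T : Tapes U) (t : Tape (Option Bool)) :
    Function.update T.get .level t = { T with level := t }.get := by
  funext j; cases j <;> simp [get]

@[simp] theorem update_unit (T : Tapes U) (t : Tape (Option Bool)) :
    Function.update T.get .unit t = { T with unit := t }.get := by
  funext j; cases j <;> simp [get]

@[simp] theorem update_block (T : Tapes U) (t : Tape (Option Bool)) :
    Function.update T.get .block t = { T with block := t }.get := by
  funext j; cases j <;> simp [get]

@[simp] theorem update_ruler (T : Tapes U) (t : Tape (Option Bool)) :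
    Function.update T.get .ruler t = { T with ruler := t }.get := by
  funext j; cases j <;> simp [get]

@[simp] theorem update_cand (T : Tapes U) (t : Tape (Option Bool)) :
    Function.update T.get .cand t = { T with cand := t }.get := by
  funext j; cases j <;> simp [get]

@[simp] theorem update_drop (T : Tapes U) (t : Tape (Option Bool)) :
    Function.update T.get .drop t = { T with drop := t }.get := by
  funext j; cases j <;> simp [get]

@[simp] theorem update_kept (T : Tapes U) (t : Tape (Option Bool)) :
    Function.update T.get .kept t = { T with kept := t }.get := by
  funext j; cases j <;> simp [get]

@[simp] theorem update_clock (T : Tapes U) (t : Tape (Option Bool)) :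
    Function.update T.get .clock t = { T with clock := t }.get := by
  funext j; cases j <;> simp [get]

@[simp] theorem update_mism (T : Tapes U) (t : Tape (Option Bool)) :
    Function.update T.get .mism t = { T with mism := t }.get := by
  funext j; cases j <;> simp [get]

@[simp] theorem update_hits (T : Tapes U) (t : Tape (Option Bool)) :
    Function.update T.get .hits t = { T with hits := t }.get := by
  funext j; cases j <;> simp [get]

@[simp] theorem update_iter (T : Tapes U) (t : Tape (Option Bool)) :
    Function.update T.get .iter t = { T with iter := t }.get := by
  funext j; cases j <;> simp [get]

@[simp] theorem update_bad (T : Tapes U) (t : Tape (Option Bool)) :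
    Function.update T.get .bad t = { T with bad := t }.get := by
  funext j; cases j <;> simp [get]

@[simp] theorem update_stuck (T : Tapes U) (t : Tape (Option Bool)) :
    Function.update T.get .stuck t = { T with stuck := t }.get := by
  funext j; cases j <;> simp [get]

end Tapes

section simulation

variable {U : QuadMachine}

open scoped Classical in
/-- The symbol on the tape of the state `s` when the current state is `a`. -/
noncomputable def mark (a s : U.State) : Option Bool := if s = a then some true else none

open scoped Classical in
/-- The tape of the state `s` when the current state is `a`. -/
noncomputable def markTape (a s : U.State) : Tape (Option Bool) :=
  if s = a then word [true] 1 else word [] 1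

/-- Storing the state of `U` on tapes lets one fixed transition simulate all its quadruples;
injectivity ensures that the scanned marks determine the state. -/
theorem mark_injective : Function.Injective (mark (U := U)) := by
  intro a b h
  have := congrFun h a
  by_contra hne
  simp [mark, hne] at this

theorem head_markTape (a s : U.State) : (markTape a s).head = mark a s := by
  unfold markTape mark; split_ifs <;> simp

theorem word_true_write_none : (word [true] 1).write none = word [] 1 :=
  word_write (by simp) (by intro i hi; cases i <;> simp_all)

theorem word_nil_write_true : (word [] 1).write (some true) = word [true] 1 :=
  word_write_append [] true

theorem markTape_write (a b s : U.State) : (markTape a s).write (mark b s) = markTape b s := by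
  unfold markTape mark
  split_ifs
  · exact write_eq_self rfl
  · exact word_nil_write_true
  · exact word_true_write_none
  · exact write_eq_self rfl

/-- The action of the quadruple `r` of `U` on all tapes. -/
noncomputable def simAction (r : U.State × (Fin (U.work + 2) → TapeAction) × U.State) :
    Ix U → TapeAction
  | .ur i => r.2.1 i
  | .st s => .write (mark r.1 s) (mark r.2.2 s)
  | _ => .stay

/-- Two applicable quadruples start in the same marked state, so determinism of `U` makes their
results agree, even if the quadruples themselves differ. -/
theorem simAction_det (hU : U.IsReversible) {r r' : U.State × (Fin (U.work + 2) → TapeAction) × U.State}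
    (hr : r ∈ U.rules) (hr' : r' ∈ U.rules) {α β β' : Ix U → Tape (Option Bool)}
    (h : ∀ i, (simAction r i).Rel (α i) (β i)) (h' : ∀ i, (simAction r' i).Rel (α i) (β' i)) :
    β = β' := by
  have h1 : r.1 = r'.1 := mark_injective (funext fun s => (h (.st s)).1.symm.trans (h' (.st s)).1)
  have h2 := hU.deterministic ⟨r.1, fun i => α (.ur i)⟩ ⟨r.2.2, fun i => β (.ur i)⟩
    ⟨r'.2.2, fun i => β' (.ur i)⟩ ⟨r, hr, rfl, rfl, fun i => h (.ur i)⟩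
    ⟨r', hr', h1, rfl, fun i => h' (.ur i)⟩
  rw [QuadMachine.Config.mk.injEq] at h2
  funext i
  have hi := h i
  have hi' := h' i
  cases i with
  | ur i => exact congrFun h2.2 i
  | st s =>
    have e := (h (.st s)).2
    have e' := (h' (.st s)).2
    rw [e, e', h2.1]
  | _ => exact rel_right_unique (a := .stay) hi hi'

theorem simAction_codet (hU : U.IsReversible)
    {r r' : U.State × (Fin (U.work + 2) → TapeAction) × U.State}
    (hr : r ∈ U.rules) (hr' : r' ∈ U.rules) {α β β' : Ix U → Tape (Option Bool)}
    (h : ∀ i, (simAction r i).Rel (β i) (α i)) (h' : ∀ i, (simAction r' i).Rel (β' i) (α i)) :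
    β = β' := by
  have e := fun s => invAction_rel.2 (h (.st s))
  have e' := fun s => invAction_rel.2 (h' (.st s))
  have h1 : r.2.2 = r'.2.2 := mark_injective (funext fun s => (e s).1.symm.trans (e' s).1)
  have h2 := hU.codeterministic ⟨r.1, fun i => β (.ur i)⟩ ⟨r'.1, fun i => β' (.ur i)⟩
    ⟨r.2.2, fun i => α (.ur i)⟩ ⟨r, hr, rfl, rfl, fun i => h (.ur i)⟩
    ⟨r', hr', rfl, h1, fun i => h' (.ur i)⟩
  rw [QuadMachine.Config.mk.injEq] at h2
  funext i
  have hi := h i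
  have hi' := h' i
  cases i with
  | ur i => exact congrFun h2.2 i
  | st s => rw [(e s).2, (e' s).2, h2.1]
  | _ => exact rel_right_unique (a := .stay) (Eq.symm hi) (Eq.symm hi')

/-- One step of `U`. -/
noncomputable def simStep (hU : U.IsReversible) : Frag (Ix U) where
  State := Bool
  finite_state := inferInstance
  entry := false
  exit := true
  rules := {q | ∃ r ∈ U.rules, q = (false, simAction r, true)}
  det := by
    rintro s α s₁ β₁ s₂ β₂ ⟨a, ⟨r, hr, h⟩, hR⟩ ⟨a', ⟨r', hr', h'⟩, hR'⟩
    simp only [Prod.mk.injEq] at h h'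
    obtain ⟨-, rfl, rfl⟩ := h
    obtain ⟨-, rfl, rfl⟩ := h'
    exact ⟨rfl, simAction_det hU hr hr' hR hR'⟩
  codet := by
    rintro s α s₁ β₁ s₂ β₂ ⟨a, ⟨r, hr, h⟩, hR⟩ ⟨a', ⟨r', hr', h'⟩, hR'⟩
    simp only [Prod.mk.injEq] at h h'
    obtain ⟨rfl, rfl, -⟩ := h
    obtain ⟨rfl, rfl, -⟩ := h'
    exact ⟨rfl, simAction_codet hU hr hr' hR hR'⟩
  source_ne_exit := by rintro q ⟨r, -, rfl⟩; simp
  target_ne_entry := by rintro q ⟨r, -, rfl⟩; simp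

/-- The tapes that hold the configuration `c` of `U` with the count `n` on the tape `stuck`. -/
noncomputable def Tapes.withConfig (T : Tapes U) (c : U.Config × ℕ) : Tapes U :=
  { T with ur := c.1.tape, st := markTape c.1.state, stuck := word [true] (c.2 + 1) }

theorem run_simStep (hU : U.IsReversible) {c d : U.Config} (h : U.Step c d) (T : Tapes U) (n : ℕ) :
    (simStep hU).Run 1 (T.withConfig (c, n)).get (T.withConfig (d, n)).get := by
  obtain ⟨r, hr, hc, hd, hR⟩ := h
  refine ⟨1, le_rfl, .single ⟨simAction r, ⟨r, hr, rfl⟩, fun i => ?_⟩⟩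
  cases i with
  | ur i => exact hR i
  | st s =>
    refine ⟨?_, ?_⟩
    · simp [Tapes.get, Tapes.withConfig, head_markTape, hc]
    · simp [Tapes.get, Tapes.withConfig, hc, hd, markTape_write]
  | _ => rfl

/-- The scanned symbols show that the configuration has a predecessor, and `stuck` is at its
mark. -/
def canRetreat (U : QuadMachine) : Set (Ix U → Option Bool) :=
  {v | v .stuck = some true ∧ ∃ r ∈ U.rules, (∀ s, v (.st s) = mark r.2.2 s) ∧
    ∀ i a b, r.2.1 i = .write a b → v (.ur i) = b}

/-- Whether a predecessor exists can be read off the heads: shifts and stays can always be undone,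
and a write exactly when the written symbol is under the head. -/
theorem heads_withConfig_mem_canRetreat {T : Tapes U} {c : U.Config × ℕ} :
    heads (T.withConfig c).get ∈ canRetreat U ↔ c.2 = 0 ∧ ∃ d, U.Step d c.1 := by
  obtain ⟨c, n⟩ := c
  have hstuck : heads (T.withConfig (c, n)).get .stuck = some true ↔ n = 0 := by
    change (word [true] (n + 1)).head = some true ↔ n = 0
    rw [head_word_succ]
    cases n <;> simp
  have hst : ∀ s, heads (T.withConfig (c, n)).get (.st s) = mark c.state s :=
    fun s => head_markTape _ _
  rw [canRetreat, Set.mem_ofPred_eq, hstuck]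
  refine and_congr_right fun _ => ⟨?_, ?_⟩
  · rintro ⟨r, hr, h1, h2⟩
    have hc : c.state = r.2.2 :=
      mark_injective (funext fun s => (hst s).symm.trans (h1 s))
    have : ∀ i, ∃ S, (invAction (r.2.1 i)).Rel (c.tape i) S := by
      intro i
      have hi := h2 i
      rcases hA : r.2.1 i with ⟨a, b⟩ | ⟨_ | _⟩ | _
      · exact ⟨_, hi a b hA, rfl⟩
      · exact ⟨_, rfl⟩
      · exact ⟨_, rfl⟩
      · exact ⟨_, rfl⟩
    choose S hS using this
    exact ⟨⟨r.1, S⟩, r, hr, rfl, hc, fun i => invAction_rel.1 (hS i)⟩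
  · rintro ⟨d, r, hr, h1, h2, h3⟩
    refine ⟨r, hr, fun s => by rw [hst, h2], fun i a b hi => ?_⟩
    have := h3 i
    rw [hi] at this
    exact (invAction_rel.2 this).1

open scoped Classical in
/-- Go back one step, or count if there is no predecessor. -/
noncomputable def retreat (c : U.Config × ℕ) : U.Config × ℕ :=
  if h : c.2 = 0 ∧ ∃ d, U.Step d c.1 then (h.2.choose, 0) else (c.1, c.2 + 1)

/-- The program for `retreat`. -/
noncomputable def tick (hU : U.IsReversible) : Frag (Ix U) :=
  .cond (canRetreat U) (simStep hU).inv (.mv .stuck .right) (Frag.sees .stuck (some true))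

/-- Waiting at a configuration without predecessor would lose the arrival time. Moving the head of
`stuck` records the waiting time, and its mark under the head distinguishes the two branches
afterwards. -/
theorem run_tick (hU : U.IsReversible) (T : Tapes U) (c : U.Config × ℕ) :
    (tick hU).Run 3 (T.withConfig c).get (T.withConfig (retreat c)).get := by
  unfold retreat
  split_ifs with h
  · refine Frag.run_cond_pos (heads_withConfig_mem_canRetreat.2 h) ?_ ?_
    · obtain ⟨c, n⟩ := c
      obtain ⟨rfl : n = 0, hd⟩ := h
      exact (run_simStep hU hd.choose_spec T 0).inv
    · simp [Frag.heads_mem_sees, Tapes.get, Tapes.withConfig]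
  · refine Frag.run_cond_neg (fun h' => h (heads_withConfig_mem_canRetreat.1 h')) ?_ ?_
    · have := Frag.run_mv .stuck .right (T.withConfig c).get
      have e : ((T.withConfig c).get .stuck).move .right = word [true] (c.2 + 1 + 1) :=
        word_move_right _ _
      rw [e, Tapes.update_stuck] at this
      exact this
    · simp [Frag.heads_mem_sees, Tapes.get, Tapes.withConfig]

/-- Go back as many steps as the counter `clock` has values. -/
noncomputable def ticks (hU : U.IsReversible) : Frag (Ix U) := .forAll .clock (tick hU)

theorem run_ticks (hU : U.IsReversible) {T : Tapes U} {e : ℕ}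
    (hT : T.clock = word (List.replicate e false) 0) (c : U.Config × ℕ) :
    (ticks hU).Run (2 ^ e * (63 * (e + 1))) (T.withConfig c).get
      (T.withConfig (retreat^[2 ^ e] c)).get := by
  have hb : ∀ i < 2 ^ e, (tick hU).Run 3
      (Function.update (T.withConfig (retreat^[i] c)).get .clock (word (bits e i) 0))
      (Function.update (T.withConfig (retreat^[i + 1] c)).get .clock (word (bits e i) 0)) := by
    intro i _
    rw [Tapes.update_clock, Tapes.update_clock, Function.iterate_succ_apply']
    exact run_tick hU { T with clock := word (bits e i) 0 } _
  exact (Frag.run_forAll (A := Ix.clock) (fun i => (T.withConfig (retreat^[i] c)).get)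
    (fun _ => hT) hb).mono (Nat.mul_le_mul_left _ (by omega))

theorem retreat_of_step (hU : U.IsReversible) {d c : U.Config} (h : U.Step d c) :
    retreat (c, 0) = (d, 0) := by
  have h' : ((c, 0) : U.Config × ℕ).2 = 0 ∧ ∃ d, U.Step d (c, 0).1 := ⟨rfl, d, h⟩
  rw [retreat, dif_pos h', hU.codeterministic _ _ _ h'.2.choose_spec h]

theorem retreat_iterate_of_steps (hU : U.IsReversible) {t : ℕ} {c d : U.Config}
    (h : U.Steps t c d) : retreat^[t] (d, 0) = (c, 0) := by
  induction h with
  | refl => rfl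
  | tail _ hs ih => rw [Function.iterate_succ_apply, retreat_of_step hU hs, ih]

theorem retreat_iterate_start (hU : U.IsReversible) {c : U.Config} (hc : c.state = U.start)
    (t n : ℕ) : (retreat^[t] (c, n)).1 = c := by
  have key : ∀ n, retreat (c, n) = (c, n + 1) := by
    intro n
    rw [retreat, dif_neg]
    rintro ⟨-, d, r, hr, -, h, -⟩
    exact hU.target_ne_start r hr (h.symm.trans hc)
  induction t generalizing n with
  | zero => rfl
  | succ t ih => rw [Function.iterate_succ_apply, key, ih]

/-- No quadruple enters the start state, so once the backward run has arrived there it stays; only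
an upper bound on the running time has to be known. -/
theorem retreat_iterate_eq_start (hU : U.IsReversible) {t t' : ℕ} {c d : U.Config}
    (h : U.Steps t c d) (hc : c.state = U.start) (ht : t ≤ t') :
    (retreat^[t'] (d, 0)).1 = c := by
  obtain ⟨k, rfl⟩ := Nat.exists_eq_add_of_le' ht
  rw [Function.iterate_add_apply, retreat_iterate_of_steps hU h, retreat_iterate_start hU hc]

end simulation

/-! ### The search for a string that is hard to erase -/

section search

variable {U : QuadMachine}

/-! ### Comparing words with the simulated first tape -/

/-- Count on `mism` if the symbols on `A` and on the first tape of `U` differ. -/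
noncomputable def differ (A : Ix U) : Frag (Ix U) :=
  .cond {v | v A = v (.ur 0)} .skip (.mv .mism .right) {v | v A = v (.ur 0)}

/-- Go to the next cell of `A` and compare it with the first tape of `U`. -/
noncomputable def compareStep (A : Ix U) : Frag (Ix U) :=
  .seq (.mv A .right) (.seq (differ A) (.mv (.ur 0) .right))

open scoped Classical in
/-- The number of places below `n` where `Y` differs from `l`. -/
noncomputable def mismatches (l : List Bool) (Y : Tape (Option Bool)) (n : ℕ) : ℕ :=
  ∑ i ∈ Finset.range n, if l[i]? = Y.nth i then 0 else 1

theorem mismatches_eq_zero_iff {l : List Bool} {Y : Tape (Option Bool)} {n : ℕ} :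
    mismatches l Y n = 0 ↔ ∀ i < n, l[i]? = Y.nth i := by
  simp [mismatches, Finset.sum_eq_zero_iff]

theorem head_move_right_iterate (Y : Tape (Option Bool)) (i : ℕ) :
    ((Tape.move Dir.right)^[i] Y).head = Y.nth i := by
  rw [← Tape.nth_zero, move_right_iterate_nth, zero_add]

/-- The function `f` exposes the four tapes that move and hides all others. Together `hB`, `hA`,
`hY` and `hM` say that it is a lens for them, so the lemma serves both the kept part and the
candidate. -/
theorem run_compare {A B : Ix U}
    (f : Tape (Option Bool) → Tape (Option Bool) → Tape (Option Bool) → Tape (Option Bool) →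
      Ix U → Tape (Option Bool))
    (hB : ∀ b a y m t, Function.update (f b a y m) B t = f t a y m)
    (hA : ∀ b a y m t, Function.update (f b a y m) A t = f b t y m)
    (hY : ∀ b a y m t, Function.update (f b a y m) (.ur 0) t = f b a t m)
    (hM : ∀ b a y m t, Function.update (f b a y m) .mism t = f b a y t)
    (k l : List Bool) (Y : Tape (Option Bool)) (c : ℕ) :
    (Frag.forCells B (compareStep A)).Run ((k.length + 1) * 14)
      (f (word k 0) (word l 0) Y (word [true] (c + 1)))
      (f (word k (k.length + 1)) (word l k.length) ((Tape.move Dir.right)^[k.length] Y)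
        (word [true] (c + mismatches l Y k.length + 1))) := by
  have gA : ∀ b a y m, f b a y m A = a := fun b a y m => by
    rw [← hA b a y m a, Function.update_self]
  have gY : ∀ b a y m, f b a y m (.ur 0) = y := fun b a y m => by
    rw [← hY b a y m y, Function.update_self]
  have gM : ∀ b a y m, f b a y m .mism = m := fun b a y m => by
    rw [← hM b a y m m, Function.update_self]
  have key : ∀ b y i m, (compareStep A).Run 11
      (f b (word l i) ((Tape.move Dir.right)^[i] y) (word [true] m))
      (f b (word l (i + 1)) ((Tape.move Dir.right)^[i + 1] y)
        (word [true] (m + if l[i]? = y.nth i then 0 else 1))) := by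
    intro b y i m
    have h1 := Frag.run_mv A .right (f b (word l i) ((Tape.move Dir.right)^[i] y) (word [true] m))
    rw [hA, gA, word_move_right] at h1
    have h3 := Frag.run_mv (.ur 0) .right (f b (word l (i + 1)) ((Tape.move Dir.right)^[i] y)
      (word [true] (m + if l[i]? = y.nth i then 0 else 1)))
    rw [hY, gY, ← Function.iterate_succ_apply' (Tape.move Dir.right)] at h3
    have hm : ∀ m, heads (f b (word l (i + 1)) ((Tape.move Dir.right)^[i] y) m) ∈
        {v : Ix U → Option Bool | v A = v (.ur 0)} ↔ l[i]? = y.nth i := by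
      intro m
      rw [Set.mem_ofPred_eq, heads, heads, gA, gY, head_word_succ, head_move_right_iterate]
    refine Frag.run_seq (T' := 7) h1 (Frag.run_seq (T := 3) ?_ h3)
    split_ifs with h
    · exact Frag.run_cond_pos ((hm _).2 h) (Frag.run_skip _) ((hm _).2 h)
    · refine Frag.run_cond_neg (fun h' => h ((hm _).1 h')) ?_ (fun h' => h ((hm _).1 h'))
      have h2 := Frag.run_mv .mism .right
        (f b (word l (i + 1)) ((Tape.move Dir.right)^[i] y) (word [true] m))
      rwa [hM, gM, word_move_right] at h2
  have := Frag.run_forCells (A := B) (body := compareStep A) (T := 11) (l := k)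
    (fun i => f (word k 0) (word l i) ((Tape.move Dir.right)^[i] Y)
      (word [true] (c + mismatches l Y i + 1))) (fun i _ => by
        have hs : c + mismatches l Y (i + 1) + 1 =
            c + mismatches l Y i + 1 + if l[i]? = Y.nth i then 0 else 1 := by
          rw [mismatches, Finset.sum_range_succ, ← mismatches]; ring
        rw [hB, hB, hs]
        exact key _ _ _ _)
  rw [hB, hB] at this
  simpa [mismatches] using this

/-! ### Testing one program against one candidate -/

/-- The program `q`, at rest, on the second tape of `U`; the other tapes of `U` blank. -/
def recordTape (U : QuadMachine) (q : List Bool) : Fin (U.work + 2) → Tape (Option Bool) :=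
  fun i => if i = 1 then word q 0 else word [] 0

theorem update_recordTape (q : List Bool) (h : ℕ) :
    Function.update (recordTape U q) 1 (word q h) =
      fun i => if i = 1 then word q h else word [] 0 := by
  funext i
  by_cases hi : i = 1 <;> simp [recordTape, hi]

/-- The tapes at rest during the search: `s` is the kept part of the input, `r` its remainder,
`w` the candidate for the first part of the remainder, `q` a program for `U`, and `c` the number
of hits found. -/
noncomputable def setup (T : Tapes U) (s r w q : List Bool) (ρ W c : ℕ) : Tapes U :=
  { T with
    ur := recordTape U q
    st := markTape U.halt
    stuck := word [true] 1
    x := word (s ++ r) 0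
    kept := word (List.replicate s.length false) 0
    ruler := word (List.replicate ρ false) 0
    cand := word w 0
    clock := word (List.replicate W false) 0
    mism := word [true] 1
    hits := word [true] (c + 1) }

/-- The configuration reached backwards from `q` within `2 ^ W` steps. -/
noncomputable def origin (U : QuadMachine) (q : List Bool) (W : ℕ) : U.Config × ℕ :=
  retreat^[2 ^ W] (U.pairConfig U.halt [] q, 0)

/-- Running `U` backwards from `q` for `2 ^ W` steps leads to the start state with the first `N`
symbols of `l` on the first tape. -/
def Hits (U : QuadMachine) (l q : List Bool) (N W : ℕ) : Prop :=
  (origin U q W).1.state = U.start ∧ ∀ i < N, l[i]? = ((origin U q W).1.tape 0).nth i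

/-- Run `U` backwards and compare the result with the kept part and the candidate. -/
noncomputable def hitRun (hU : U.IsReversible) : Frag (Ix U) :=
  .seq (.mv (.ur 1) .right) (.seq (ticks hU) (.seq (.forCells .kept (compareStep .x))
    (.forCells .ruler (compareStep .cand))))

/-- The tapes after `hitRun`. -/
noncomputable def hitEnd (T : Tapes U) (s r w q : List Bool) (ρ W c : ℕ) : Tapes U :=
  { (setup T s r w q ρ W c).withConfig (origin U q W) with
    ur := Function.update (origin U q W).1.tape 0
      ((Tape.move Dir.right)^[ρ] ((Tape.move Dir.right)^[s.length] ((origin U q W).1.tape 0)))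
    x := word (s ++ r) s.length
    kept := word (List.replicate s.length false) (s.length + 1)
    ruler := word (List.replicate ρ false) (ρ + 1)
    cand := word w ρ
    mism := word [true] (mismatches (s ++ r) ((origin U q W).1.tape 0) s.length +
      mismatches w ((Tape.move Dir.right)^[s.length] ((origin U q W).1.tape 0)) ρ + 1) }

theorem run_hitRun (hU : U.IsReversible) (T : Tapes U) (s r w q : List Bool) (ρ W c : ℕ) :
    (hitRun hU).Run (2 ^ W * (63 * (W + 1)) + 14 * (s.length + ρ + 3))
      (setup T s r w q ρ W c).get (hitEnd T s r w q ρ W c).get := by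
  have h1 := Frag.run_mv (.ur 1) .right (setup T s r w q ρ W c).get
  have e1 : ((setup T s r w q ρ W c).get (.ur 1)).move .right = word q 1 := by
    simp [setup, Tapes.get, recordTape]
  -- Once the head of the record is on its first symbol, the simulated tapes form the halting
  -- configuration with empty output and garbage `q`.
  have e2 : { setup T s r w q ρ W c with ur := Function.update (recordTape U q) 1 (word q 1) } =
      (setup T s r w q ρ W c).withConfig (U.pairConfig U.halt [] q, 0) := by
    rw [update_recordTape]
    ext : 1 <;> try rfl
    funext i
    rcases eq_or_ne i 1 with rfl | hi
    · simp [Tapes.withConfig, QuadMachine.pairConfig, word_one]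
    · simp [Tapes.withConfig, QuadMachine.pairConfig, hi, word_nil 0 1, word_one]
  rw [e1, Tapes.update_ur] at h1
  have h2 := run_ticks hU (T := setup T s r w q ρ W c) rfl (U.pairConfig U.halt [] q, 0)
  rw [← e2] at h2
  have h3 := run_compare (A := Ix.x) (B := Ix.kept) (U := U)
    (fun b a y m => Tapes.get { (setup T s r w q ρ W c).withConfig (origin U q W) with
      ur := Function.update (origin U q W).1.tape 0 y
      x := a
      kept := b
      mism := m }) (by simp) (by simp) (by simp) (by simp)
      (List.replicate s.length false) (s ++ r) ((origin U q W).1.tape 0) 0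
  have h4 := run_compare (A := Ix.cand) (B := Ix.ruler) (U := U)
    (fun b a y m => Tapes.get { (setup T s r w q ρ W c).withConfig (origin U q W) with
      ur := Function.update (origin U q W).1.tape 0 y
      x := word (s ++ r) s.length
      kept := word (List.replicate s.length false) (s.length + 1)
      ruler := b
      cand := a
      mism := m }) (by simp) (by simp) (by simp) (by simp)
      (List.replicate ρ false) w
      ((Tape.move Dir.right)^[s.length] ((origin U q W).1.tape 0))
      (mismatches (s ++ r) ((origin U q W).1.tape 0) s.length)
  simp only [List.length_replicate, Function.update_eq_self, zero_add] at h3 h4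
  exact (Frag.run_seq h1 (Frag.run_seq h2 (Frag.run_seq h3 h4))).mono (by omega)

/-- All symbols agree, and the state is the start state. -/
def isHit (U : QuadMachine) : Set (Ix U → Option Bool) :=
  {v | v .mism = some true ∧ v (.st U.start) = some true}

/-- A count is the distance of a head from a single mark, so seeing the mark on `mism` means no
mismatch. The kept part was read from `x` and the candidate from `cand`; together they are a prefix
of `s ++ w`. -/
theorem heads_hitEnd_mem_isHit {T : Tapes U} {s r w q : List Bool} {ρ W c : ℕ} :
    heads (hitEnd T s r w q ρ W c).get ∈ isHit U ↔ Hits U (s ++ w) q (s.length + ρ) W := by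
  have h1 : ∀ m, (word [true] (m + 1)).head = some true ↔ m = 0 := by
    intro m; rw [head_word_succ]; cases m <;> simp
  have h2 : ∀ a b : U.State, mark a b = some true ↔ a = b := by
    intro a b; unfold mark; split_ifs with h <;> simp [h]
    simpa [eq_comm] using h
  change (word [true] _).head = some true ∧ (markTape _ _).head = some true ↔ _
  rw [h1, head_markTape, h2, Hits, and_comm, Nat.add_eq_zero_iff, mismatches_eq_zero_iff,
    mismatches_eq_zero_iff]
  refine and_congr_right fun _ => ⟨?_, fun h => ⟨fun i hi => ?_, fun i hi => ?_⟩⟩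
  · rintro ⟨ha, hb⟩ i hi
    rcases lt_or_ge i s.length with h | h
    · rw [← ha i h, List.getElem?_append_left h, List.getElem?_append_left h]
    · rw [List.getElem?_append_right h, hb (i - s.length) (by omega), move_right_iterate_nth]
      congr 1; omega
  · rw [← h i (by omega), List.getElem?_append_left hi, List.getElem?_append_left hi]
  · have := h (s.length + i) (by omega)
    rw [List.getElem?_append_right (by omega), Nat.add_sub_cancel_left] at this
    rw [this, move_right_iterate_nth]
    congr 1; push_cast; ring

/-- Count on `hits` if the program on the second tape of `U` hits the candidate. -/
noncomputable def hit (hU : U.IsReversible) : Frag (Ix U) :=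
  .conj (hitRun hU) (.cond (isHit U) (.mv .hits .right) .skip (isHit U))

open scoped Classical in
-- The backward run never touches `hits`, so it can be undone from the updated count.
theorem run_hit (hU : U.IsReversible) (T : Tapes U) (s r w q : List Bool) (ρ W c : ℕ) :
    (hit hU).Run (2 ^ W * (300 * (W + s.length + ρ + 1)))
      (setup T s r w q ρ W c).get
      (setup T s r w q ρ W (c + if Hits U (s ++ w) q (s.length + ρ) W then 1 else 0)).get := by
  have h1 := run_hitRun hU T s r w q ρ W c
  have h3 := run_hitRun hU T s r w q ρ W (c + if Hits U (s ++ w) q (s.length + ρ) W then 1 else 0)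
  refine (Frag.run_conj (T' := 3) h1 ?_ h3).mono ?_
  · split_ifs with h
    · refine Frag.run_cond_pos (heads_hitEnd_mem_isHit.2 h) ?_ (heads_hitEnd_mem_isHit.2 h)
      have := Frag.run_mv .hits .right (hitEnd T s r w q ρ W c).get
      have e : ((hitEnd T s r w q ρ W c).get .hits).move .right = word [true] (c + 1 + 1) :=
        word_move_right _ _
      rw [e, Tapes.update_hits] at this
      exact this
    · exact Frag.run_cond_neg (mt heads_hitEnd_mem_isHit.1 h) (Frag.run_skip _)
        (mt heads_hitEnd_mem_isHit.1 h)
  · have : 1 ≤ 2 ^ W := Nat.one_le_two_pow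
    nlinarith [Nat.zero_le s.length, Nat.zero_le ρ]

/-! ### Counting hits over all programs -/

open scoped Classical in
/-- The number of programs of length `e` that hit. -/
noncomputable def hitCount (U : QuadMachine) (s w : List Bool) (e ρ W : ℕ) : ℕ :=
  ∑ v ∈ Finset.range (2 ^ e), if Hits U (s ++ w) (bits e v) (s.length + ρ) W then 1 else 0

/-- Count the programs of a given length that hit. -/
noncomputable def hitAll (hU : U.IsReversible) : Frag (Ix U) := .forAll (.ur 1) (hit hU)

theorem update_setup_ur (T : Tapes U) (s r w q q' : List Bool) (ρ W c : ℕ) :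
    Function.update (setup T s r w q ρ W c).get (.ur 1) (word q' 0) =
      (setup T s r w q' ρ W c).get := by
  rw [Tapes.update_ur]
  congr 1
  ext : 1 <;> try rfl
  funext i
  by_cases hi : i = 1
  · subst hi; simp [setup, recordTape]
  · simp [setup, recordTape, hi]

theorem setup_get_ur (T : Tapes U) (s r w q : List Bool) (ρ W c : ℕ) :
    (setup T s r w q ρ W c).get (.ur 1) = word q 0 := by
  simp [setup, Tapes.get, recordTape]

theorem run_hitAll (hU : U.IsReversible) (T : Tapes U) (s r w : List Bool) (e ρ W c : ℕ) :
    (hitAll hU).Run (2 ^ (e + W) * (360 * (e + W + s.length + ρ + 1)))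
      (setup T s r w (List.replicate e false) ρ W c).get
      (setup T s r w (List.replicate e false) ρ W (c + hitCount U s w e ρ W)).get := by
  classical
  have hb : ∀ i < 2 ^ e, (hit hU).Run (2 ^ W * (300 * (W + s.length + ρ + 1)))
      (Function.update (setup T s r w (List.replicate e false) ρ W
        (c + ∑ v ∈ Finset.range i,
          if Hits U (s ++ w) (bits e v) (s.length + ρ) W then 1 else 0)).get (.ur 1)
        (word (bits e i) 0))
      (Function.update (setup T s r w (List.replicate e false) ρ W
        (c + ∑ v ∈ Finset.range (i + 1),
          if Hits U (s ++ w) (bits e v) (s.length + ρ) W then 1 else 0)).get (.ur 1)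
        (word (bits e i) 0)) := by
    intro i _
    rw [update_setup_ur, update_setup_ur, Finset.sum_range_succ, ← add_assoc]
    exact run_hit hU _ _ _ _ _ _ _ _
  have := Frag.run_forAll (A := Ix.ur 1) (fun i => (setup T s r w (List.replicate e false) ρ W
        (c + ∑ v ∈ Finset.range i,
          if Hits U (s ++ w) (bits e v) (s.length + ρ) W then 1 else 0)).get)
      (fun _ => setup_get_ur _ _ _ _ _ _ _ _) hb
  simp only [Finset.range_zero, Finset.sum_empty, add_zero] at this
  refine this.mono ?_
  rw [pow_add, mul_assoc]
  refine Nat.mul_le_mul_left _ ?_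
  have : 1 ≤ 2 ^ W := Nat.one_le_two_pow
  nlinarith [Nat.zero_le s.length, Nat.zero_le ρ, Nat.zero_le e]

/-- Count the hits, then shorten the programs and the ruler by one. -/
noncomputable def sweep (hU : U.IsReversible) : Frag (Ix U) :=
  .seq (hitAll hU) (.seq (Frag.push (.ur 1)).inv (Frag.push .ruler).inv)

theorem run_sweep (hU : U.IsReversible) (T : Tapes U) (s r w : List Bool) (e ρ W c : ℕ) :
    (sweep hU).Run (2 ^ (e + 1 + W) * (400 * (e + W + s.length + ρ + 3)))
      (setup T s r w (List.replicate (e + 1) false) (ρ + 1) W c).get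
      (setup T s r w (List.replicate e false) ρ W (c + hitCount U s w (e + 1) (ρ + 1) W)).get := by
  have h1 := run_hitAll hU T s r w (e + 1) (ρ + 1) W c
  generalize c + hitCount U s w (e + 1) (ρ + 1) W = c' at h1 ⊢
  -- After a full cycle the program tape holds zeros again, so an inverse push can shorten it.
  have h2 := (Frag.run_push (B := .ur 1) (l := List.replicate e false)
    (α := (setup T s r w (List.replicate e false) (ρ + 1) W c').get)
    (setup_get_ur _ _ _ _ _ _ _ _)).inv
  rw [update_setup_ur, ← List.replicate_succ'] at h2
  have h3 := (Frag.run_push (B := .ruler) (l := List.replicate ρ false)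
    (α := (setup T s r w (List.replicate e false) ρ W c').get) rfl).inv
  rw [Tapes.update_ruler, ← List.replicate_succ'] at h3
  refine (Frag.run_seq h1 (Frag.run_seq h2 h3)).mono ?_
  simp only [List.length_replicate]
  have : 1 ≤ 2 ^ (e + 1 + W) := Nat.one_le_two_pow
  nlinarith [Nat.zero_le s.length, Nat.zero_le ρ, Nat.zero_le e, Nat.zero_le W]

/-- The number of hits by programs of length `e + 1, …, e + g`. -/
noncomputable def blockCount (U : QuadMachine) (s w : List Bool) (e ρ g W : ℕ) : ℕ :=
  ∑ i ∈ Finset.range g, hitCount U s w (e + (g - i)) (ρ + (g - i)) W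

/-- `E` bounds the exponent of programs times steps, and `B` collects all polynomial quantities. -/
theorem run_each_sweep (hU : U.IsReversible) {T : Tapes U} {lg : List Bool}
    (hT : T.block = word lg 0) (s r w : List Bool) (e ρ W c E B : ℕ)
    (hE : e + lg.length + W ≤ E) (hB : e + W + s.length + ρ + 2 * lg.length + 2 ≤ B) :
    (Frag.each .block (sweep hU)).Run (2 ^ E * (410 * B ^ 2))
      (setup T s r w (List.replicate (e + lg.length) false) (ρ + lg.length) W c).get
      (setup T s r w (List.replicate e false) ρ W
        (c + blockCount U s w e ρ lg.length W)).get := by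
  set g := lg.length with hg
  have := Frag.run_each (A := Ix.block) (body := sweep hU) (T := 2 ^ E * (400 * B)) (l := lg)
    (fun i => (setup T s r w (List.replicate (e + (g - i)) false) (ρ + (g - i)) W
      (c + ∑ j ∈ Finset.range i, hitCount U s w (e + (g - j)) (ρ + (g - j)) W)).get)
    (fun i => hT) (fun i hi => by
      obtain ⟨d, hd⟩ : ∃ d, g - i = d + 1 := ⟨g - i - 1, by omega⟩
      have hd' : g - (i + 1) = d := by omega
      rw [Finset.sum_range_succ, hd, hd', ← add_assoc, ← add_assoc, ← add_assoc,
        Tapes.update_block, Tapes.update_block]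
      refine (run_sweep hU { T with block := word lg (i + 1) } s r w (e + d) (ρ + d) W _).mono ?_
      exact Nat.mul_le_mul (Nat.pow_le_pow_right (by norm_num) (by omega))
        (Nat.mul_le_mul_left _ (by omega)))
  simp only [← hg, Nat.sub_zero, Nat.sub_self, Finset.range_zero, Finset.sum_empty,
    add_zero] at this
  refine this.mono ?_
  have h1 : 1 ≤ 2 ^ E := Nat.one_le_two_pow
  have h2 : g + 1 ≤ B := by omega
  calc (g + 1) * (2 ^ E * (400 * B) + 10) ≤ B * (2 ^ E * (400 * B) + 2 ^ E * (10 * B)) :=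
        Nat.mul_le_mul h2 (Nat.add_le_add_left (by nlinarith) _)
    _ = _ := by ring

/-- The number of hits found by `check`. -/
noncomputable def levelCount (U : QuadMachine) (s w : List Bool) (e g n k : ℕ) : ℕ :=
  ∑ j ∈ Finset.range k,
    blockCount U s w (e + (k - (j + 1)) * g) ((k - (j + 1)) * g) g (n * (j + 1))

/-- Count all hits of the candidate. -/
noncomputable def check (hU : U.IsReversible) : Frag (Ix U) :=
  .each .level (.seq (.each .x (.push .clock)) (.each .block (sweep hU)))

/-- Programs are treated from the longest down. Each level first adds `n = |s| + |r|` to the length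
of the clock and then handles `g` lengths, which reproduces the schedule in `Hard`. The `j`-th
instance of `hE` is the exponent of that level. -/
theorem run_check (hU : U.IsReversible) {T : Tapes U} {lg lk : List Bool}
    (hg : T.block = word lg 0) (hk : T.level = word lk 0) (s r w : List Bool) (e c E B : ℕ)
    (hE : ∀ j < lk.length, e + (lk.length - j) * lg.length +
      (s.length + r.length) * (j + 1) ≤ E)
    (hB : e + 2 * (lk.length * lg.length) + (s.length + r.length) * (lk.length + 1) + s.length +
      lk.length + 2 ≤ B) :
    (check hU).Run (2 ^ E * (480 * B ^ 3))
      (setup T s r w (List.replicate (e + lk.length * lg.length) false)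
        (lk.length * lg.length) 0 c).get
      (setup T s r w (List.replicate e false) 0 ((s.length + r.length) * lk.length)
        (c + levelCount U s w e lg.length (s.length + r.length) lk.length)).get := by
  set g := lg.length with hg'
  set k := lk.length with hk'
  set n := s.length + r.length with hn
  have h1 : 1 ≤ 2 ^ E := Nat.one_le_two_pow
  have := Frag.run_each (A := Ix.level)
    (body := .seq (.each .x (.push .clock)) (.each .block (sweep hU)))
    (T := 2 ^ E * (470 * B ^ 2)) (l := lk)
    (fun i => (setup T s r w (List.replicate (e + (k - i) * g) false) ((k - i) * g) (n * i)
      (c + ∑ j ∈ Finset.range i,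
        blockCount U s w (e + (k - (j + 1)) * g) ((k - (j + 1)) * g) g (n * (j + 1)))).get)
    (fun i => hk) (fun i hi => by
      obtain ⟨d, hd⟩ : ∃ d, k - i = d + 1 := ⟨k - i - 1, by omega⟩
      have hd' : k - (i + 1) = d := by omega
      have hdg : d * g + g ≤ k * g := by
        calc d * g + g = (d + 1) * g := by ring
          _ ≤ k * g := Nat.mul_le_mul_right _ (by omega)
      have hni : n * (i + 1) ≤ n * (k + 1) := Nat.mul_le_mul_left _ (by omega)
      rw [Finset.sum_range_succ, hd, hd', ← add_assoc c, Tapes.update_level, Tapes.update_level]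
      have a1 := Frag.run_each_push (A := Ix.x) (B := Ix.clock) (by simp) (l := s ++ r)
        (u := List.replicate (n * i) false)
        (α := (setup { T with level := word lk (i + 1) } s r w
          (List.replicate (e + (d + 1) * g) false) ((d + 1) * g) (n * i)
          (c + ∑ j ∈ Finset.range i, blockCount U s w (e + (k - (j + 1)) * g)
            ((k - (j + 1)) * g) g (n * (j + 1)))).get) rfl rfl
      rw [List.length_append, ← hn, List.replicate_append_replicate, ← Nat.mul_succ,
        Tapes.update_clock, List.length_replicate] at a1
      have hEi := hE i hi
      rw [hd] at hEi
      have a2 := run_each_sweep hU (T := { T with level := word lk (i + 1) }) hg s r w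
        (e + d * g) (d * g) (n * (i + 1)) (c + ∑ j ∈ Finset.range i,
          blockCount U s w (e + (k - (j + 1)) * g) ((k - (j + 1)) * g) g (n * (j + 1))) E B
          (by rw [← hg']; linarith) (by rw [← hg']; omega)
      rw [← hg', show e + d * g + g = e + (d + 1) * g by ring,
        show d * g + g = (d + 1) * g by ring] at a2
      refine (Frag.run_seq a1 a2).mono ?_
      have b1 : (n + 1) * (8 * (n + n * i) + 42) ≤ B * (50 * B) := by
        have : n ≤ n * (k + 1) := Nat.le_mul_of_pos_right _ (by omega)
        refine Nat.mul_le_mul (by omega) ?_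
        have : n + n * i = n * (i + 1) := by ring
        omega
      have b2 : 1 ≤ B ^ 2 := Nat.one_le_pow _ _ (by omega)
      have b3 : B ^ 2 ≤ 2 ^ E * B ^ 2 := Nat.le_mul_of_pos_left _ h1
      linarith)
  simp only [← hk', Nat.sub_zero, Nat.sub_self, Finset.range_zero, Finset.sum_empty,
    add_zero, zero_mul, mul_zero] at this
  refine this.mono ?_
  have h2 : k + 1 ≤ B := by omega
  have b2 : 1 ≤ B ^ 2 := Nat.one_le_pow _ _ (by omega)
  calc (k + 1) * (2 ^ E * (470 * B ^ 2) + 10)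
      ≤ B * (2 ^ E * (470 * B ^ 2) + 2 ^ E * (10 * B ^ 2)) :=
        Nat.mul_le_mul h2 (Nat.add_le_add_left (by nlinarith) _)
    _ = _ := by ring

/-! ### Judging candidates and finding the first one without hits -/

/-- Decide on `bad` whether the candidate is hit. -/
noncomputable def judge (hU : U.IsReversible) : Frag (Ix U) :=
  .conj (check hU) (.cond (Frag.sees .hits (some true)) .skip
    (Frag.permC .bad (Equiv.swap none (some true))) (Frag.sees .hits (some true)))

open scoped Classical in
-- One flag is all that survives the uncomputation of the count; `nextCand` can clear it because its
-- value is then known.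
theorem run_judge (hU : U.IsReversible) {T : Tapes U} {lg lk : List Bool}
    (hg : T.block = word lg 0) (hk : T.level = word lk 0) (s r w : List Bool) (e E B : ℕ)
    (hE : ∀ j < lk.length, e + (lk.length - j) * lg.length +
      (s.length + r.length) * (j + 1) ≤ E)
    (hB : e + 2 * (lk.length * lg.length) + (s.length + r.length) * (lk.length + 1) + s.length +
      lk.length + 2 ≤ B) :
    (judge hU).Run (2 ^ E * (970 * B ^ 3))
      (setup { T with bad := word [] 1 } s r w
        (List.replicate (e + lk.length * lg.length) false) (lk.length * lg.length) 0 0).get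
      (setup { T with bad := (if levelCount U s w e lg.length (s.length + r.length) lk.length = 0 then
          word [] 1 else word [true] 1) } s r w
        (List.replicate (e + lk.length * lg.length) false) (lk.length * lg.length) 0 0).get := by
  have h1 := run_check hU (T := { T with bad := word [] 1 }) hg hk s r w e 0 E B hE hB
  have h3 := run_check hU (T := { T with
    bad := (if levelCount U s w e lg.length (s.length + r.length) lk.length = 0 then
          word [] 1 else word [true] 1) }) hg hk s r w e 0 E B hE hB
  refine (Frag.run_conj (T' := 3) h1 ?_ h3).mono ?_
  · generalize levelCount U s w e lg.length (s.length + r.length) lk.length = c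
    split_ifs with h
    · subst h
      refine Frag.run_cond_pos ?_ (Frag.run_skip _) ?_ <;>
      · rw [Frag.heads_mem_sees]
        exact head_word_succ _ _
    · have hc : ∀ t, heads (setup { T with bad := t } s r w (List.replicate e false) 0
          ((s.length + r.length) * lk.length) (0 + c)).get ∉ Frag.sees .hits (some true) := by
        intro t
        rw [Frag.heads_mem_sees]
        change (word [true] (0 + c + 1)).head ≠ _
        rw [head_word_succ, List.getElem?_eq_none (by simp; omega)]
        simp
      refine Frag.run_cond_neg (hc _) ?_ (hc _)
      have := Frag.run_permC .bad (Equiv.swap none (some true))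
        (setup { T with bad := word [] 1 } s r w (List.replicate e false) 0
          ((s.length + r.length) * lk.length) (0 + c)).get
      have e1 : (setup { T with bad := word [] 1 } s r w (List.replicate e false) 0
          ((s.length + r.length) * lk.length) (0 + c)).get .bad = word [] 1 := rfl
      rw [e1, head_word_succ, List.getElem?_nil, Equiv.swap_apply_left, word_nil_write_true,
        Tapes.update_bad] at this
      exact this
  · have b1 : 1 ≤ 2 ^ E := Nat.one_le_two_pow
    have b2 : 1 ≤ B ^ 3 := Nat.one_le_pow _ _ (by omega)
    have b3 : 1 ≤ 2 ^ E * B ^ 3 := Nat.mul_pos b1 b2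
    linarith

/-- Go to the next candidate. -/
noncomputable def nextCand : Frag (Ix U) :=
  .seq (.permC .bad (Equiv.swap none (some true))) (.seq (.mv .iter .right) (.inc .cand))

theorem run_nextCand (T : Tapes U) (s r w q : List Bool) (ρ W c i : ℕ) :
    (nextCand (U := U)).Run (15 * (w.length + 2))
      (setup { T with bad := word [true] 1, iter := word [true] i } s r w q ρ W c).get
      (setup { T with bad := word [] 1, iter := word [true] (i + 1) } s r (incr w) q ρ W c).get := by
  have h1 := Frag.run_permC .bad (Equiv.swap none (some true))
    (setup { T with bad := word [true] 1, iter := word [true] i } s r w q ρ W c).get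
  have e1 : (setup { T with bad := word [true] 1, iter := word [true] i } s r w q ρ W c).get .bad =
    word [true] 1 := rfl
  rw [e1, head_word_succ, List.getElem?_cons_zero, Equiv.swap_apply_right, word_true_write_none,
    Tapes.update_bad] at h1
  have h2 := Frag.run_mv .iter .right
    (setup { T with bad := word [] 1, iter := word [true] i } s r w q ρ W c).get
  have e2 : ((setup { T with bad := word [] 1, iter := word [true] i } s r w q ρ W c).get
      .iter).move .right = word [true] (i + 1) := word_move_right _ _
  rw [e2, Tapes.update_iter] at h2
  have h3 := Frag.run_inc .cand w
    (setup { T with bad := word [] 1, iter := word [true] (i + 1) } s r w q ρ W c).get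
  rw [Tapes.update_cand, Tapes.update_cand] at h3
  exact (Frag.run_seq h1 (Frag.run_seq h2 h3)).mono (by omega)

/-- Find the first candidate that is not hit. -/
noncomputable def search (hU : U.IsReversible) : Frag (Ix U) :=
  .loop (Frag.sees .iter (some true)) (judge hU) (Frag.sees .bad none) nextCand

/-- The tape `iter` serves reversibility only: its head is on the mark exactly at the entry of the
loop. The number of rounds left there disappears when the whole search is undone. -/
theorem run_search (hU : U.IsReversible) {T : Tapes U} {lg lk : List Bool}
    (hg : T.block = word lg 0) (hk : T.level = word lk 0) (s r : List Bool) (e E B N : ℕ)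
    (hE : ∀ j < lk.length, e + (lk.length - j) * lg.length +
      (s.length + r.length) * (j + 1) ≤ E)
    (hB : e + 2 * (lk.length * lg.length) + (s.length + r.length) * (lk.length + 1) + s.length +
      lk.length + 2 ≤ B)
    (hN : ∀ i < N, levelCount U s (bits (lk.length * lg.length) i) e lg.length
      (s.length + r.length) lk.length ≠ 0)
    (hN' : levelCount U s (bits (lk.length * lg.length) N) e lg.length
      (s.length + r.length) lk.length = 0) :
    (search hU).Run ((N + 1) * (2 ^ E * (1000 * B ^ 3)))
      (setup { T with bad := word [] 1, iter := word [true] 1 } s r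
        (List.replicate (lk.length * lg.length) false)
        (List.replicate (e + lk.length * lg.length) false) (lk.length * lg.length) 0 0).get
      (setup { T with bad := word [] 1, iter := word [true] (N + 1) } s r
        (bits (lk.length * lg.length) N)
        (List.replicate (e + lk.length * lg.length) false) (lk.length * lg.length) 0 0).get := by
  set d := lk.length * lg.length with hd
  have := Frag.run_loop (A := Frag.sees .iter (some true)) (B := Frag.sees .bad none)
    (P := judge hU) (Q := nextCand) (T := 2 ^ E * (970 * B ^ 3)) (T' := 15 * (d + 2)) N
    (fun i => (setup { T with bad := word [] 1, iter := word [true] (i + 1) } s r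
      (bits d i) (List.replicate (e + d) false) d 0 0).get)
    (fun i => (setup { T with
      bad := if i = N then word [] 1 else word [true] 1
      iter := word [true] (i + 1) } s r
      (bits d i) (List.replicate (e + d) false) d 0 0).get)
    rfl
    (fun i hi => by
      have h := run_judge hU (T := { T with iter := word [true] (i + 1) }) hg hk s r (bits d i)
        e E B hE hB
      have hi' : levelCount U s (bits d i) e lg.length (s.length + r.length) lk.length = 0 ↔
          i = N := by
        rcases hi.lt_or_eq with h | rfl
        · simp [hN i h, h.ne]
        · simp [hN']
      simp only [hi'] at h
      exact h)
    (fun i hi => by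
      rw [Frag.heads_mem_sees, if_neg hi.ne]
      change (word [true] 1).head ≠ none
      simp)
    (fun i hi => by
      rw [if_neg hi.ne, ← incr_bits]
      have := run_nextCand T s r (bits d i) (List.replicate (e + d) false) d 0 0 (i + 1)
      rwa [length_bits] at this)
    (fun i hi => by
      rw [Frag.heads_mem_sees]
      change (word [true] (i + 1 + 1)).head ≠ _
      simp)
    (by
      rw [Frag.heads_mem_sees, if_pos rfl]
      change (word [] 1).head = none
      simp)
  simp only [if_true, bits_zero] at this
  refine this.mono (Nat.mul_le_mul_left _ ?_)
  have b1 : 1 ≤ 2 ^ E := Nat.one_le_two_pow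
  have b2 : d + 2 ≤ B := by omega
  have b3 : 1 * B ≤ B ^ 2 * B := Nat.mul_le_mul_right _ (Nat.one_le_pow _ _ (by omega))
  have b4 : 1 * B ^ 3 ≤ 2 ^ E * B ^ 3 := Nat.mul_le_mul_right _ b1
  have b5 : B ^ 2 * B = B ^ 3 := by ring
  have b6 : 15 * (d + 2) ≤ 15 * B := Nat.mul_le_mul_left _ b2
  linarith

end search

/-! ### The erasing program -/

section program

variable {U : QuadMachine}

/-- The tapes outside the search: those not listed are blank. -/
def stage (U : QuadMachine) (x p level unit block ruler cand drop : Tape (Option Bool)) :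
    Tapes U where
  ur _ := word [] 0
  st _ := word [] 0
  x := x
  p := p
  level := level
  unit := unit
  block := block
  ruler := ruler
  cand := cand
  drop := drop
  kept := word [] 0
  clock := word [] 0
  mism := word [] 0
  hits := word [] 0
  iter := word [] 0
  bad := word [] 0
  stuck := word [] 0

theorem run_each_push_le {A B : Ix U} (hAB : A ≠ B) (l u : List Bool)
    (α : Ix U → Tape (Option Bool)) (hA : α A = word l 0) (hB : α B = word u 0) {b : ℕ}
    (hb : l.length + u.length + 1 ≤ b) :
    (Frag.each A (.push B)).Run (50 * b ^ 2) α
      (Function.update α B (word (u ++ List.replicate l.length false) 0)) := by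
  refine (Frag.run_each_push hAB hA hB).mono ?_
  calc (l.length + 1) * (8 * (l.length + u.length) + 42) ≤ b * (50 * b) :=
        Nat.mul_le_mul (by omega) (by omega)
    _ = _ := by ring

/-! #### Reading the record -/

/-- Copy the ones after the head of `p` to `A`. -/
noncomputable def copyOnes (A : Ix U) : Frag (Ix U) :=
  .seq (.loop (Frag.sees .p (some true))ᶜ (.seq (.mv .p .right) (.mv A .right))
    (Frag.sees .p (some false)) (.permC A (Equiv.swap none (some true)))) (.back A)

theorem getElem?_replicate_append (u t : List Bool) {k i : ℕ} (hi : i ≤ k) :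
    (u ++ (List.replicate k true ++ false :: t))[u.length + i]? = some (decide (i < k)) := by
  rw [List.getElem?_append_right (by omega), Nat.add_sub_cancel_left]
  rcases hi.lt_or_eq with h | rfl
  · rw [List.getElem?_append_left (by simpa using h)]; simp [h]
  · rw [List.getElem?_append_right (by simp)]; simp

/-- Seeing a one on `p` means being inside a block, so `hu`, a start on the left blank or on a
delimiter, is the entry assertion, and the zero after the block stops the loop. -/
theorem run_copyOnes {A : Ix U}
    (f : Tape (Option Bool) → Tape (Option Bool) → Ix U → Tape (Option Bool))
    (hp : ∀ p a t, Function.update (f p a) .p t = f t a)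
    (hA : ∀ p a t, Function.update (f p a) A t = f p t)
    (u t : List Bool) (k : ℕ)
    (hu : (word (u ++ (List.replicate k true ++ false :: t)) u.length).head ≠ some true) :
    (copyOnes A).Run (12 * k + 15)
      (f (word (u ++ (List.replicate k true ++ false :: t)) u.length) (word [] 0))
      (f (word (u ++ (List.replicate k true ++ false :: t)) (u.length + k + 1))
        (word (List.replicate k true) 0)) := by
  have gp : ∀ p a, f p a .p = p := fun p a => by rw [← hp p a p, Function.update_self]
  have gA : ∀ p a, f p a A = a := fun p a => by rw [← hA p a a, Function.update_self]
  set L := u ++ (List.replicate k true ++ false :: t) with hL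
  have h1 := Frag.run_loop (A := (Frag.sees Ix.p (some true))ᶜ) (B := Frag.sees .p (some false))
    (P := .seq (.mv .p .right) (.mv A .right)) (Q := .permC A (Equiv.swap none (some true)))
    (T := 5) (T' := 1) k
    (fun i => f (word L (u.length + i)) (word (List.replicate i true) i))
    (fun i => f (word L (u.length + i + 1)) (word (List.replicate i true) (i + 1)))
    (by rw [Set.mem_compl_iff, Frag.heads_mem_sees, gp]; exact hu)
    (fun i _ => by
      have a1 := Frag.run_mv .p .right (f (word L (u.length + i)) (word (List.replicate i true) i))
      have a2 := Frag.run_mv A .right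
        (f (word L (u.length + i + 1)) (word (List.replicate i true) i))
      rw [hp, gp, word_move_right] at a1
      rw [hA, gA, word_move_right] at a2
      exact Frag.run_seq a1 a2)
    (fun i hi => by
      rw [Frag.heads_mem_sees, gp, head_word_succ, getElem?_replicate_append _ _ hi.le]
      simp [hi])
    (fun i hi => by
      have a1 := Frag.run_permC A (Equiv.swap none (some true))
        (f (word L (u.length + i + 1)) (word (List.replicate i true) (i + 1)))
      rw [hA, gA, head_word_succ, List.getElem?_eq_none (by simp), Equiv.swap_apply_left] at a1
      have a2 := word_write_append (List.replicate i true) true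
      rw [List.length_replicate, ← List.replicate_succ'] at a2
      rw [a2] at a1
      exact a1)
    (fun i hi => by
      rw [Set.mem_compl_iff, not_not, Frag.heads_mem_sees, gp]
      change (word L (u.length + i + 1)).head = _
      rw [head_word_succ, getElem?_replicate_append _ _ hi.le]
      simp [hi])
    (by
      rw [Frag.heads_mem_sees, gp, head_word_succ, getElem?_replicate_append _ _ le_rfl]
      simp)
  have h2 := Frag.run_back A (List.replicate k true)
    (f (word L (u.length + k + 1)) (word (List.replicate k true) (k + 1)))
  rw [hA, hA] at h2
  simp only [List.length_replicate] at h2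
  exact (Frag.run_seq h1 h2).mono (by omega)

/-- Move the head of `p` to the next zero. -/
noncomputable def toDelim (U : QuadMachine) : Frag (Ix U) :=
  .loop (Frag.sees .p (some true))ᶜ (.mv .p .right) (Frag.sees .p (some false)) .skip

theorem run_toDelim (f : Tape (Option Bool) → Ix U → Tape (Option Bool))
    (hp : ∀ p t, Function.update (f p) .p t = f t) (u t : List Bool) (k : ℕ)
    (hu : (word (u ++ (List.replicate k true ++ false :: t)) u.length).head ≠ some true) :
    (toDelim U).Run (4 * k + 4)
      (f (word (u ++ (List.replicate k true ++ false :: t)) u.length))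
      (f (word (u ++ (List.replicate k true ++ false :: t)) (u.length + k + 1))) := by
  have gp : ∀ p, f p .p = p := fun p => by rw [← hp p p, Function.update_self]
  set L := u ++ (List.replicate k true ++ false :: t) with hL
  refine (Frag.run_loop (T := 1) (T' := 1) k
    (fun i => f (word L (u.length + i)))
    (fun i => f (word L (u.length + i + 1)))
    (by rw [Set.mem_compl_iff, Frag.heads_mem_sees, gp]; exact hu)
    (fun i _ => by
      have a1 := Frag.run_mv .p .right (f (word L (u.length + i)))
      rwa [hp, gp, word_move_right] at a1)
    (fun i hi => by
      rw [Frag.heads_mem_sees, gp, head_word_succ, getElem?_replicate_append _ _ hi.le]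
      simp [hi])
    (fun i hi => Frag.run_skip _)
    (fun i hi => by
      rw [Set.mem_compl_iff, not_not, Frag.heads_mem_sees, gp]
      change (word L (u.length + i + 1)).head = _
      rw [head_word_succ, getElem?_replicate_append _ _ hi.le]
      simp [hi])
    (by
      rw [Frag.heads_mem_sees, gp, head_word_succ, getElem?_replicate_append _ _ le_rfl]
      simp)).mono (by omega)

/-- The parameters `κ` and `γ` in unary, with delimiters. -/
def code (κ γ : ℕ) : List Bool :=
  List.replicate κ true ++ false :: (List.replicate γ true ++ [false])

theorem length_code (κ γ : ℕ) : (code κ γ).length = κ + γ + 2 := by simp [code]; omega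

theorem code_append (κ γ : ℕ) (t : List Bool) : code κ γ ++ t =
    [] ++ (List.replicate κ true ++ false :: (List.replicate γ true ++ false :: t)) := by
  simp [code]

theorem code_append' (κ γ : ℕ) (t : List Bool) : code κ γ ++ t =
    (List.replicate κ true ++ [false]) ++ (List.replicate γ true ++ false :: t) := by
  simp [code]

theorem head_code_first (κ γ : ℕ) (t : List Bool) :
    (word ([] ++ (List.replicate κ true ++ false :: (List.replicate γ true ++ false :: t)))
      ([] : List Bool).length).head ≠ some true := by
  rw [List.length_nil, head_word_zero]; simp

theorem head_code_second (κ γ : ℕ) (t : List Bool) :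
    (word ((List.replicate κ true ++ [false]) ++ (List.replicate γ true ++ false :: t))
      (List.replicate κ true ++ [false]).length).head ≠ some true := by
  rw [List.length_append, List.length_singleton, head_word_succ,
    List.getElem?_append_left (by simp), List.getElem?_append_right le_rfl]
  simp

/-- Read the parameters from `p`. -/
noncomputable def parse (U : QuadMachine) : Frag (Ix U) := .seq (copyOnes .level) (copyOnes .unit)

theorem run_parse (x : Tape (Option Bool)) (κ γ : ℕ) :
    (parse U).Run (12 * κ + 12 * γ + 33)
      (stage U x (word (code κ γ) 0) (word [] 0) (word [] 0) (word [] 0) (word [] 0) (word [] 0)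
        (word [] 0)).get
      (stage U x (word (code κ γ) (code κ γ).length) (word (List.replicate κ true) 0)
        (word (List.replicate γ true) 0) (word [] 0) (word [] 0) (word [] 0) (word [] 0)).get := by
  have h1 := run_copyOnes (A := Ix.level) (U := U) (fun p a => (stage U x p a (word [] 0) (word [] 0)
    (word [] 0) (word [] 0) (word [] 0)).get) (fun _ _ _ => Tapes.update_p _ _)
    (fun _ _ _ => Tapes.update_level _ _) _ _ κ (head_code_first κ γ [])
  have h2 := run_copyOnes (A := Ix.unit) (U := U) (fun p a => (stage U x p
    (word (List.replicate κ true) 0) a (word [] 0)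
    (word [] 0) (word [] 0) (word [] 0)).get) (fun _ _ _ => Tapes.update_p _ _)
    (fun _ _ _ => Tapes.update_unit _ _) _ _ γ (head_code_second κ γ [])
  rw [← code_append, List.append_nil] at h1
  rw [← code_append', List.append_nil] at h2
  simp only [List.length_append, List.length_replicate, List.length_singleton, List.length_nil,
    zero_add] at h1 h2
  rw [length_code, show κ + γ + 2 = κ + 1 + γ + 1 by ring]
  exact (Frag.run_seq h1 h2).mono (by omega)

/-- The length of a block for the parameter `γ`. -/
def blockLength (γ : ℕ) : ℕ := 12 * γ

/-- Compute the unary lengths that depend on the parameters only. -/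
noncomputable def prep (U : QuadMachine) : Frag (Ix U) :=
  .seq (parse U) (.seq (.rep (.each .unit (.push .block)) 12)
    (.seq (.each .level (.each .block (.push .ruler)))
      (.seq (.each .ruler (.push .cand)) (.seq (.each .ruler (.push .drop))
        (.each .block (.push .drop))))))

/-- The tapes after `prep`. -/
def prepared (U : QuadMachine) (x : Tape (Option Bool)) (κ γ : ℕ) : Tapes U :=
  stage U x (word (code κ γ) (code κ γ).length) (word (List.replicate κ true) 0)
    (word (List.replicate γ true) 0) (word (List.replicate (blockLength γ) false) 0)
    (word (List.replicate (κ * blockLength γ) false) 0)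
    (word (List.replicate (κ * blockLength γ) false) 0)
    (word (List.replicate ((κ + 1) * blockLength γ) false) 0)

theorem run_prep (x : Tape (Option Bool)) (κ γ b : ℕ)
    (hb : 2 * ((κ + 1) * blockLength γ) + κ + γ + 2 ≤ b) :
    (prep U).Run (2000 * b ^ 3)
      (stage U x (word (code κ γ) 0) (word [] 0) (word [] 0) (word [] 0) (word [] 0) (word [] 0)
        (word [] 0)).get
      (prepared U x κ γ).get := by
  set g := blockLength γ with hg
  have hg' : g = 12 * γ := hg
  have hκg : κ * g + g = (κ + 1) * g := by ring
  have h1 := run_parse (U := U) x κ γ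
  set p := word (code κ γ) (code κ γ).length
  set lev := word (List.replicate κ true) 0 with hlev
  set uni := word (List.replicate γ true) 0 with huni
  have h2 := Frag.run_rep (P := Frag.each (Ix.unit (U := U)) (.push .block)) (T := 50 * b ^ 2)
    (fun i => (stage U x p lev uni (word (List.replicate (i * γ) false) 0) (word [] 0) (word [] 0)
      (word [] 0)).get) 12 (fun i hi => by
        have := run_each_push_le (A := Ix.unit) (B := .block) (U := U) (by simp)
          (List.replicate γ true) (List.replicate (i * γ) false)
          (stage U x p lev uni (word (List.replicate (i * γ) false) 0) (word [] 0) (word [] 0)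
            (word [] 0)).get rfl rfl (b := b) (by
              have : i * γ ≤ 12 * γ := Nat.mul_le_mul_right _ hi.le
              simp only [List.length_replicate]; omega)
        rw [List.length_replicate, List.replicate_append_replicate, ← Nat.succ_mul,
          Tapes.update_block] at this
        exact this)
  rw [← hg', zero_mul] at h2
  set blk := word (List.replicate g false) 0 with hblk
  have h3 := Frag.run_each (A := Ix.level (U := U)) (body := .each .block (.push .ruler))
    (T := 50 * b ^ 2) (l := List.replicate κ true)
    (fun i => (stage U x p lev uni blk (word (List.replicate (i * g) false) 0) (word [] 0)
      (word [] 0)).get) (fun i => rfl) (fun i hi => by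
        rw [List.length_replicate] at hi
        have := run_each_push_le (A := Ix.block) (B := .ruler) (U := U) (by simp)
          (List.replicate g false) (List.replicate (i * g) false)
          (stage U x p (word (List.replicate κ true) (i + 1)) uni blk
            (word (List.replicate (i * g) false) 0) (word [] 0)
            (word [] 0)).get rfl rfl (b := b) (by
              have : i * g ≤ κ * g := Nat.mul_le_mul_right _ hi.le
              simp only [List.length_replicate]; omega)
        rw [List.length_replicate, List.replicate_append_replicate, ← Nat.succ_mul,
          Tapes.update_ruler] at this
        rw [Tapes.update_level, Tapes.update_level]
        exact this)
  rw [List.length_replicate, zero_mul] at h3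
  set rul := word (List.replicate (κ * g) false) 0 with hrul
  have h4 := run_each_push_le (A := Ix.ruler) (B := .cand) (U := U) (by simp)
    (List.replicate (κ * g) false) []
    (stage U x p lev uni blk rul (word [] 0) (word [] 0)).get rfl rfl (b := b) (by simp; omega)
  rw [List.length_replicate, List.nil_append, Tapes.update_cand] at h4
  have h5 := run_each_push_le (A := Ix.ruler) (B := .drop) (U := U) (by simp)
    (List.replicate (κ * g) false) []
    (stage U x p lev uni blk rul rul (word [] 0)).get rfl rfl (b := b) (by simp; omega)
  rw [List.length_replicate, List.nil_append, Tapes.update_drop] at h5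
  have h6 := run_each_push_le (A := Ix.block) (B := .drop) (U := U) (by simp)
    (List.replicate g false) (List.replicate (κ * g) false)
    (stage U x p lev uni blk rul rul rul).get rfl rfl (b := b) (by simp; omega)
  rw [List.length_replicate, List.replicate_append_replicate, hκg, Tapes.update_drop] at h6
  refine (Frag.run_seq h1 (Frag.run_seq h2 (Frag.run_seq h3 (Frag.run_seq h4
    (Frag.run_seq h5 h6))))).mono ?_
  have b1 : 1 ≤ b := by omega
  have b2 : b ≤ b ^ 3 := Nat.le_self_pow (by norm_num) b
  have b3 : b ^ 2 ≤ b ^ 3 := Nat.pow_le_pow_right b1 (by norm_num)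
  have b4 : (κ + 1) * (50 * b ^ 2 + 10) ≤ b * (50 * b ^ 2 + 10 * b ^ 2) :=
    Nat.mul_le_mul (by omega) (by nlinarith)
  have b5 : b * (50 * b ^ 2 + 10 * b ^ 2) = 60 * b ^ 3 := by ring
  omega

/-! #### Setting up the search -/

theorem run_mark (A : Ix U) (α : Ix U → Tape (Option Bool)) (hA : α A = word [] 0) :
    (Frag.permC A (Equiv.swap none (some true))).Run 1 α (Function.update α A (word [true] 1)) := by
  have := Frag.run_permC A (Equiv.swap none (some true)) α
  rwa [hA, word_nil 0 1, head_word_succ, List.getElem?_nil, Equiv.swap_apply_left,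
    word_nil_write_true] at this

/-- Write the marks of the search. -/
noncomputable def marks (U : QuadMachine) : Frag (Ix U) :=
  .seq (.permC .stuck (Equiv.swap none (some true)))
    (.seq (.permC .mism (Equiv.swap none (some true)))
      (.seq (.permC .hits (Equiv.swap none (some true)))
        (.seq (.permC .iter (Equiv.swap none (some true)))
          (.permC (.st U.halt) (Equiv.swap none (some true))))))

open scoped Classical in
theorem run_marks (T : Tapes U) (h1 : T.stuck = word [] 0) (h2 : T.mism = word [] 0)
    (h3 : T.hits = word [] 0) (h4 : T.iter = word [] 0) (h5 : T.st U.halt = word [] 0) :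
    (marks U).Run 17 T.get
      { T with
        stuck := word [true] 1
        mism := word [true] 1
        hits := word [true] 1
        iter := word [true] 1
        st := Function.update T.st U.halt (word [true] 1) }.get := by
  have a1 := run_mark .stuck T.get h1
  rw [Tapes.update_stuck] at a1
  have a2 := run_mark .mism { T with stuck := word [true] 1 }.get h2
  rw [Tapes.update_mism] at a2
  have a3 := run_mark .hits { T with stuck := word [true] 1, mism := word [true] 1 }.get h3
  rw [Tapes.update_hits] at a3
  have a4 := run_mark .iter
    { T with stuck := word [true] 1, mism := word [true] 1, hits := word [true] 1 }.get h4
  rw [Tapes.update_iter] at a4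
  have a5 := run_mark (.st U.halt)
    { T with
      stuck := word [true] 1
      mism := word [true] 1
      hits := word [true] 1
      iter := word [true] 1 }.get h5
  rw [Tapes.update_st] at a5
  exact Frag.run_seq a1 (Frag.run_seq a2 (Frag.run_seq a3 (Frag.run_seq a4 a5)))

/-- Prepare the tapes for the search. -/
noncomputable def launch (U : QuadMachine) : Frag (Ix U) :=
  .seq (.each .x (.push .kept)) (.seq (Frag.each .drop (.push .kept)).inv
    (.seq (.each .kept (.push (.ur 1))) (.seq (.each .ruler (.push (.ur 1)))
      (.seq (Frag.each .unit (.push (.ur 1))).inv (marks U)))))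

/-- Lengths are subtracted by inverse pushes: `|s| = n - (κ+1)g` for the kept part, and `|s| + κg -
γ = e + κg` for the longest program. The tape `y` is arbitrary since `setup` overwrites the field
`x`. -/
theorem run_launch (y : Tape (Option Bool)) (s r : List Bool) (κ γ e b : ℕ)
    (hs : s.length = e + γ) (hr : r.length = (κ + 1) * blockLength γ)
    (hb : 2 * (s.length + (κ + 1) * blockLength γ) + γ + 1 ≤ b) :
    (launch U).Run (300 * b ^ 2) (prepared U (word (s ++ r) 0) κ γ).get
      (setup { prepared U y κ γ with bad := word [] 1, iter := word [true] 1 } s r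
        (List.replicate (κ * blockLength γ) false)
        (List.replicate (e + κ * blockLength γ) false) (κ * blockLength γ) 0 0).get := by
  classical
  set g := blockLength γ with hg
  have hκ : κ * g ≤ (κ + 1) * g := Nat.mul_le_mul_right _ (by omega)
  set P := prepared U (word (s ++ r) 0) κ γ with hP
  have h1 := run_each_push_le (A := Ix.x) (B := .kept) (U := U) (by simp) (s ++ r) [] P.get rfl rfl
    (b := b) (by simp; omega)
  rw [List.nil_append, List.length_append, hr, Tapes.update_kept] at h1
  have h2 := (run_each_push_le (A := Ix.drop) (B := .kept) (U := U) (by simp)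
    (List.replicate ((κ + 1) * g) false) (List.replicate s.length false)
    { P with kept := word (List.replicate s.length false) 0 }.get rfl rfl
    (b := b) (by simp; omega)).inv
  rw [List.length_replicate, List.replicate_append_replicate, Tapes.update_kept] at h2
  have h3 := run_each_push_le (A := Ix.kept) (B := .ur 1) (U := U) (by simp)
    (List.replicate s.length false) []
    { P with kept := word (List.replicate s.length false) 0 }.get rfl rfl
    (b := b) (by simp; omega)
  rw [List.length_replicate, List.nil_append, Tapes.update_ur] at h3
  have h4 := run_each_push_le (A := Ix.ruler) (B := .ur 1) (U := U) (by simp)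
    (List.replicate (κ * g) false) (List.replicate s.length false)
    { P with
      kept := word (List.replicate s.length false) 0
      ur := Function.update P.ur 1 (word (List.replicate s.length false) 0) }.get rfl
      (by simp [Tapes.get])
    (b := b) (by simp; omega)
  rw [List.length_replicate, List.replicate_append_replicate, Tapes.update_ur] at h4
  simp only [Function.update_idem] at h4
  have h5 := (run_each_push_le (A := Ix.unit) (B := .ur 1) (U := U) (by simp)
    (List.replicate γ true) (List.replicate (e + κ * g) false)
    { P with
      kept := word (List.replicate s.length false) 0
      ur := Function.update P.ur 1 (word (List.replicate (e + κ * g) false) 0) }.get rfl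
      (by simp [Tapes.get])
    (b := b) (by simp; omega)).inv
  rw [List.length_replicate, List.replicate_append_replicate, Tapes.update_ur,
    show e + κ * g + γ = s.length + κ * g by omega] at h5
  simp only [Function.update_idem] at h5
  have h6 := run_marks { P with
      kept := word (List.replicate s.length false) 0
      ur := Function.update P.ur 1 (word (List.replicate (e + κ * g) false) 0) } rfl rfl rfl rfl rfl
  have e6 : ({ P with
      kept := word (List.replicate s.length false) 0
      ur := Function.update P.ur 1 (word (List.replicate (e + κ * g) false) 0)
      stuck := word [true] 1
      mism := word [true] 1
      hits := word [true] 1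
      iter := word [true] 1
      st := Function.update P.st U.halt (word [true] 1) } : Tapes U) =
      setup { prepared U y κ γ with bad := word [] 1, iter := word [true] 1 } s r
        (List.replicate (κ * g) false) (List.replicate (e + κ * g) false) (κ * g) 0 0 := by
    refine Tapes.ext ?_ ?_ rfl rfl rfl rfl rfl rfl rfl rfl
      rfl rfl rfl rfl rfl ?_ rfl
    · funext i
      by_cases hi : i = 1
      · subst hi; simp [setup, recordTape]
      · simp [setup, recordTape, hi, hP, prepared, stage]
    · funext a
      by_cases ha : a = U.halt
      · subst ha; simp [setup, markTape]
      · simp [setup, markTape, ha, hP, prepared, stage, word_nil 0 1]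
    · exact word_nil 0 1
  rw [← e6]
  refine (Frag.run_seq h1 (Frag.run_seq h2 (Frag.run_seq h3 (Frag.run_seq h4
    (Frag.run_seq h5 h6))))).mono ?_
  have : 1 ≤ b ^ 2 := Nat.one_le_pow _ _ (by omega)
  omega

/-! #### Erasing what has been found -/

/-- Flip the scanned bit of `x` if `cand` scans a one. -/
noncomputable def flipBy (U : QuadMachine) : Frag (Ix U) :=
  .perm .x (fun v => if v .cand = some true then Equiv.swap (some false) (some true) else 1)
    fun v b => by simp

theorem run_flipBy (α : Ix U → Tape (Option Bool)) :
    (flipBy U).Run 1 α (Function.update α .x ((α .x).write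
      ((if (α .cand).head = some true then Equiv.swap (some false) (some true) else 1 :
        Equiv.Perm (Option Bool)) (α .x).head))) := Frag.run_perm α

/-- Erase from `x` the word on `cand`. -/
noncomputable def cancel (U : QuadMachine) : Frag (Ix U) :=
  .conj (.forCells .kept (.mv .x .right))
    (.seq (.forCells .cand (.seq (.mv .x .right) (flipBy U)))
      (Frag.forCells .cand (.mv .x .right)).inv)

theorem run_skipCells {A : Ix U} (l L : List Bool) (k : ℕ)
    (f : Tape (Option Bool) → Tape (Option Bool) → Ix U → Tape (Option Bool))
    (hA : ∀ a x t, Function.update (f a x) A t = f t x)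
    (hx : ∀ a x t, Function.update (f a x) .x t = f a t) :
    (Frag.forCells A (.mv .x .right)).Run ((l.length + 1) * 4) (f (word l 0) (word L k))
      (f (word l (l.length + 1)) (word L (k + l.length))) := by
  have gx : ∀ a x, f a x .x = x := fun a x => by rw [← hx a x x, Function.update_self]
  have := Frag.run_forCells (A := A) (body := .mv .x .right) (T := 1) (l := l)
    (fun i => f (word l 0) (word L (k + i))) (fun i _ => by
      rw [hA, hA]
      have := Frag.run_mv .x .right (f (word l (i + 1)) (word L (k + i)))
      rwa [hx, gx, word_move_right] at this)
  rwa [hA, hA] at this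

/-- Adding a word to itself modulo 2 gives zeros. The bits of `w` are not lost as information, since
they still stand on `cand`. -/
theorem run_cancel (T : Tapes U) (s w z : List Bool)
    (hx : T.x = word (s ++ (w ++ z)) 0) (hk : T.kept = word (List.replicate s.length false) 0)
    (hw : T.cand = word w 0) :
    (cancel U).Run (20 * (s.length + w.length + 2)) T.get
      { T with x := word (s ++ (List.replicate w.length false ++ z)) 0 }.get := by
  set L := s ++ (w ++ z) with hL
  set L' := s ++ (List.replicate w.length false ++ z) with hL'
  have skip1 : ∀ (M : List Bool), (Frag.forCells .kept (.mv .x .right)).Run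
      ((s.length + 1) * 4) { T with x := word M 0 }.get
      { T with
        x := word M s.length
        kept := word (List.replicate s.length false) (s.length + 1) }.get := by
    intro M
    have := run_skipCells (A := .kept) (List.replicate s.length false) M 0
      (fun a x => { T with kept := a, x := x }.get) (fun _ _ _ => Tapes.update_kept _ _)
      (fun _ _ _ => Tapes.update_x _ _)
    simp only [← hk, List.length_replicate, zero_add] at this
    exact this
  have skip2 := run_skipCells (A := .cand) w L' s.length
      (fun a x => { T with
        x := x
        kept := word (List.replicate s.length false) (s.length + 1)
        cand := a }.get) (fun _ _ _ => Tapes.update_cand _ _)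
      (fun _ _ _ => Tapes.update_x _ _)
  have flip := Frag.run_forCells (A := Ix.cand) (body := .seq (.mv .x .right) (flipBy U)) (T := 5)
    (l := w) (fun i => { T with
        x := word (s ++ (List.replicate i false ++ (w.drop i ++ z))) (s.length + i)
        kept := word (List.replicate s.length false) (s.length + 1) }.get) (fun i hi => by
      rw [Tapes.update_cand, Tapes.update_cand]
      have a1 := Frag.run_mv .x .right { T with
        x := word (s ++ (List.replicate i false ++ (w.drop i ++ z))) (s.length + i)
        kept := word (List.replicate s.length false) (s.length + 1)
        cand := word w (i + 1) }.get
      have e1 : (Tapes.get { T with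
        x := word (s ++ (List.replicate i false ++ (w.drop i ++ z))) (s.length + i)
        kept := word (List.replicate s.length false) (s.length + 1)
        cand := word w (i + 1) } .x).move .right =
        word (s ++ (List.replicate i false ++ (w.drop i ++ z))) (s.length + i + 1) :=
        word_move_right _ _
      rw [e1, Tapes.update_x] at a1
      have a2 := run_flipBy (U := U)
        { T with
          x := word (s ++ (List.replicate i false ++ (w.drop i ++ z))) (s.length + i + 1)
          kept := word (List.replicate s.length false) (s.length + 1)
          cand := word w (i + 1) }.get
      have ew : w[i]? = some w[i] := List.getElem?_eq_getElem hi
      have ed : w.drop i = w[i] :: w.drop (i + 1) := List.drop_eq_getElem_cons hi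
      have eL : s ++ (List.replicate i false ++ (w.drop i ++ z)) =
          (s ++ List.replicate i false) ++ w[i] :: (w.drop (i + 1) ++ z) := by
        rw [ed, List.append_assoc, List.cons_append]
      have eL' : s ++ (List.replicate (i + 1) false ++ (w.drop (i + 1) ++ z)) =
          (s ++ List.replicate i false) ++ false :: (w.drop (i + 1) ++ z) := by
        rw [List.replicate_succ']; simp
      have el : s.length + i = (s ++ List.replicate i false).length := by simp
      have ec : (Tapes.get { T with
          x := word (s ++ (List.replicate i false ++ (w.drop i ++ z))) (s.length + i + 1)
          kept := word (List.replicate s.length false) (s.length + 1)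
          cand := word w (i + 1) } .cand).head = some w[i] :=
        (head_word_succ _ _).trans ew
      have ex : (Tapes.get { T with
          x := word (s ++ (List.replicate i false ++ (w.drop i ++ z))) (s.length + i + 1)
          kept := word (List.replicate s.length false) (s.length + 1)
          cand := word w (i + 1) } .x) = word ((s ++ List.replicate i false) ++
            w[i] :: (w.drop (i + 1) ++ z)) ((s ++ List.replicate i false).length + 1) := by
        rw [← eL, ← el]; rfl
      have eσ : (if some w[i] = some true then Equiv.swap (some false) (some true) else 1 :
          Equiv.Perm (Option Bool)) (some w[i]) = some false := by
        cases w[i] <;> simp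
      rw [ec, ex, head_word_succ, List.getElem?_append_right le_rfl, Nat.sub_self,
        List.getElem?_cons_zero, eσ, word_write_mid, ← eL', ← el, Tapes.update_x] at a2
      exact Frag.run_seq a1 a2)
  rw [Tapes.update_cand, Tapes.update_cand] at flip
  simp only [List.replicate_zero, List.drop_zero, List.nil_append, List.drop_length,
    add_zero] at flip
  simp only [← hw] at skip2 flip
  -- Positioning depends only on lengths, so it is undone on the changed word `L'`.
  have := Frag.run_conj (skip1 L) (Frag.run_seq flip skip2.inv) (skip1 L')
  rw [← hx] at this
  exact this.mono (by omega)

/-! #### Moving the kept part to the record -/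

/-- Append the word on `x` to the word on `p`. -/
noncomputable def copyToRecord (U : QuadMachine) : Frag (Ix U) :=
  .loop (Frag.sees .x none) (.seq (.seq (.mv .x .right) (.mv .p .right))
    (.perm .p (fun v => Equiv.swap none (v .x)) fun v b => by simp)) (Frag.sees .x none) .skip

/-- Append the rest of the word on `p` to the word on `x`. -/
noncomputable def copyFromRecord (U : QuadMachine) : Frag (Ix U) :=
  .loop (Frag.sees .x none) (.seq (.seq (.mv .x .right) (.mv .p .right))
    (.perm .x (fun v => Equiv.swap none (v .p)) fun v b => by simp)) (Frag.sees .x none) .skip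

/-- Swapping the blank with the symbol to be copied writes it reversibly. The case `i ≥ |s|` is
needed because the copying loop also executes its body on the blank after the word, where the swap
is trivial. -/
theorem word_take_write (u s : List Bool) (i : ℕ) :
    (word (u ++ s.take i) (u.length + i + 1)).write
      (Equiv.swap none s[i]? (word (u ++ s.take i) (u.length + i + 1)).head) =
      word (u ++ s.take (i + 1)) (u.length + i + 1) := by
  have hn : (word (u ++ s.take i) (u.length + i + 1)).head = none := by
    rw [head_word_succ, List.getElem?_eq_none (by simp)]
  rw [hn, Equiv.swap_apply_left]
  rcases lt_or_ge i s.length with h | h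
  · have := word_write_append (u ++ s.take i) s[i]
    rw [List.length_append, List.length_take_of_le h.le, List.append_assoc,
      ← List.take_succ_eq_append_getElem h] at this
    rwa [List.getElem?_eq_getElem h]
  · rw [List.getElem?_eq_none h, List.take_of_length_le h, List.take_of_length_le (by omega)]
    rw [List.take_of_length_le h] at hn
    exact write_eq_self hn

/-- The tapes outside the search whose computed tapes are blank. -/
def bare (U : QuadMachine) (x p : Tape (Option Bool)) : Tapes U :=
  stage U x p (word [] 0) (word [] 0) (word [] 0) (word [] 0) (word [] 0) (word [] 0)

theorem run_moveBoth (l u : List Bool) (i j : ℕ) :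
    (Frag.seq (.mv .x .right) (.mv .p .right)).Run 5 (bare U (word l i) (word u j)).get
      (bare U (word l (i + 1)) (word u (j + 1))).get := by
  have h1 := Frag.run_mv .x .right (bare U (word l i) (word u j)).get
  have h2 := Frag.run_mv .p .right (bare U (word l (i + 1)) (word u j)).get
  have e1 : ((bare U (word l i) (word u j)).get .x).move .right = word l (i + 1) :=
    word_move_right _ _
  have e2 : ((bare U (word l (i + 1)) (word u j)).get .p).move .right = word u (j + 1) :=
    word_move_right _ _
  rw [e1, Tapes.update_x] at h1
  rw [e2, Tapes.update_p] at h2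
  exact Frag.run_seq h1 h2

theorem run_copyToRecord (u s : List Bool) :
    (copyToRecord U).Run ((s.length + 1) * 12)
      (bare U (word s 0) (word u u.length)).get
      (bare U (word s (s.length + 1)) (word (u ++ s) (u.length + s.length + 1))).get := by
  have := Frag.run_loop (A := Frag.sees (Ix.x (U := U)) none) (B := Frag.sees .x none)
    (P := .seq (.seq (.mv .x .right) (.mv .p .right))
      (.perm .p (fun v => Equiv.swap none (v .x)) fun v b => by simp)) (Q := .skip)
    (T := 9) (T' := 1) s.length
    (fun i => (bare U (word s i) (word (u ++ s.take i) (u.length + i))).get)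
    (fun i => (bare U (word s (i + 1)) (word (u ++ s.take (i + 1)) (u.length + i + 1))).get)
    (head_word_zero s)
    (fun i _ => by
      have h := Frag.run_perm (A := Ix.p) (σ := fun v => Equiv.swap none (v .x))
        (hσ := fun v b => by simp)
        (bare U (word s (i + 1)) (word (u ++ s.take i) (u.length + i + 1))).get
      have e : ((bare U (word s (i + 1)) (word (u ++ s.take i) (u.length + i + 1))).get .p).write
          (Equiv.swap none (heads (bare U (word s (i + 1))
            (word (u ++ s.take i) (u.length + i + 1))).get .x)
            ((bare U (word s (i + 1)) (word (u ++ s.take i) (u.length + i + 1))).get .p).head) =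
          word (u ++ s.take (i + 1)) (u.length + i + 1) := by
        have := word_take_write u s i
        rw [← head_word_succ s i] at this
        exact this
      rw [e, Tapes.update_p] at h
      exact Frag.run_seq (run_moveBoth _ _ _ _) h)
    (fun i hi => by
      rw [Frag.heads_mem_sees]
      change (word s (i + 1)).head ≠ none
      simpa using hi)
    (fun i _ => Frag.run_skip _)
    (fun i hi => by
      rw [Frag.heads_mem_sees]
      change (word s (i + 1)).head ≠ none
      simpa using hi)
    (by
      rw [Frag.heads_mem_sees]
      change (word s (s.length + 1)).head = none
      simp)
  rw [List.take_zero, List.append_nil, add_zero, List.take_of_length_le (by omega)] at this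
  exact this

/-- It ends in the same tapes as `run_copyToRecord`; run backwards after it, it deletes the original
and leaves the copy. -/
theorem run_copyFromRecord (u s : List Bool) :
    (copyFromRecord U).Run ((s.length + 1) * 12)
      (bare U (word [] 0) (word (u ++ s) u.length)).get
      (bare U (word s (s.length + 1)) (word (u ++ s) (u.length + s.length + 1))).get := by
  have := Frag.run_loop (A := Frag.sees (Ix.x (U := U)) none) (B := Frag.sees .x none)
    (P := .seq (.seq (.mv .x .right) (.mv .p .right))
      (.perm .x (fun v => Equiv.swap none (v .p)) fun v b => by simp)) (Q := .skip)
    (T := 9) (T' := 1) s.length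
    (fun i => (bare U (word (s.take i) i) (word (u ++ s) (u.length + i))).get)
    (fun i => (bare U (word (s.take (i + 1)) (i + 1)) (word (u ++ s) (u.length + i + 1))).get)
    (head_word_zero _)
    (fun i _ => by
      have h := Frag.run_perm (A := Ix.x) (σ := fun v => Equiv.swap none (v .p))
        (hσ := fun v b => by simp)
        (bare U (word (s.take i) (i + 1)) (word (u ++ s) (u.length + i + 1))).get
      have e : ((bare U (word (s.take i) (i + 1)) (word (u ++ s) (u.length + i + 1))).get .x).write
          (Equiv.swap none (heads (bare U (word (s.take i) (i + 1))
            (word (u ++ s) (u.length + i + 1))).get .p)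
            ((bare U (word (s.take i) (i + 1)) (word (u ++ s) (u.length + i + 1))).get .x).head) =
          word (s.take (i + 1)) (i + 1) := by
        have := word_take_write [] s i
        simp only [List.nil_append, List.length_nil, zero_add] at this
        rw [show s[i]? = (word (u ++ s) (u.length + i + 1)).head by
          rw [head_word_succ, List.getElem?_append_right (by omega), Nat.add_sub_cancel_left]]
          at this
        exact this
      rw [e, Tapes.update_x] at h
      exact Frag.run_seq (run_moveBoth _ _ _ _) h)
    (fun i hi => by
      rw [Frag.heads_mem_sees]
      change (word (s.take (i + 1)) (i + 1)).head ≠ none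
      simpa using hi)
    (fun i _ => Frag.run_skip _)
    (fun i hi => by
      rw [Frag.heads_mem_sees]
      change (word (s.take (i + 1)) (i + 1)).head ≠ none
      simpa using hi)
    (by
      rw [Frag.heads_mem_sees]
      change (word (s.take (s.length + 1)) (s.length + 1)).head = none
      simp)
  rw [List.take_zero, add_zero, List.take_of_length_le (by omega)] at this
  exact this

/-- Move the word on `x` to the end of the record. -/
noncomputable def append (U : QuadMachine) : Frag (Ix U) :=
  .conj (.seq (toDelim U) (toDelim U)) (.seq (copyToRecord U) (copyFromRecord U).inv)

theorem run_toDelims (x : Tape (Option Bool)) (κ γ : ℕ) (t : List Bool) :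
    (Frag.seq (toDelim U) (toDelim U)).Run (4 * κ + 4 * γ + 11)
      (bare U x (word (code κ γ ++ t) 0)).get
      (bare U x (word (code κ γ ++ t) (code κ γ).length)).get := by
  have h1 := run_toDelim (U := U) (fun p => (bare U x p).get) (fun _ _ => Tapes.update_p _ _) _ _ κ
    (head_code_first κ γ t)
  have h2 := run_toDelim (U := U) (fun p => (bare U x p).get) (fun _ _ => Tapes.update_p _ _) _ _ γ
    (head_code_second κ γ t)
  rw [← code_append] at h1
  rw [← code_append'] at h2
  simp only [List.length_append, List.length_replicate, List.length_singleton, List.length_nil,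
    zero_add] at h1 h2
  rw [length_code, show κ + γ + 2 = κ + 1 + γ + 1 by ring]
  exact (Frag.run_seq h1 h2).mono (by omega)

/-- The code is self-delimiting, so its end is found in the same way before and after the word is
appended. -/
theorem run_append (κ γ : ℕ) (s : List Bool) :
    (append U).Run (8 * κ + 8 * γ + 24 * s.length + 60)
      (bare U (word s 0) (word (code κ γ) 0)).get
      (bare U (word [] 0) (word (code κ γ ++ s) 0)).get := by
  have h1 := run_toDelims (U := U) (word s 0) κ γ []
  rw [List.append_nil] at h1
  exact (Frag.run_conj h1 (Frag.run_seq (run_copyToRecord _ _) (run_copyFromRecord _ _).inv)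
    (run_toDelims (word [] 0) κ γ s)).mono (by omega)

/-! #### The whole program -/

/-- Keep the first part of `x`, erase the rest, and undo all computations. -/
noncomputable def shorten (hU : U.IsReversible) : Frag (Ix U) :=
  .conj (prep U) (.seq (.conj (.seq (launch U) (search hU)) (cancel U))
    (Frag.each .drop (.push .x)).inv)

/-- The result of the search clears the middle part of `x`; the search is then undone on the cleared
word, and the trailing zeros are removed last. -/
theorem run_shorten (hU : U.IsReversible) (s : List Bool) (κ γ e E B N : ℕ)
    (hs : s.length = e + γ)
    (hE : ∀ j < κ, e + (κ - j) * blockLength γ +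
      (s.length + (κ + 1) * blockLength γ) * (j + 1) ≤ E)
    (hB : 3 * ((s.length + (κ + 1) * blockLength γ) * (κ + 1)) + κ + γ + 2 ≤ B)
    (hN : ∀ i < N, levelCount U s (bits (κ * blockLength γ) i) e (blockLength γ)
      (s.length + (κ + 1) * blockLength γ) κ ≠ 0)
    (hN' : levelCount U s (bits (κ * blockLength γ) N) e (blockLength γ)
      (s.length + (κ + 1) * blockLength γ) κ = 0) :
    (shorten hU).Run ((N + 1) * 2 ^ E * (9000 * B ^ 3))
      (bare U (word (s ++ (bits (κ * blockLength γ) N ++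
        List.replicate (blockLength γ) false)) 0) (word (code κ γ) 0)).get
      (bare U (word s 0) (word (code κ γ) 0)).get := by
  set g := blockLength γ with hg
  set n := s.length + (κ + 1) * g with hn
  have hκ : κ * g + g = (κ + 1) * g := by ring
  have hnκ : n ≤ n * (κ + 1) := Nat.le_mul_of_pos_right _ (by omega)
  -- The search depends on the remainder `r` only through its length; this allows it to be undone
  -- after the cancellation.
  have key : ∀ (y : Tape (Option Bool)) (r : List Bool), r.length = (κ + 1) * g →
      (Frag.seq (launch U) (search hU)).Run (300 * B ^ 2 + (N + 1) * (2 ^ E * (1000 * B ^ 3)) + 3)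
        (prepared U (word (s ++ r) 0) κ γ).get
        (setup { prepared U y κ γ with bad := word [] 1, iter := word [true] (N + 1) } s r
          (bits (κ * g) N) (List.replicate (e + κ * g) false) (κ * g) 0 0).get := by
    intro y r hr
    have h1 := run_launch (U := U) y s r κ γ e B hs (by rw [hr]) (by rw [← hg, ← hn]; omega)
    have h2 := run_search hU (T := prepared U y κ γ) (lg := List.replicate g false)
      (lk := List.replicate κ true) rfl rfl s r e E B N
      (by simpa only [List.length_replicate, hr] using hE)
      (by simp only [List.length_replicate, hr, ← hn]; omega)
      (by simpa only [List.length_replicate, hr] using hN)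
      (by simpa only [List.length_replicate, hr] using hN')
    simp only [List.length_replicate] at h2
    exact Frag.run_seq h1 h2
  set w := bits (κ * g) N with hw
  have hwl : w.length = κ * g := length_bits _ _
  have h1 := run_prep (U := U) (word (s ++ (w ++ List.replicate g false)) 0) κ γ B
    (by rw [← hg]; omega)
  have h2 := key (word [] 0) (w ++ List.replicate g false) (by simp [hwl, hκ])
  have h3 := run_cancel (setup { prepared U (word [] 0) κ γ with
      bad := word [] 1
      iter := word [true] (N + 1) } s (w ++ List.replicate g false)
      w (List.replicate (e + κ * g) false) (κ * g) 0 0) s w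
      (List.replicate g false) rfl rfl rfl
  have h4 := key (word [] 0) (List.replicate w.length false ++ List.replicate g false)
    (by simp [hwl, hκ])
  have h5 := (run_each_push_le (A := Ix.drop) (B := .x) (U := U) (by simp)
    (List.replicate ((κ + 1) * g) false) s (prepared U (word s 0) κ γ).get rfl rfl (b := B) (by
      simp only [List.length_replicate]; omega)).inv
  rw [List.length_replicate, Tapes.update_x, ← hκ, ← List.replicate_append_replicate] at h5
  have h6 := run_prep (U := U) (word s 0) κ γ B (by rw [← hg]; omega)
  rw [hwl] at h3 h4
  refine (Frag.run_conj h1 (Frag.run_seq (Frag.run_conj h2 h3 h4) h5) h6).mono ?_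
  have c1 : 1 ≤ (N + 1) * 2 ^ E := Nat.mul_pos (by omega) (Nat.two_pow_pos E)
  have c2 : B ≤ B ^ 3 := Nat.le_self_pow (by norm_num) B
  have c3 : B ^ 2 ≤ B ^ 3 := Nat.pow_le_pow_right (by omega) (by norm_num)
  have c4 : B ^ 3 ≤ (N + 1) * 2 ^ E * B ^ 3 := Nat.le_mul_of_pos_left _ c1
  have c5 : (N + 1) * (2 ^ E * (1000 * B ^ 3)) = 1000 * ((N + 1) * 2 ^ E * B ^ 3) := by ring
  have c6 : (N + 1) * 2 ^ E * (9000 * B ^ 3) = 9000 * ((N + 1) * 2 ^ E * B ^ 3) := by ring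
  rw [c5, c6]
  omega

/-- The erasing program. -/
noncomputable def erase (hU : U.IsReversible) : Frag (Ix U) :=
  .conj (.seq (.mv .x .left) (.mv .p .left)) (.seq (shorten hU) (append U))

theorem run_erase (hU : U.IsReversible) (s : List Bool) (κ γ e E B N : ℕ)
    (hs : s.length = e + γ)
    (hE : ∀ j < κ, e + (κ - j) * blockLength γ +
      (s.length + (κ + 1) * blockLength γ) * (j + 1) ≤ E)
    (hB : 3 * ((s.length + (κ + 1) * blockLength γ) * (κ + 1)) + κ + γ + 2 ≤ B)
    (hN : ∀ i < N, levelCount U s (bits (κ * blockLength γ) i) e (blockLength γ)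
      (s.length + (κ + 1) * blockLength γ) κ ≠ 0)
    (hN' : levelCount U s (bits (κ * blockLength γ) N) e (blockLength γ)
      (s.length + (κ + 1) * blockLength γ) κ = 0) :
    (erase hU).Run ((N + 1) * 2 ^ E * (10000 * B ^ 3))
      (bare U (word (s ++ (bits (κ * blockLength γ) N ++
        List.replicate (blockLength γ) false)) 1) (word (code κ γ) 1)).get
      (bare U (word [] 1) (word (code κ γ ++ s) 1)).get := by
  have key : ∀ l u, (Frag.seq (.mv .x .left) (.mv .p .left)).Run 5
      (bare U (word l 1) (word u 1)).get (bare U (word l 0) (word u 0)).get := by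
    intro l u
    have h1 := Frag.run_mv .x .left (bare U (word l 1) (word u 1)).get
    have h2 := Frag.run_mv .p .left (bare U (word l 0) (word u 1)).get
    have e1 : ((bare U (word l 1) (word u 1)).get .x).move .left = word l 0 :=
      word_move_left _ _
    have e2 : ((bare U (word l 0) (word u 1)).get .p).move .left = word u 0 :=
      word_move_left _ _
    rw [e1, Tapes.update_x] at h1
    rw [e2, Tapes.update_p] at h2
    exact Frag.run_seq h1 h2
  refine (Frag.run_conj (key _ _) (Frag.run_seq (run_shorten hU s κ γ e E B N hs hE hB hN hN')
    (run_append κ γ s)) (key _ _)).mono ?_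
  have hnκ : s.length + (κ + 1) * blockLength γ ≤
    (s.length + (κ + 1) * blockLength γ) * (κ + 1) := Nat.le_mul_of_pos_right _ (by omega)
  have c1 : 1 ≤ (N + 1) * 2 ^ E := Nat.mul_pos (by omega) (Nat.two_pow_pos E)
  have c2 : B ≤ B ^ 3 := Nat.le_self_pow (by norm_num) B
  have c4 : B ^ 3 ≤ (N + 1) * 2 ^ E * B ^ 3 := Nat.le_mul_of_pos_left _ c1
  have c5 : (N + 1) * 2 ^ E * (9000 * B ^ 3) = 9000 * ((N + 1) * 2 ^ E * B ^ 3) := by ring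
  have c6 : (N + 1) * 2 ^ E * (10000 * B ^ 3) = 10000 * ((N + 1) * 2 ^ E * B ^ 3) := by ring
  rw [c5, c6]
  omega

end program

/-! ### From fragments to machines -/

theorem exists_equiv_fin_of_ne {ι : Type} [Finite ι] {a b : ι} (h : a ≠ b) :
    ∃ (w : ℕ) (e : Fin (w + 2) ≃ ι), e 0 = a ∧ e 1 = b := by
  classical
  obtain ⟨n, ⟨f⟩⟩ := Finite.exists_equiv_fin ι
  have hn : 2 ≤ n := by
    have h' : f a ≠ f b := fun hf => h (f.injective hf)
    have := (f a).isLt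
    have := (f b).isLt
    by_contra
    exact h' (Fin.ext (by omega))
  obtain ⟨w, rfl⟩ := Nat.exists_eq_add_of_le' hn
  set e := f.symm.trans (Equiv.swap (f.symm 0) a) with he
  have h0 : e 0 = a := by simp [he]
  have h1 : e 1 ≠ a := by
    rw [← h0]
    exact fun h => absurd (e.injective h) (by simp)
  refine ⟨w, e.trans (Equiv.swap (e 1) b), ?_, ?_⟩
  · rw [Equiv.trans_apply, h0, Equiv.swap_apply_of_ne_of_ne h1.symm h]
  · rw [Equiv.trans_apply, Equiv.swap_apply_left]

namespace Frag

variable {ι : Type} {w : ℕ}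

/-- The machine that executes a fragment; `e` enumerates the tapes. -/
def toMachine (F : Frag ι) (e : Fin (w + 2) ≃ ι) : QuadMachine where
  State := F.State
  finite_state := F.finite_state
  work := w
  start := F.entry
  halt := F.exit
  rules := {r | (r.1, fun i => r.2.1 (e.symm i), r.2.2) ∈ F.rules}

theorem toMachine_step {F : Frag ι} {e : Fin (w + 2) ≃ ι} {c d : (F.toMachine e).Config} :
    (F.toMachine e).Step c d ↔
      F.Step c.state (fun i => c.tape (e.symm i)) d.state (fun i => d.tape (e.symm i)) := by
  constructor
  · rintro ⟨⟨s, acts, s'⟩, hr, rfl, rfl, h⟩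
    exact ⟨_, hr, fun i => h (e.symm i)⟩
  · rintro ⟨acts, hr, h⟩
    refine ⟨(c.state, fun i => acts (e i), d.state), ?_, rfl, rfl, fun i => ?_⟩
    · change (_, fun i => acts (e (e.symm i)), _) ∈ F.rules
      simpa using hr
    · obtain ⟨j, rfl⟩ := e.symm.surjective i
      have := h j
      change (acts (e (e.symm j))).Rel _ _
      rwa [e.apply_symm_apply]

theorem config_ext {M : QuadMachine} {e : Fin (M.work + 2) ≃ ι} {c d : M.Config}
    (h : c.state = d.state ∧ (fun i => c.tape (e.symm i)) = fun i => d.tape (e.symm i)) :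
    c = d := by
  obtain ⟨s, α⟩ := c
  obtain ⟨s', β⟩ := d
  obtain ⟨rfl : s = s', h⟩ := h
  have : α = β := funext fun i => by simpa using congrFun h (e i)
  rw [this]

theorem toMachine_isReversible (F : Frag ι) (e : Fin (w + 2) ≃ ι) :
    (F.toMachine e).IsReversible where
  deterministic _ _ _ h h' := config_ext (e := e) (F.det (toMachine_step.1 h) (toMachine_step.1 h'))
  codeterministic _ _ _ h h' :=
    config_ext (e := e) (F.codet (toMachine_step.1 h) (toMachine_step.1 h'))
  source_ne_halt _ h := F.source_ne_exit _ h
  target_ne_start _ h := F.target_ne_entry _ h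

theorem Reach.toMachine_steps {F : Frag ι} (e : Fin (w + 2) ≃ ι) {n s α s' β}
    (h : F.Reach n s α s' β) :
    (F.toMachine e).Steps n ⟨s, fun i => α (e i)⟩ ⟨s', fun i => β (e i)⟩ := by
  induction h with
  | refl => exact .refl _
  | tail _ hs ih =>
    refine ih.tail (toMachine_step.2 ?_)
    simpa using hs

end Frag

section machine

variable {U : QuadMachine}

instance : Finite (Ix U) := by
  have := U.finite_state
  refine Finite.of_surjective (fun a : (Fin (U.work + 2) ⊕ U.State) ⊕ Fin 15 => match a with
    | .inl (.inl i) => Ix.ur i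
    | .inl (.inr s) => .st s
    | .inr i => ![.x, .p, .level, .unit, .block, .ruler, .cand, .drop, .kept, .clock, .mism,
        .hits, .iter, .bad, .stuck] i) ?_
  rintro (i | s | _ | _ | _ | _ | _ | _ | _ | _ | _ | _ | _ | _ | _ | _ | _)
  · exact ⟨.inl (.inl i), rfl⟩
  · exact ⟨.inl (.inr s), rfl⟩
  · exact ⟨.inr 0, rfl⟩
  · exact ⟨.inr 1, rfl⟩
  · exact ⟨.inr 2, rfl⟩
  · exact ⟨.inr 3, rfl⟩
  · exact ⟨.inr 4, rfl⟩
  · exact ⟨.inr 5, rfl⟩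
  · exact ⟨.inr 6, rfl⟩
  · exact ⟨.inr 7, rfl⟩
  · exact ⟨.inr 8, rfl⟩
  · exact ⟨.inr 9, rfl⟩
  · exact ⟨.inr 10, rfl⟩
  · exact ⟨.inr 11, rfl⟩
  · exact ⟨.inr 12, rfl⟩
  · exact ⟨.inr 13, rfl⟩
  · exact ⟨.inr 14, rfl⟩

theorem bare_get_of_ne {x p : Tape (Option Bool)} {i : Ix U} (hx : i ≠ .x) (hp : i ≠ .p) :
    (bare U x p).get i = word [] 1 := by
  rw [word_nil 1 0]
  cases i <;> first | rfl | exact absurd rfl hx | exact absurd rfl hp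

/-- A program that turns `x` and `p` into `y` and `q` and leaves the other tapes blank is a
machine that computes this. -/
theorem exists_machine (F : Frag (Ix U)) : ∃ M : QuadMachine, M.IsReversible ∧
    ∀ (T : ℕ) (x p y q : List Bool), F.Run T (bare U (word x 1) (word p 1)).get
      (bare U (word y 1) (word q 1)).get → M.ComputesIn T x p y q := by
  obtain ⟨w, e, h0, h1⟩ := exists_equiv_fin_of_ne (a := Ix.x (U := U)) (b := .p) (by simp)
  refine ⟨F.toMachine e, F.toMachine_isReversible e, fun T x p y q ⟨t, ht, h⟩ => ⟨t, ht, ?_⟩⟩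
  have key : ∀ (s : F.State) (u v : List Bool), (F.toMachine e).pairConfig s u v =
      ⟨s, fun i => (bare U (word u 1) (word v 1)).get (e i)⟩ := by
    intro s u v
    refine congrArg (QuadMachine.Config.mk (M := F.toMachine e) s) (funext fun i => ?_)
    change Fin (w + 2) at i
    split_ifs with hi hi'
    · subst hi
      rw [← word_one]
      exact (congrArg (bare U (word u 1) (word v 1)).get h0).symm
    · subst hi'
      rw [← word_one]
      exact (congrArg (bare U (word u 1) (word v 1)).get h1).symm
    · rw [bare_get_of_ne, word_one]; · rfl
      · rw [← h0]; exact fun h => hi (e.injective h)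
      · rw [← h1]; exact fun h => hi' (e.injective h)
  have := h.toMachine_steps e
  rw [← key, ← key] at this
  exact this

end machine

/-! ### Strings that are hard to erase -/

theorem bits_add (a b i : ℕ) : bits (a + b) i = bits a i ++ bits b (i / 2 ^ a) := by
  refine List.ext_getElem? fun t => ?_
  rcases lt_or_ge t a with h | h
  · rw [List.getElem?_append_left (by simpa using h)]
    simp only [getElem?_bits, h, show t < a + b by omega]
  · rw [List.getElem?_append_right (by simpa using h)]
    simp only [length_bits, getElem?_bits, Nat.testBit_div_two_pow,
      show t - a < b ↔ t < a + b by omega, show t - a + a = t by omega]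

theorem bits_add_mul (a b i j : ℕ) : bits (a + b) (i % 2 ^ a + 2 ^ a * j) = bits a i ++ bits b j := by
  rw [bits_add]
  congr 1
  · refine List.ext_getElem? fun t => ?_
    simp only [getElem?_bits]
    split_ifs with h
    · rw [add_comm, Nat.testBit_two_pow_mul_add _ (Nat.mod_lt _ (Nat.two_pow_pos a)), if_pos h,
        Nat.testBit_mod_two_pow]
      simp [h]
    · rfl
  · rw [Nat.add_mul_div_left _ _ (Nat.two_pow_pos a), Nat.div_eq_of_lt (Nat.mod_lt _
      (Nat.two_pow_pos a)), zero_add]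

section hard

variable {U : QuadMachine}

theorem Hits.congr {l l' q : List Bool} {N W : ℕ} (h : Hits U l q N W)
    (hl : ∀ i < N, l'[i]? = l[i]?) : Hits U l' q N W :=
  ⟨h.1, fun i hi => (hl i hi).trans (h.2 i hi)⟩

/-- No short program hits the first `L` bits of `i`; the time allowed to a program depends on
its length. -/
def Hard (U : QuadMachine) (n γ g L i : ℕ) : Prop :=
  ∀ q : List Bool, q.length + γ ≤ L →
    ¬ Hits U (bits L i) q (q.length + γ) (n * ((L - (q.length + γ)) / g + 1))

open scoped Classical in
-- The backward run from `q` fixes the low `N` bits of every string it hits, leaving `L - N` free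
-- ones.
theorem card_hits_le (q : List Bool) {N L : ℕ} (W : ℕ) (h : N ≤ L) :
    ((Finset.range (2 ^ L)).filter fun i => Hits U (bits L i) q N W).card ≤ 2 ^ (L - N) := by
  rw [← Finset.card_range (2 ^ (L - N))]
  refine Finset.card_le_card_of_injOn (· / 2 ^ N) (fun i hi => ?_) fun i hi j hj hij => ?_
  · simp only [Finset.coe_filter, Finset.mem_range, Set.mem_ofPred_eq] at hi
    simp only [Finset.coe_range, Set.mem_Iio]
    rw [Nat.div_lt_iff_lt_mul (Nat.two_pow_pos N), ← pow_add, Nat.sub_add_cancel h]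
    exact hi.1
  · simp only [Finset.coe_filter, Finset.mem_range, Set.mem_ofPred_eq] at hi hj
    refine Nat.eq_of_testBit_eq fun t => ?_
    rcases lt_or_ge t N with ht | ht
    · have := (hi.2.2 t ht).trans (hj.2.2 t ht).symm
      simpa only [getElem?_bits, show t < L by omega, if_true, Option.some.injEq] using this
    · have := congrArg (·.testBit (t - N)) hij
      simpa only [Nat.testBit_div_two_pow, Nat.sub_add_cancel ht] using this

/-- Union bound: the `2^l` programs of length `l` hit at most `2^(L-l-γ)` strings each, hence
`2^(L-γ)` per length. The time bounds play no role in this count. -/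
theorem exists_hard (U : QuadMachine) (n g : ℕ) {γ L : ℕ} (h : γ ≤ L) (h' : L - γ + 1 < 2 ^ γ) :
    ∃ i < 2 ^ L, Hard U n γ g L i := by
  classical
  by_contra! hne
  have hsub : Finset.range (2 ^ L) ⊆ (Finset.range (L - γ + 1)).biUnion fun l =>
      (Finset.range (2 ^ l)).biUnion fun v => (Finset.range (2 ^ L)).filter fun i =>
        Hits U (bits L i) (bits l v) (l + γ) (n * ((L - (l + γ)) / g + 1)) := by
    intro i hi
    have := hne i (Finset.mem_range.1 hi)
    simp only [Hard, not_forall, not_not] at this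
    obtain ⟨q, hq, hh⟩ := this
    obtain ⟨v, hv, hvq⟩ := exists_bits q
    simp only [Finset.mem_biUnion, Finset.mem_filter]
    exact ⟨q.length, Finset.mem_range.2 (by omega), v, Finset.mem_range.2 hv, hi, hvq.symm ▸ hh⟩
  have hcard := Finset.card_le_card hsub
  rw [Finset.card_range] at hcard
  have hle : 2 ^ L ≤ (L - γ + 1) * 2 ^ (L - γ) := by
    refine hcard.trans (Finset.card_biUnion_le.trans ?_)
    rw [← smul_eq_mul, ← Finset.card_range (L - γ + 1), ← Finset.sum_const]
    rw [Finset.card_range]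
    refine Finset.sum_le_sum fun l hl => ?_
    rw [Finset.mem_range] at hl
    refine Finset.card_biUnion_le.trans ((Finset.sum_le_sum fun v _ =>
      card_hits_le _ _ (show l + γ ≤ L by omega)).trans ?_)
    rw [Finset.sum_const, Finset.card_range, smul_eq_mul, ← pow_add]
    exact Nat.pow_le_pow_right (by norm_num) (by omega)
  have : (L - γ + 1) * 2 ^ (L - γ) < 2 ^ γ * 2 ^ (L - γ) :=
    Nat.mul_lt_mul_of_pos_right h' (Nat.two_pow_pos _)
  rw [← pow_add, Nat.add_sub_cancel' h] at this
  omega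

/-- Division of `e + kg - |q|` by `g`: the quotient is the level that treats `q`, the remainder its
place within the block. -/
theorem levelCount_eq_zero_iff {s w : List Bool} {e γ g n k : ℕ} (hs : s.length = e + γ)
    (hg : 0 < g) : levelCount U s w e g n k = 0 ↔ ∀ q : List Bool, e < q.length →
      q.length ≤ e + k * g →
        ¬ Hits U (s ++ w) q (q.length + γ) (n * ((e + k * g - q.length) / g + 1)) := by
  simp only [levelCount, blockCount, hitCount, Finset.sum_eq_zero_iff, Finset.mem_range,
    ite_eq_right_iff, one_ne_zero, imp_false]
  constructor
  · intro h q hq hq' hh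
    obtain ⟨v, hv, hvq⟩ := exists_bits q
    set o := e + k * g - q.length with ho
    have ho' : o < k * g := by omega
    have hj : o / g < k := by rwa [Nat.div_lt_iff_lt_mul hg]
    have hi : o % g < g := Nat.mod_lt _ hg
    have hdm := Nat.div_add_mod o g
    have hk : (k - (o / g + 1)) * g + (o / g + 1) * g = k * g := by
      rw [← add_mul, Nat.sub_add_cancel hj]
    have hm : (o / g + 1) * g = g * (o / g) + g := by ring
    have hl : e + (k - (o / g + 1)) * g + (g - o % g) = q.length := by omega
    refine h (o / g) hj (o % g) hi v (by rwa [hl]) ?_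
    rw [hl, hvq, show s.length + ((k - (o / g + 1)) * g + (g - o % g)) = q.length + γ by omega]
    exact hh
  · intro h j hj i hi v _ hh
    have hk : (k - (j + 1)) * g + (j + 1) * g = k * g := by
      rw [← add_mul, Nat.sub_add_cancel hj]
    have hm : (j + 1) * g = g * j + g := by ring
    refine h (bits (e + (k - (j + 1)) * g + (g - i)) v) (by simp; omega)
      (by simp; omega) ?_
    rw [length_bits, show e + k * g - (e + (k - (j + 1)) * g + (g - i)) = i + g * j by omega,
      Nat.add_mul_div_left _ _ hg, Nat.div_eq_of_lt hi, zero_add]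
    rwa [show s.length + ((k - (j + 1)) * g + (g - i)) =
      e + (k - (j + 1)) * g + (g - i) + γ by omega] at hh

/-- The first candidate without hits leads to the first hard string, because a program that hits a
smaller candidate without hitting the kept part alone is counted. -/
theorem levelCount_of_hard {n γ g e k i : ℕ} (hg : 0 < g)
    (hi : Hard U n γ g (e + γ + k * g) i)
    (hmin : ∀ j < i, ¬ Hard U n γ g (e + γ + k * g) j) :
    (∀ a < i / 2 ^ (e + γ), levelCount U (bits (e + γ) i) (bits (k * g) a) e g n k ≠ 0) ∧
      levelCount U (bits (e + γ) i) (bits (k * g) (i / 2 ^ (e + γ))) e g n k = 0 := by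
  have hsub : ∀ q : List Bool, e + γ + k * g - (q.length + γ) = e + k * g - q.length :=
    fun q => by omega
  constructor
  · intro a ha h0
    -- The kept part occupies the low-order bits, so a smaller candidate gives a smaller string,
    -- which is not hard by minimality.
    have hlt : i % 2 ^ (e + γ) + 2 ^ (e + γ) * a < i := by
      have h1 := Nat.mod_add_div i (2 ^ (e + γ))
      have h2 := Nat.mul_lt_mul_of_pos_left ha (Nat.two_pow_pos (e + γ))
      omega
    refine hmin _ hlt fun q hq hh => ?_
    rw [bits_add_mul, hsub] at hh
    -- A program of length at most `e` compares at most `e + γ` bits, all in the kept part, and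
    -- would hit the hard string `i` as well.
    rcases le_or_gt q.length e with hqe | hqe
    · refine hi q hq ?_
      rw [hsub, bits_add]
      refine hh.congr fun t ht => ?_
      rw [List.getElem?_append_left (by simp; omega), List.getElem?_append_left (by simp; omega)]
    · exact (levelCount_eq_zero_iff (length_bits _ _) hg).1 h0 q hqe (by omega) hh
  · refine (levelCount_eq_zero_iff (length_bits _ _) hg).2 fun q _ hq hh => hi q (by omega) ?_
    rwa [hsub, bits_add]

/-- The machine erases the first hard string, with a loss that depends on the level. -/
theorem run_erase_of_hard (hU : U.IsReversible) {n γ e κ i B : ℕ} (hγ : 0 < γ)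
    (hn : n = e + γ + (κ + 1) * blockLength γ)
    (hi : Hard U n γ (blockLength γ) (e + γ + κ * blockLength γ) i)
    (hmin : ∀ j < i, ¬ Hard U n γ (blockLength γ) (e + γ + κ * blockLength γ) j)
    (hlt : i < 2 ^ (e + γ + κ * blockLength γ)) (hB : 3 * (n * (κ + 1)) + κ + γ + 2 ≤ B) :
    (erase hU).Run (2 ^ (n * (κ + 1) - γ) * (10000 * B ^ 3))
      (bare U (word (bits (e + γ + κ * blockLength γ) i ++
        List.replicate (blockLength γ) false) 1) (word (code κ γ) 1)).get
      (bare U (word [] 1) (word (code κ γ ++ bits (e + γ) i) 1)).get := by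
  have hg : 0 < blockLength γ := by unfold blockLength; omega
  obtain ⟨h1, h2⟩ := levelCount_of_hard hg hi hmin
  have hN : i / 2 ^ (e + γ) < 2 ^ (κ * blockLength γ) := by
    rwa [Nat.div_lt_iff_lt_mul (Nat.two_pow_pos _), ← pow_add, add_comm]
  set g := blockLength γ with hgdef
  set N := i / 2 ^ (e + γ) with hNdef
  have hκ : (κ + 1) * g = κ * g + g := by ring
  -- The level `j = κ - 1` is the most expensive: one level less costs a factor `2^g` in programs
  -- but saves `2^n` in time.
  have hE : ∀ j < κ, e + (κ - j) * g + ((bits (e + γ) i).length + (κ + 1) * g) * (j + 1) ≤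
      e + g + n * κ := by
    intro j hj
    rw [length_bits, ← hn]
    obtain ⟨a, rfl⟩ : ∃ a, κ = j + 1 + a := ⟨κ - (j + 1), by omega⟩
    have : a * g ≤ n * a := by
      rw [mul_comm]; exact Nat.mul_le_mul_right _ (by omega)
    have e1 : (j + 1 + a - j) * g = g + a * g := by
      rw [show j + 1 + a - j = 1 + a by omega]; ring
    have e2 : n * (j + 1 + a) = n * (j + 1) + n * a := by ring
    omega
  have := run_erase hU (bits (e + γ) i) κ γ e (e + g + n * κ) B N (length_bits _ _) hE
    (by rw [length_bits, ← hgdef, ← hn]; exact hB) (by rwa [length_bits, ← hgdef, ← hn])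
    (by rwa [length_bits, ← hgdef, ← hn])
  rw [← List.append_assoc, ← bits_add] at this
  refine this.mono (Nat.mul_le_mul_right _ ?_)
  -- At most `2^(κg)` candidates are tried, and `κg + e + g = n - γ`.
  calc (N + 1) * 2 ^ (e + g + n * κ) ≤ 2 ^ (κ * g) * 2 ^ (e + g + n * κ) :=
        Nat.mul_le_mul_right _ hN
    _ = 2 ^ (n * (κ + 1) - γ) := by
        rw [← pow_add]
        congr 1
        rw [Nat.mul_succ]
        omega

/-- A fast computation that erases a string makes its output hit this string. -/
theorem hits_of_computesIn (hU : U.IsReversible) {x p q : List Bool} {t N W : ℕ}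
    (h : U.ComputesIn t x p [] q) (ht : t ≤ 2 ^ W) : Hits U x q N W := by
  obtain ⟨T, hT, h⟩ := h
  have := retreat_iterate_eq_start hU h rfl (hT.trans ht)
  refine ⟨?_, fun i _ => ?_⟩
  · rw [origin, this]; rfl
  · rw [origin, this, ← word_nth_nat, word_one]; rfl

end hard

/-! ### The hierarchy -/

section parameters

/-- The exponent is 16 + 1: `n^8` is of order `γ^16`, and one more factor `γ + 1` absorbs the
constants that depend on the machine. -/
theorem exists_pow_le_two_pow : ∃ γ₀ : ℕ, ∀ γ ≥ γ₀, (γ + 1) ^ 17 ≤ 2 ^ γ := by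
  have h := (tendsto_pow_const_div_const_pow_of_one_lt 17 (r := (2 : ℝ)) (by norm_num)).eventually
    (gt_mem_nhds (show (0 : ℝ) < 1 / 2 by norm_num))
  obtain ⟨γ₀, h⟩ := Filter.eventually_atTop.1 h
  refine ⟨γ₀, fun γ hγ => ?_⟩
  have := h (γ + 1) (by omega)
  rw [div_lt_iff₀ (by positivity), pow_succ (2 : ℝ)] at this
  have h' : ((γ + 1 : ℕ) : ℝ) ^ 17 ≤ 2 ^ γ := by linarith
  exact_mod_cast h'

/-- The time of the universal machine is below `2 ^ K`. -/
theorem time_le {c γ n K t P : ℕ} (hγ : γ ≤ K) (hK : K ≤ n ^ 2)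
    (ht : t ≤ 2 ^ (K - γ) * P) (hP : (c + 1) * (P * n ^ 2 + 1) ≤ 2 ^ γ) (hP' : P ≤ 2 ^ γ) :
    c * (t * Nat.log 2 t) + c ≤ 2 ^ K := by
  have hs : 2 ^ (K - γ) * 2 ^ γ = 2 ^ K := by rw [← pow_add, Nat.sub_add_cancel hγ]
  have hlog : Nat.log 2 t ≤ n ^ 2 := by
    refine le_trans ?_ hK
    calc Nat.log 2 t ≤ Nat.log 2 (2 ^ K) :=
          Nat.log_mono_right (ht.trans (hs ▸ Nat.mul_le_mul_left _ hP'))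
      _ = K := Nat.log_pow (by norm_num) K
  calc c * (t * Nat.log 2 t) + c ≤ c * ((2 ^ (K - γ) * P) * n ^ 2) + c * 2 ^ (K - γ) :=
        Nat.add_le_add (Nat.mul_le_mul_left _ (Nat.mul_le_mul ht hlog))
          (Nat.le_mul_of_pos_right _ (Nat.two_pow_pos _))
    _ = 2 ^ (K - γ) * (c * (P * n ^ 2 + 1)) := by ring
    _ ≤ 2 ^ (K - γ) * 2 ^ γ := Nat.mul_le_mul_left _
        ((Nat.mul_le_mul_right _ (Nat.le_succ c)).trans hP)
    _ = 2 ^ K := hs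

theorem irrevCost_le {M : QuadMachine} {t : ℕ → ℕ} {x y p q : List Bool} {a : ℕ}
    (h : M.ComputesIn (t x.length) x p y q) (ha : p.length + q.length ≤ a) :
    M.irrevCost t x y ≤ a :=
  (iInf_le_of_le p (iInf_le_of_le q (iInf_le_of_le h le_rfl))).trans (by exact_mod_cast ha)

theorem lt_irrevCost {M : QuadMachine} {t : ℕ → ℕ} {x y : List Bool} {a : ℕ}
    (h : ∀ p q, M.ComputesIn (t x.length) x p y q → a < p.length + q.length) :
    a < M.irrevCost t x y := by
  refine lt_of_lt_of_le (b := ((a + 1 : ℕ) : ℕ∞)) (by exact_mod_cast Nat.lt_succ_self a) ?_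
  exact le_iInf fun p => le_iInf fun q => le_iInf fun hpq => by exact_mod_cast h p q hpq

end parameters

/-- The cost of erasing is small at each level and large at the levels below. -/
theorem exists_hierarchy {U : QuadMachine} (hU : U.IsUniversalReversible) : ∃ n₀ : ℕ,
    ∀ n m : ℕ, n₀ ≤ n → 4 * m ^ 2 ≤ n → n < 4 * (m + 1) ^ 2 →
      ∃ (x : List Bool) (a : ℕ → ℕ), x.length = n ∧ ∀ k, 1 ≤ k → k ≤ m →
        U.irrevCost (expTime k) x [] ≤ a k ∧
          ∀ j, 1 ≤ j → j < k → a k < U.irrevCost (expTime j) x [] := by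
  obtain ⟨M, hM, hrun⟩ := exists_machine (erase hU.1)
  obtain ⟨c, hc⟩ := hU.2 M hM
  obtain ⟨γ₀, hγ₀⟩ := exists_pow_le_two_pow
  -- A lower bound for `γ`; the second summand dominates `c + 1` times the numerical constants in
  -- `hlarge`.
  set G := γ₀ + (c + 1) * (2 ^ 100 + 1) with hG
  refine ⟨64 * (G + 1) ^ 2, fun n m hn hm hm' => ?_⟩
  obtain ⟨γ, hγ⟩ : ∃ γ, γ = m / 4 := ⟨_, rfl⟩
  have hGγ : G ≤ γ := by
    have : 16 * (G + 1) ^ 2 < (m + 1) ^ 2 := by omega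
    have : 4 * (G + 1) < m + 1 := by
      refine lt_of_pow_lt_pow_left₀ 2 (by omega) ?_
      calc (4 * (G + 1)) ^ 2 = 16 * (G + 1) ^ 2 := by ring
        _ < _ := this
    omega
  have hc0 : (c + 1) * 1 ≤ (c + 1) * (2 ^ 100 + 1) := Nat.mul_le_mul_left _ (by norm_num)
  have hγc : 8 + c ≤ γ := by omega
  have hpow : (γ + 1) ^ 17 ≤ 2 ^ γ := hγ₀ γ (by omega)
  have hnγ : n ≤ 64 * (γ + 1) ^ 2 := by
    have : (m + 1) ^ 2 ≤ (4 * (γ + 1)) ^ 2 := Nat.pow_le_pow_left (by omega) 2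
    have e : (4 * (γ + 1)) ^ 2 = 16 * (γ + 1) ^ 2 := by ring
    omega
  clear hm'
  obtain ⟨g, hg⟩ : ∃ g, g = blockLength γ := ⟨_, rfl⟩
  have hg' : g = 12 * γ := hg
  have hm1 : 1 ≤ m := by omega
  have hmm : m ≤ m ^ 2 := Nat.le_self_pow (by norm_num) m
  -- Even at the top level `kg ≤ 3m²`, while `n ≥ 4m²`; the remaining `m²` leaves room for a kept
  -- part of at least `γ` bits.
  have hmg : m * g ≤ 3 * m ^ 2 := by
    calc m * g ≤ m * (3 * m) := Nat.mul_le_mul_left _ (by omega)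
      _ = _ := by ring
  have hgn : g + γ ≤ n := by
    have : 1 * g ≤ m * g := Nat.mul_le_mul_right _ hm1
    omega
  have hbig : n ^ 8 ≤ 2 ^ 48 * (γ + 1) ^ 16 :=
    (Nat.pow_le_pow_left hnγ 8).trans (le_of_eq (by ring))
  have hlarge : (c + 1) * (2 ^ 20 * n ^ 6 * n ^ 2 + 1) ≤ 2 ^ γ := by
    have h1 : 1 ≤ (γ + 1) ^ 16 := Nat.one_le_pow _ _ (by omega)
    calc (c + 1) * (2 ^ 20 * n ^ 6 * n ^ 2 + 1) = (c + 1) * (2 ^ 20 * n ^ 8 + 1) := by ring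
      _ ≤ (c + 1) * ((2 ^ 100 + 1) * (γ + 1) ^ 16) := Nat.mul_le_mul_left _ (by omega)
      _ = ((c + 1) * (2 ^ 100 + 1)) * (γ + 1) ^ 16 := by ring
      _ ≤ (γ + 1) * (γ + 1) ^ 16 := Nat.mul_le_mul_right _ (by omega)
      _ = (γ + 1) ^ 17 := by ring
      _ ≤ 2 ^ γ := hpow
  have hn1 : 1 ≤ n := by omega
  have hn2 : n ≤ n ^ 2 := Nat.le_self_pow (by norm_num) n
  have hn6 : n ^ 2 ≤ n ^ 6 := Nat.pow_le_pow_right hn1 (by norm_num)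
  have hP : 2 ^ 20 * n ^ 6 ≤ 2 ^ γ := by
    refine le_trans ?_ hlarge
    have h1 : 2 ^ 20 * n ^ 6 * 1 ≤ 2 ^ 20 * n ^ 6 * n ^ 2 :=
      Nat.mul_le_mul_left _ (Nat.one_le_pow _ _ hn1)
    have h2 : 1 * (2 ^ 20 * n ^ 6 * n ^ 2 + 1) ≤ (c + 1) * (2 ^ 20 * n ^ 6 * n ^ 2 + 1) :=
      Nat.mul_le_mul_right _ (by omega)
    omega
  have hex : ∃ i, Hard U n γ g (n - g) i :=
    let ⟨i, _, hi⟩ := exists_hard U n g (γ := γ) (L := n - g) (by omega) (by omega)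
    ⟨i, hi⟩
  obtain ⟨i, hi, hlt, hmin⟩ : ∃ i, Hard U n γ g (n - g) i ∧ i < 2 ^ (n - g) ∧
      ∀ j < i, ¬ Hard U n γ g (n - g) j := by
    classical
    obtain ⟨i₀, h₀, hi₀⟩ := exists_hard U n g (γ := γ) (L := n - g) (by omega) (by omega)
    exact ⟨Nat.find hex, Nat.find_spec hex, (Nat.find_min' hex hi₀).trans_lt h₀,
      fun j hj => Nat.find_min hex hj⟩
  set x := bits (n - g) i ++ List.replicate g false with hx
  have hxn : x.length = n := by
    rw [hx, List.length_append, length_bits, List.length_replicate]; omega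
  -- The code has length `k + γ + 1` and is counted in the input and in the garbage; the garbage
  -- also holds the kept bits.
  refine ⟨x, fun k => 2 * (k + γ + 1) + (n - k * g) + c, hxn, fun k hk hkm => ?_⟩
  obtain ⟨κ, rfl⟩ := Nat.exists_eq_add_of_le' hk
  have hκg : (κ + 1) * g = κ * g + g := by ring
  have hκm : (κ + 1) * g ≤ m * g := Nat.mul_le_mul_right _ hkm
  obtain ⟨e, he⟩ : ∃ e, n = e + γ + (κ + 1) * g := ⟨n - (κ + 1) * g - γ, by omega⟩
  have hL : n - g = e + γ + κ * g := by omega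
  refine ⟨?_, fun j hj hjk => lt_irrevCost fun p q hpq => ?_⟩
  · obtain ⟨B, hB⟩ : ∃ B, B = 3 * (n * (κ + 1)) + κ + γ + 2 := ⟨_, rfl⟩
    have hnκ : n * (κ + 1) ≤ n ^ 2 := by
      rw [pow_two]; exact Nat.mul_le_mul_left _ (by omega)
    have hBn : B ^ 3 ≤ 64 * n ^ 6 :=
      (Nat.pow_le_pow_left (show B ≤ 4 * n ^ 2 by omega) 3).trans (le_of_eq (by ring))
    rw [hL, hg] at hi hmin hlt
    have h1 := run_erase_of_hard hU.1 (by omega) (he.trans (by rw [hg])) hi hmin hlt hB.ge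
    rw [← hg, ← hL, ← hx] at h1
    obtain ⟨p', q', hl, hcomp⟩ := hc _ _ _ _ _ (hrun _ _ _ _ _ h1)
    have hKγ : γ ≤ n * (κ + 1) := (show γ ≤ n by omega).trans (Nat.le_mul_of_pos_right _ hk)
    have ht : 2 ^ (n * (κ + 1) - γ) * (10000 * B ^ 3) + x.length + (code κ γ).length ≤
        2 ^ (n * (κ + 1) - γ) * (2 ^ 20 * n ^ 6) := by
      have h2 := Nat.le_mul_of_pos_left (n + (κ + γ + 2)) (Nat.two_pow_pos (n * (κ + 1) - γ))
      rw [hxn, length_code, add_assoc]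
      refine (Nat.add_le_add_left h2 _).trans ?_
      rw [← mul_add]
      exact Nat.mul_le_mul_left _ (by omega)
    have htime := time_le hKγ hnκ ht hlarge hP
    refine irrevCost_le (p := p') (q := q') ?_ (hl.trans ?_)
    · obtain ⟨T, hT, h⟩ := hcomp
      refine ⟨T, hT.trans (htime.trans (le_of_eq ?_)), h⟩
      rw [expTime, hxn, mul_comm]
    · rw [List.length_append, length_code, length_bits]
      beta_reduce
      omega
  · by_contra! hle
    obtain ⟨κ', rfl⟩ : ∃ κ', κ = κ' + 1 := ⟨κ - 1, by omega⟩
    have hκg' : (κ' + 1) * g = κ' * g + g := by ring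
    -- Here `k = κ' + 2`. The claim reduces to `2(k+γ+1) + c + γ ≤ 12γ`, which follows from `k ≤ m ≤
    -- 4γ + 3` and `8 + c ≤ γ`; this is the reason for the factor 12 in `blockLength`.
    have hq : κ' * g + (q.length + γ) ≤ n - g := by omega
    refine hi q (by omega) ((hits_of_computesIn hU.1 hpq ?_).congr fun t ht => ?_)
    · rw [expTime, hxn, mul_comm]
      refine Nat.pow_le_pow_right (by norm_num) (Nat.mul_le_mul_left _ ?_)
      -- So `q` is allowed at least `2^(n(κ'+1))` backward steps, and `j ≤ κ' + 1`.
      have : κ' ≤ (n - g - (q.length + γ)) / g := by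
        rw [Nat.le_div_iff_mul_le (by omega)]; omega
      omega
    · rw [hx, List.getElem?_append_left (by rw [length_bits]; omega)]

end RevMachine

theorem mainTheorem2 (UR : QuadMachine) (hUR : UR.IsUniversalReversible) :
    ∃ n₀ : ℕ, ∀ n : ℕ, n₀ ≤ n → ∃ x : List Bool, x.length = n ∧
      (∀ k : ℕ, 1 ≤ k → k ≤ ⌊√(n : ℝ) / 2⌋₊ → UR.irrevCost (expTime k) x [] ≠ ⊤) ∧
      (∀ j k : ℕ, 1 ≤ j → j < k → k ≤ ⌊√(n : ℝ) / 2⌋₊ →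
        expTime j n < expTime k n ∧
          UR.irrevCost (expTime k) x [] < UR.irrevCost (expTime j) x []) := by
  obtain ⟨n₀, h⟩ := RevMachine.exists_hierarchy hUR
  refine ⟨n₀ + 1, fun n hn => ?_⟩
  obtain ⟨m, hm⟩ : ∃ m, m = ⌊√(n : ℝ) / 2⌋₊ := ⟨_, rfl⟩
  have h1 : 4 * m ^ 2 ≤ n := by
    have : (m : ℝ) ≤ √n / 2 := hm ▸ Nat.floor_le (by positivity)
    have h2 : (2 * m : ℝ) ^ 2 ≤ n := by
      rw [← Real.sq_sqrt (Nat.cast_nonneg n)]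
      exact pow_le_pow_left₀ (by positivity) (by linarith) 2
    have : ((4 * m ^ 2 : ℕ) : ℝ) ≤ n := by push_cast; linarith
    exact_mod_cast this
  have h2 : n < 4 * (m + 1) ^ 2 := by
    have : √n / 2 < (m : ℝ) + 1 := hm ▸ Nat.lt_floor_add_one _
    have h2 : (n : ℝ) < (2 * (m + 1)) ^ 2 := by
      rw [← Real.sqrt_lt' (by positivity)]
      linarith
    have : (n : ℝ) < ((4 * (m + 1) ^ 2 : ℕ) : ℝ) := by push_cast; linarith
    exact_mod_cast this
  obtain ⟨x, a, hx, hxa⟩ := h n m (by omega) h1 h2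
  rw [← hm]
  refine ⟨x, hx, fun k hk hkm => ?_, fun j k hj hjk hkm => ⟨?_, ?_⟩⟩
  · exact ne_top_of_le_ne_top (ENat.natCast_ne_top _) (hxa k hk hkm).1
  · exact Nat.pow_lt_pow_right (by norm_num) (Nat.mul_lt_mul_of_pos_right hjk (by omega))
  · obtain ⟨hle, hlt⟩ := hxa k (by omega) hkm
    exact hle.trans_lt (hlt j hj hjk)
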